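/- **Theorem 8.2.** Let $\mathcal B$ be a $W^*$-algebra and let $E$ be a faithful $W^*$-correspondence over $\mathcal B$; that is, $E$ is a self-dual Hilbert $\mathcal B$-module (every bounded right $\mathcal B$-linear map $E\to\mathcal B$ has the form $y\mapsto\langle x,y\rangle$ for some $x\in E$) with a nondegenerate left action of $\mathcal B$ by adjointable operators such that all maps $b\mapsto\langle x,bx\rangle$ $(x\in E)$ are normal and the left action $\mathcal B\to\mathcal B^a(E)$ is injective. Then $E$ admits a normal, faithful, nondegenerate representation on a Hilbert space. That is, there exist a Hilbert space $G$, a nondegenerate $*$-representation $\pi\colon\mathcal B\to\mathcal B(G)$ and a linear map $\eta\colon E\to\mathcal B(G)$ with $$\eta(bxb')=\pi(b)\eta(x)\pi(b'),\qquad \eta(x)^*\eta(y)=\pi(\langle x,y\rangle)\qquad(b,b'\in\mathcal B,\ x,y\in E)$$ such that $\pi$ and $\eta$ are injective, $\overline{\operatorname{span}}\,\eta(E)G=G$, and $\pi$ and $\eta$ are normal. Here a linear map between $W^*$-algebras is normal if it is $\sigma$-weakly continuous, and $\eta$ is normal if it is the restriction to the 2-1-corners of a normal linear map between the extended linking algebras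 $\begin{pmatrix}\mathcal B&E^*\\E&\mathcal B^a(E)\end{pmatrix}$ of $E$ and $M_2(\mathcal B(G))$ of $\mathcal B(G)$ (as a Hilbert module over itself). -/

import Mathlib

open scoped InnerProductSpace WithCStarModule

universe u v w

/-! ## Normal linear maps

On a W⋆-algebra the predual is the linear span of the normal positive functionals, that is, of the
positive functionals that respect suprema of bounded increasing nets.  A linear map between
W⋆-algebras is normal if it is σ-weakly continuous.  Both notions only use the linear structure and
the order, and they are stated for an arbitrary ordered complex vector space. -/

section Normal

open scoped ComplexOrder

/-- The normal linear functionals on `M`: the span of the functionals that respect suprema of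
increasing nets (such a functional is automatically monotone, hence positive). -/
def normalFunctionals (M : Type u) [AddCommGroup M] [Module ℂ M] [PartialOrder M] :
    Submodule ℂ (M →ₗ[ℂ] ℂ) :=
  Submodule.span ℂ {φ | ScottContinuous φ}

/-- A linear map is normal if it is continuous for the σ-weak topologies, that is, if it pulls
normal functionals back to normal functionals. -/
def IsNormalMap {M : Type u} {N : Type v} [AddCommGroup M] [Module ℂ M] [PartialOrder M]
    [AddCommGroup N] [Module ℂ N] [PartialOrder N] (f : M →ₗ[ℂ] N) : Prop :=
  ∀ ψ ∈ normalFunctionals N, ψ ∘ₗ f ∈ normalFunctionals M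

end Normal

/-! ## Adjointable operators and the extended linking algebra

Mathlib's `CStarModule A F` is a Hilbert module with the algebra acting from the left and
`⟪x, a • y⟫_A = a * ⟪x, y⟫_A`.  A (right) Hilbert `B`-module with `⟨x, y b⟩ = ⟨x, y⟩ b` is the
same thing as a `CStarModule Bᵐᵒᵖ F`. -/

section Adjointable

variable {A : Type u} {F : Type v} [CStarAlgebra A] [PartialOrder A] [StarOrderedRing A]
  [NormedAddCommGroup F] [NormedSpace ℂ F] [Module A F] [CStarModule A F]

set_option linter.unusedSectionVars false

theorem cstarModule_ext {x y : F} (h : ∀ z : F, ⟪z, x⟫_A = ⟪z, y⟫_A) : x = y := by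
  have h1 : ⟪x - y, x - y⟫_A = 0 := by
    rw [CStarModule.inner_sub_right, h, sub_self]
  exact sub_eq_zero.mp (CStarModule.inner_self.mp h1)

theorem cstarModule_ext_diag {x : F} {T S : F →ₗ[ℂ] F}
    (h : ∀ z : F, ⟪z, T z⟫_A = ⟪z, S z⟫_A) : T x = S x := by
  have hD : ∀ z : F, ⟪z, (T - S) z⟫_A = 0 := fun z => by
    rw [LinearMap.sub_apply, CStarModule.inner_sub_right, h, sub_self]
  have key : ∀ y : F, ⟪y, (T - S) x⟫_A = 0 := fun y => by
    have h1 := hD (y + x)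
    have h2 := hD (y + Complex.I • x)
    simp only [map_add, map_smul, CStarModule.inner_add_right, CStarModule.inner_add_left,
      CStarModule.inner_smul_right_complex, CStarModule.inner_smul_left_complex, hD, smul_zero,
      zero_add, add_zero] at h1 h2
    have h3 : Complex.I • (⟪y, (T - S) x⟫_A - ⟪x, (T - S) y⟫_A) = 0 := by
      rw [← h2, smul_sub]
      simp [sub_eq_add_neg]
      abel
    have h4 := (smul_eq_zero.mp h3).resolve_left Complex.I_ne_zero
    have h5 : (2 : ℂ) • ⟪y, (T - S) x⟫_A = 0 := by
      rw [two_smul]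
      nth_rewrite 2 [sub_eq_zero.mp h4]
      rw [add_comm] at h1
      exact h1
    exact (smul_eq_zero.mp h5).resolve_left two_ne_zero
  refine cstarModule_ext (A := A) fun y => ?_
  have := key y
  rw [LinearMap.sub_apply, CStarModule.inner_sub_right] at this
  exact sub_eq_zero.mp this

variable (A F) in
/-- The algebra of adjointable operators on a Hilbert module. -/
def adjointableOps : Subalgebra ℂ (Module.End ℂ F) where
  carrier := {T | ∃ S : Module.End ℂ F, ∀ x y : F, ⟪T x, y⟫_A = ⟪x, S y⟫_A}
  mul_mem' := by
    rintro T₁ T₂ ⟨S₁, h₁⟩ ⟨S₂, h₂⟩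
    exact ⟨S₂ * S₁, fun x y => by simp [h₁, h₂]⟩
  add_mem' := by
    rintro T₁ T₂ ⟨S₁, h₁⟩ ⟨S₂, h₂⟩
    exact ⟨S₁ + S₂, fun x y => by simp [h₁, h₂]⟩
  algebraMap_mem' := by
    intro z
    exact ⟨algebraMap ℂ _ (star z), fun x y => by simp [Module.algebraMap_end_apply]⟩

/-- The order of the C⋆-algebra of adjointable operators: `T ≤ S` if and only if
`⟨x, T x⟩ ≤ ⟨x, S x⟩` for all `x`. -/
instance adjointableOps.instPartialOrder : PartialOrder (adjointableOps A F) where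
  le T S := ∀ x : F, ⟪x, (T : Module.End ℂ F) x⟫_A ≤ ⟪x, (S : Module.End ℂ F) x⟫_A
  le_refl _ _ := le_rfl
  le_trans _ _ _ h₁ h₂ x := (h₁ x).trans (h₂ x)
  le_antisymm T S h₁ h₂ := by
    refine Subtype.ext (LinearMap.ext fun x => ?_)
    exact cstarModule_ext_diag (A := A) fun z => le_antisymm (h₁ z) (h₂ z)

variable (A F) in
/-- The extended linking algebra of a Hilbert module `F` over the unital algebra `A`: the
adjointable operators on the direct sum `A ⊕ F`, that is, the `2 × 2` matrices with entries in
`A`, `F⋆`, `F` and in the adjointable operators on `F`. -/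
abbrev LinkingAlgebra : Type (max u v) := adjointableOps A C⋆ᵐᵒᵈ(A, A × F)

/-- The element of the extended linking algebra with entry `x` in the 2-1-corner and `0` elsewhere:
it sends `(a, y)` to `(0, x a)` (the action of `a` on `x` being written `a • x` here). -/
def linkingCorner (x : F) : LinkingAlgebra A F :=
  ⟨{  toFun := fun p => ((0, p.1 • x) : A × F)
      map_add' := fun p q => by
        refine Prod.ext ?_ ?_
        · exact (add_zero (0 : A)).symm
        · exact add_smul p.1 q.1 x
      map_smul' := fun z p => by
        refine Prod.ext ?_ ?_
        · exact (smul_zero z).symm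
        · refine cstarModule_ext (A := A) fun w => ?_
          change ⟪w, (z • p.1) • x⟫_A = ⟪w, z • (p.1 • x)⟫_A
          simp },
    { toFun := fun p => ((⟪x, p.2⟫_A, 0) : A × F)
      map_add' := fun p q => by
        refine Prod.ext ?_ ?_
        · exact CStarModule.inner_add_right
        · exact (add_zero (0 : F)).symm
      map_smul' := fun z p => by
        refine Prod.ext ?_ ?_
        · exact CStarModule.inner_smul_right_complex
        · exact (smul_zero z).symm },
    fun p q => by
      change ⟪(0 : A), q.1⟫_A + ⟪p.1 • x, q.2⟫_A = ⟪p.1, ⟪x, q.2⟫_A⟫_A + ⟪p.2, (0 : F)⟫_A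
      simp [WithCStarModule.inner_def]⟩

end Adjointable

/-- A map `η` between self-dual Hilbert modules `E` over `A` and `F` over `C` is normal if it is the
restriction to the 2-1-corners of a normal map between the extended linking algebras. -/
def IsNormalModuleMap {A : Type*} {E : Type*} {C : Type*} {F : Type*}
    [CStarAlgebra A] [PartialOrder A] [StarOrderedRing A]
    [NormedAddCommGroup E] [NormedSpace ℂ E] [Module A E] [CStarModule A E]
    [CStarAlgebra C] [PartialOrder C] [StarOrderedRing C]
    [NormedAddCommGroup F] [NormedSpace ℂ F] [Module C F] [CStarModule C F]
    (η : E → F) : Prop :=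
  ∃ P : LinkingAlgebra A E →ₗ[ℂ] LinkingAlgebra C F, IsNormalMap P ∧
    ∀ x : E, P (linkingCorner x) = linkingCorner (η x)

/-! ## W⋆-correspondences -/

section Correspondence

open MulOpposite

variable (B : Type u) (E : Type v) [CStarAlgebra B] [PartialOrder B] [StarOrderedRing B]
  [NormedAddCommGroup E] [NormedSpace ℂ E] [Module Bᵐᵒᵖ E] [CStarModule Bᵐᵒᵖ E]

variable {E} in
/-- The `B`-valued inner product of a right Hilbert `B`-module, linear in the second variable, as a
linear map in that variable. -/
def rightInner (x : E) : E →ₗ[ℂ] B where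
  toFun y := unop ⟪x, y⟫_Bᵐᵒᵖ
  map_add' y z := by simp
  map_smul' c y := by simp

/-- Self-duality: every bounded right linear map `E → B` is of the form `y ↦ ⟨x, y⟩`. -/
def IsSelfDual : Prop :=
  ∀ Φ : E →L[ℂ] B, (∀ (x : E) (b : B), Φ (op b • x) = Φ x * b) →
    ∃ x : E, ∀ y : E, Φ y = rightInner B x y

/-- A W⋆-correspondence structure over `B` on the right Hilbert `B`-module `E`: a nondegenerate left
action of `B` by adjointable operators, such that `E` is self-dual and all maps
`b ↦ ⟨x, b x⟩` are normal. -/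
structure WStarCorrespondence where
  /-- The left action. -/
  lact : B →ₙₐ[ℂ] Module.End ℂ E
  inner_lact : ∀ (b : B) (x y : E),
    rightInner B (lact b x) y = rightInner B x (lact (star b) y)
  nondegenerate :
    (Submodule.span ℂ {z : E | ∃ (b : B) (x : E), z = lact b x}).topologicalClosure = ⊤
  selfDual : IsSelfDual B E
  normal : ∀ x : E,
    IsNormalMap (rightInner B x ∘ₗ LinearMap.applyₗ x ∘ₗ (lact : B →ₗ[ℂ] Module.End ℂ E))

variable {B E}

/-- A W⋆-correspondence is faithful if its left action is faithful. -/
def WStarCorrespondence.IsFaithful (X : WStarCorrespondence B E) : Prop :=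
  Function.Injective X.lact

/-- A representation `(π, η)` of a correspondence on a Hilbert space `G`, where, as always, `π` is
a nondegenerate representation of `B`. -/
structure WStarCorrespondence.Representation (X : WStarCorrespondence B E)
    (G : Type w) [NormedAddCommGroup G] [InnerProductSpace ℂ G] [CompleteSpace G] where
  π : B →⋆ₙₐ[ℂ] (G →L[ℂ] G)
  η : E →ₗ[ℂ] (G →L[ℂ] G)
  π_nondegenerate :
    (Submodule.span ℂ {h : G | ∃ (b : B) (g : G), h = π b g}).topologicalClosure = ⊤
  map_bimodule : ∀ (b : B) (x : E) (b' : B), η (X.lact b (op b' • x)) = π b * η x * π b'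
  star_mul : ∀ x y : E, star (η x) * η y = π (rightInner B x y)

namespace WStarCorrespondence.Representation

variable {X : WStarCorrespondence B E} {G : Type w} [NormedAddCommGroup G] [InnerProductSpace ℂ G]
  [CompleteSpace G]

/-- The representation is nondegenerate: the vectors `η(x) g` are total in `G`. -/
def IsNondegenerate (R : X.Representation G) : Prop :=
  (Submodule.span ℂ {h : G | ∃ (x : E) (g : G), h = R.η x g}).topologicalClosure = ⊤

/-- The representation is faithful: `π` and `η` are injective. -/
def IsFaithful (R : X.Representation G) : Prop :=
  Function.Injective R.π ∧ Function.Injective R.η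

/-- The representation is normal: both `π` and `η` are normal.  For `η`, the target `B(G)` is
regarded as a right Hilbert module over itself, with inner product `⟨s, t⟩ = s⋆ t`. -/
def IsNormal (R : X.Representation G) : Prop :=
  IsNormalMap (R.π : B →ₗ[ℂ] (G →L[ℂ] G)) ∧
  IsNormalModuleMap (A := Bᵐᵒᵖ) (E := E) (C := (G →L[ℂ] G)ᵐᵒᵖ) (F := (G →L[ℂ] G)ᵐᵒᵖ)
    (fun x => op (R.η x))

end WStarCorrespondence.Representation

end Correspondence

/-! Given a representation of `B` on a Hilbert space `H`, form `E ⊗ H` over `B`, on which `B` acts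
from the left. Every `x` in `E` gives a creation operator `L_x : h ↦ x ⊗ h` with `L_x⋆ L_y = ⟨x,
y⟩`. If a unitary `U : E ⊗ H → H` intertwines the two actions of `B`, then `η(x) = U L_x` satisfies
all algebraic identities, `η(E)H` is total because the elementary tensors are total in `E ⊗ H`, and
`η` is injective as soon as `π` is. The theorem therefore amounts to finding a faithful normal `H`
with `E ⊗ H ≅ H` as representations of `B`.

Here `H` is a multiple of the sum of the GNS spaces of all normal positive functionals, and `E ⊗ H`
is built in the same way (`FamilySpace`). Faithfulness of the left action and normality of `b ↦ ⟨x,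
b x⟩` make the representation on `E ⊗ H` faithful and normal. Two faithful normal representations
become equivalent after a large enough amplification: a normal functional is dominated, on a nonzero
compression, by a vector functional of the other representation (`exists_dominated_conjugate`); a
Radon–Nikodym argument turns domination into equality (`exists_vectorFunctional_eq`); exhaustion
yields cyclic decompositions and isometric intertwiners in both directions; and Cantor–Bernstein
yields a unitary (`exists_unitary_intertwiner`).

All of this needs enough normal positive functionals, whereas a W⋆-algebra only comes with a
predual. Weak limits of bounded increasing nets are suprema, so predual functionals are order
continuous (`IsPredual.mem_orderContinuous`), and suitable compressions of them are positive and
nonzero (`exists_scottContinuous_ne_zero`). Order continuity is the working notion throughout: it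
contains the normal functionals and is stable under sums and compressions, and its monotone members
are Scott continuous.

For normality of `η`, the linking algebra acts on `(B ⊕ E) ⊗ H`. Self-duality makes suprema of
adjointable operators pointwise (`IsSelfDual.isLUB_rightInner`), so this action is normal;
compressing it, with `E ⊗ H` identified with `H` by `U`, gives the required map of linking algebras.
-/

section NormalRepresentation

open Filter Topology ComplexOrder ComplexConjugate MulOpposite

/-! ### Order continuous functionals on an ordered vector space. -/

section OrderContinuous

variable {M : Type*} [AddCommGroup M] [Module ℂ M] [PartialOrder M]

variable (M) in
/-- The linear functionals that converge along increasing nets possessing a supremum. -/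
def orderContinuous : Submodule ℂ (M →ₗ[ℂ] ℂ) where
  carrier := {ω | ∀ (d : Set M), d.Nonempty → DirectedOn (· ≤ ·) d → ∀ s, IsLUB d s →
    ∀ ε > (0 : ℝ), ∃ a ∈ d, ∀ b ∈ d, a ≤ b → ‖ω b - ω s‖ < ε}
  add_mem' := by
    intro ω₁ ω₂ h₁ h₂ d hd hdir s hs ε hε
    obtain ⟨a₁, ha₁, H₁⟩ := h₁ d hd hdir s hs (ε / 2) (by positivity)
    obtain ⟨a₂, ha₂, H₂⟩ := h₂ d hd hdir s hs (ε / 2) (by positivity)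
    obtain ⟨a, ha, h1, h2⟩ := hdir a₁ ha₁ a₂ ha₂
    refine ⟨a, ha, fun b hb hab => ?_⟩
    have e : (ω₁ + ω₂) b - (ω₁ + ω₂) s = (ω₁ b - ω₁ s) + (ω₂ b - ω₂ s) := by
      simp only [LinearMap.add_apply]; ring
    rw [e]
    have := H₁ b hb (h1.trans hab)
    have := H₂ b hb (h2.trans hab)
    exact (norm_add_le _ _).trans_lt (by linarith)
  zero_mem' := by
    intro d hd _ s _ ε hε
    obtain ⟨a, ha⟩ := hd
    exact ⟨a, ha, fun b _ _ => by simpa using hε⟩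
  smul_mem' := by
    intro c ω h d hd hdir s hs ε hε
    obtain ⟨a, ha, H⟩ := h d hd hdir s hs (ε / (‖c‖ + 1)) (by positivity)
    refine ⟨a, ha, fun b hb hab => ?_⟩
    have e : (c • ω) b - (c • ω) s = c * (ω b - ω s) := by
      simp only [LinearMap.smul_apply, smul_eq_mul]; ring
    rw [e, norm_mul]
    have h1 := H b hb hab
    rw [lt_div_iff₀ (by positivity)] at h1
    nlinarith [norm_nonneg (ω b - ω s), norm_nonneg c]

theorem tendsto_of_mem_orderContinuous {ω : M →ₗ[ℂ] ℂ} (hω : ω ∈ orderContinuous M)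
    {ι : Type*} [Preorder ι] [IsDirectedOrder ι] [Nonempty ι] {x : ι → M} (hx : Monotone x)
    {s : M} (hs : IsLUB (Set.range x) s) : Tendsto (fun i => ω (x i)) atTop (𝓝 (ω s)) := by
  refine Metric.tendsto_nhds.mpr fun ε hε => ?_
  obtain ⟨a, ⟨i, rfl⟩, H⟩ := hω (Set.range x) (Set.range_nonempty x)
    (directedOn_range.mpr hx.directed_le) s hs ε hε
  refine (eventually_ge_atTop i).mono fun j hij => ?_
  rw [dist_eq_norm]
  exact H _ ⟨j, rfl⟩ (hx hij)

theorem scottContinuous_mem_orderContinuous {ω : M →ₗ[ℂ] ℂ} (hω : ScottContinuous ω) :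
    ω ∈ orderContinuous M := by
  intro d hd hdir s hs ε hε
  have h := hω hd hdir hs
  have hmono : Monotone ω := hω.monotone
  by_contra! hcon
  -- If every tail of `d` leaves the ε-ball around `ω s`, then, since all differences are real by
  -- monotonicity, `ω s - ε` is an upper bound of the image of `d`.
  have key : ω s ≤ ω s - (ε : ℂ) := by
    refine h.2 ?_
    rintro _ ⟨a, ha, rfl⟩
    obtain ⟨b, hb, hab, hε'⟩ := hcon a ha
    have h1 : ω b ≤ ω s := hmono (hs.1 hb)
    have h2 : ω a ≤ ω b := hmono hab
    rw [Complex.le_def] at h1 h2 ⊢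
    have h3 : ω b - ω s = ((ω b).re - (ω s).re : ℝ) := by
      apply Complex.ext <;> simp [h1.2]
    rw [h3, Complex.norm_real, Real.norm_eq_abs, abs_of_nonpos (by linarith)] at hε'
    constructor
    · simp; linarith
    · simp [h1.2, h2.2]
  rw [Complex.le_def] at key
  have := key.1
  simp at this
  linarith

theorem normalFunctionals_le_orderContinuous : normalFunctionals M ≤ orderContinuous M :=
  Submodule.span_le.mpr fun _ h => scottContinuous_mem_orderContinuous h

theorem scottContinuous_of_mem_orderContinuous {ω : M →ₗ[ℂ] ℂ} (hω : ω ∈ orderContinuous M)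
    (hmono : Monotone ω) : ScottContinuous ω := by
  intro d hd hdir s hs
  refine ⟨?_, fun z hz => ?_⟩
  · rintro _ ⟨a, ha, rfl⟩
    exact hmono (hs.1 ha)
  · have : Nonempty d := hd.to_subtype
    have : IsDirectedOrder d := ⟨fun a b => by
      obtain ⟨c, hc, h1, h2⟩ := hdir a a.2 b b.2
      exact ⟨⟨c, hc⟩, h1, h2⟩⟩
    have := tendsto_of_mem_orderContinuous hω (x := fun a : d => (a : M)) (fun _ _ h => h)
      (s := s) (by simpa using hs)
    exact le_of_tendsto' this fun a => hz ⟨a, a.2, rfl⟩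

end OrderContinuous

/-! ### Weak compactness from the predual and suprema in a W⋆-algebra. -/

section WStar

variable {B : Type u} [CStarAlgebra B] [PartialOrder B] [StarOrderedRing B]

/-- A set of functionals that separates the points and for which bounded sets are relatively
compact, as is the predual of a W⋆-algebra. -/
structure IsPredual (𝒳 : Set (B →L[ℂ] ℂ)) : Prop where
  separating : ∀ b : B, (∀ f ∈ 𝒳, f b = 0) → b = 0
  compact : ∀ (U : Ultrafilter B) (r : ℝ), (∀ᶠ x in (U : Filter B), ‖x‖ ≤ r) →
    ∃ t : B, ‖t‖ ≤ r ∧ ∀ f ∈ 𝒳, Tendsto f U (𝓝 (f t))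

theorem exists_isPredual [WStarAlgebra B] : ∃ 𝒳 : Set (B →L[ℂ] ℂ), IsPredual 𝒳 := by
  obtain ⟨X, _, _, _, ⟨e⟩⟩ := WStarAlgebra.exists_predual (M := B)
  -- The identification `e` of the dual of `X` with `B` is conjugate-linear, so evaluation at `φ`
  -- becomes linear only after conjugation.
  refine ⟨{f | ∃ φ : X, ∀ b, f b = conj (e.symm b φ)}, ?_, ?_⟩
  · intro b hb
    have : e.symm b = 0 := by
      ext φ
      let f : B →ₗ[ℂ] ℂ :=
        { toFun := fun b => conj (e.symm b φ)
          map_add' := by simp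
          map_smul' := fun m x => by
            rw [map_smulₛₗ]
            simp }
      have := hb (f.mkContinuous ‖φ‖ fun b => by
        change ‖conj (e.symm b φ)‖ ≤ _
        rw [RCLike.norm_conj]
        refine ((e.symm b).le_opNorm φ).trans ?_
        rw [e.symm.norm_map, mul_comm]) ⟨φ, fun _ => rfl⟩
      have h2 : conj (e.symm b φ) = 0 := this
      simpa using h2
    simpa using this
  · intro U r hU
    have hc := WeakDual.isCompact_closedBall (𝕜 := ℂ) (E := X) (0 : StrongDual ℂ X) r
    let g : B → WeakDual ℂ X := fun b => StrongDual.toWeakDual (e.symm b)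
    obtain ⟨t, ht, htU⟩ := hc.ultrafilter_le_nhds (U.map g) (by
      rw [Filter.le_principal_iff, Ultrafilter.mem_coe, Ultrafilter.mem_map]
      filter_upwards [hU] with x hx
      simpa [g] using hx)
    refine ⟨e (WeakDual.toStrongDual t), ?_, ?_⟩
    · rw [e.norm_map]
      simpa using ht
    · rintro f ⟨φ, hφ⟩
      have h1 : Tendsto g U (𝓝 t) := htU
      have h2 : Tendsto (fun b => g b φ) U (𝓝 (t φ)) :=
        ((WeakDual.eval_continuous φ).tendsto t).comp h1
      have h3 := (Complex.continuous_conj.tendsto _).comp h2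
      rw [hφ, e.symm_apply_apply]
      refine h3.congr fun b => ?_
      simp only [Function.comp, hφ, g]
      rfl

namespace IsPredual

variable {𝒳 : Set (B →L[ℂ] ℂ)} (h𝒳 : IsPredual 𝒳)
include h𝒳

theorem ext {a b : B} (h : ∀ f ∈ 𝒳, f a = f b) : a = b :=
  sub_eq_zero.mp (h𝒳.separating _ fun f hf => by rw [map_sub, h f hf, sub_self])

theorem norm_le {ι : Type*} {U : Ultrafilter ι} {x : ι → B} {t : B} {r : ℝ}
    (hx : ∀ᶠ i in (U : Filter ι), ‖x i‖ ≤ r)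
    (ht : ∀ f ∈ 𝒳, Tendsto (fun i => f (x i)) U (𝓝 (f t))) : ‖t‖ ≤ r := by
  obtain ⟨t', ht', h⟩ := h𝒳.compact (U.map x) r hx
  have : t = t' := h𝒳.ext fun f hf => tendsto_nhds_unique (ht f hf) (h f hf)
  rwa [this]

/-- Self-adjointness is encoded by norms, which are lower semicontinuous along the limit: `‖x + i
n‖² ≤ r² + n²` for self-adjoint `x` with `‖x‖ ≤ r`. Hence the imaginary part `y` of `t` satisfies
`‖y + n‖ ≤ √(r² + n²)` for all real `n`. Positive `n` gives `y ≤ r² / (2n)`, so `y ≤ 0`; negative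
`n` gives `-y ≤ 0`. -/
theorem isSelfAdjoint {ι : Type*} {U : Ultrafilter ι} {x : ι → B} {t : B} {r : ℝ}
    (hx : ∀ᶠ i in (U : Filter ι), ‖x i‖ ≤ r) (hsa : ∀ᶠ i in (U : Filter ι), IsSelfAdjoint (x i))
    (ht : ∀ f ∈ 𝒳, Tendsto (fun i => f (x i)) U (𝓝 (f t))) : IsSelfAdjoint t := by
  have hr : 0 ≤ r := (norm_nonneg t).trans (h𝒳.norm_le hx ht)
  have bound : ∀ n : ℝ, ‖t + ((n : ℂ) * Complex.I) • (1 : B)‖ ≤ √(r ^ 2 + n ^ 2) := by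
    intro n
    refine h𝒳.norm_le (U := U) (x := fun i => x i + ((n : ℂ) * Complex.I) • (1 : B)) ?_ ?_
    · filter_upwards [hx, hsa] with i hi hi'
      refine Real.le_sqrt_of_sq_le ?_
      rw [sq, ← CStarRing.norm_star_mul_self]
      have : star (x i + ((n : ℂ) * Complex.I) • (1 : B)) * (x i + ((n : ℂ) * Complex.I) • (1 : B))
          = x i * x i + ((n : ℂ) ^ 2) • (1 : B) := by
        simp only [star_add, star_smul, hi'.star_eq, star_one, mul_add, add_mul, mul_smul_comm,
          smul_mul_assoc, mul_one, one_mul]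
        have h1 : star ((n : ℂ) * Complex.I) = -((n : ℂ) * Complex.I) := by simp
        have h2 : ((n : ℂ) ^ 2) = -(((n : ℂ) * Complex.I) * (n * Complex.I)) := by
          ring_nf; simp
        rw [h1, h2]
        generalize (n : ℂ) * Complex.I = z
        simp only [smul_add, smul_neg, neg_smul, smul_smul]
        abel
      rw [this]
      refine (norm_add_le _ _).trans (add_le_add ((norm_mul_le _ _).trans ?_) ?_)
      · rw [sq]; gcongr
      · rw [norm_smul]
        rcases subsingleton_or_nontrivial B with h | h
        · simp [Subsingleton.elim (1 : B) 0]; positivity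
        · simp
    · intro f hf
      simp only [map_add]
      exact (ht f hf).add_const _
  have hIm : ∀ n : ℝ, ‖(imaginaryPart t : B) + (n : ℂ) • (1 : B)‖ ≤ √(r ^ 2 + n ^ 2) := by
    intro n
    have h1 : ((imaginaryPart (t + ((n : ℂ) * Complex.I) • (1 : B))) : B)
        = (imaginaryPart t : B) + (n : ℂ) • (1 : B) := by
      simp [imaginaryPart_smul, realPart_one]
    rw [← h1]
    exact (imaginaryPart.norm_le _).trans (bound n)
  have key : ∀ y : B, IsSelfAdjoint y → (∀ n : ℝ, 0 < n → ‖y + (n : ℂ) • (1 : B)‖ ≤ √(r ^ 2 + n ^ 2)) →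
      y ≤ 0 := by
    intro y hy h
    have h2 : ∀ n : ℝ, 0 < n → y ≤ (r ^ 2 / (2 * n)) • (1 : B) := by
      intro n hn
      have h3 : IsSelfAdjoint (y + (n : ℂ) • (1 : B)) := by
        refine hy.add ?_
        rw [isSelfAdjoint_iff]; simp
      have h4 := h3.le_algebraMap_norm_self
      have h5 : √(r ^ 2 + n ^ 2) ≤ n + r ^ 2 / (2 * n) := by
        refine Real.sqrt_le_iff.mpr ⟨by positivity, ?_⟩
        have : (n + r ^ 2 / (2 * n)) ^ 2 = n ^ 2 + r ^ 2 + (r ^ 2 / (2 * n)) ^ 2 := by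
          field_simp; ring
        rw [this]
        nlinarith [sq_nonneg (r ^ 2 / (2 * n))]
      have h6 : algebraMap ℝ B ‖y + (n : ℂ) • (1 : B)‖ ≤ algebraMap ℝ B (n + r ^ 2 / (2 * n)) :=
        algebraMap_mono B ((h n hn).trans h5)
      have h7 := h4.trans h6
      rw [Algebra.algebraMap_eq_smul_one, add_smul, add_comm, Complex.coe_smul] at h7
      simpa using h7
    have h3 : Tendsto (fun n : ℝ => (r ^ 2 / (2 * n)) • (1 : B)) atTop (𝓝 ((0 : ℝ) • (1 : B))) := by
      refine Tendsto.smul_const ?_ _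
      exact Tendsto.const_div_atTop (tendsto_id.const_mul_atTop two_pos) _
    rw [zero_smul] at h3
    exact ge_of_tendsto h3 ((eventually_gt_atTop 0).mono h2)
  have hle : (imaginaryPart t : B) ≤ 0 := key _ (imaginaryPart t).2 fun n _ => hIm n
  have hge : -(imaginaryPart t : B) ≤ 0 := key _ (imaginaryPart t).2.neg fun n _ => by
    have := hIm (-n)
    rw [← norm_neg]
    simpa [add_comm] using this
  have h0 : (imaginaryPart t : B) = 0 := le_antisymm hle (by simpa using hge)
  rw [← realPart_add_I_smul_imaginaryPart t, h0, smul_zero, add_zero]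
  exact (realPart t).2

/-- For self-adjoint `t` with `‖t‖ ≤ r`, positivity is equivalent to the norm condition `‖r - t‖ ≤
r`, which survives the limit. -/
theorem nonneg {ι : Type*} {U : Ultrafilter ι} {x : ι → B} {t : B} {r : ℝ}
    (hx : ∀ᶠ i in (U : Filter ι), ‖x i‖ ≤ r) (hsa : ∀ᶠ i in (U : Filter ι), 0 ≤ x i)
    (ht : ∀ f ∈ 𝒳, Tendsto (fun i => f (x i)) U (𝓝 (f t))) : 0 ≤ t := by
  have hr : 0 ≤ r := (norm_nonneg t).trans (h𝒳.norm_le hx ht)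
  have h1 : IsSelfAdjoint t := h𝒳.isSelfAdjoint hx (hsa.mono fun i hi => .of_nonneg hi) ht
  have h2 : ‖algebraMap ℝ B r - t‖ ≤ r := by
    refine h𝒳.norm_le (U := U) (x := fun i => algebraMap ℝ B r - x i) ?_ ?_
    · filter_upwards [hx, hsa] with i hi hi'
      have := (SpectrumRestricts.nnreal_iff_nnnorm (t := ⟨r, hr⟩) (IsSelfAdjoint.of_nonneg hi') hi).mp
        (SpectrumRestricts.nnreal_of_nonneg hi')
      exact this
    · intro f hf
      simp only [map_sub]
      exact (ht f hf).const_sub _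
  have h3 := (SpectrumRestricts.nnreal_iff_nnnorm (t := ⟨r, hr⟩) h1 (h𝒳.norm_le hx ht)).mpr h2
  rw [SpectrumRestricts.nnreal_iff] at h3
  exact (StarOrderedRing.nonneg_iff_spectrum_nonneg t h1).mpr h3

theorem exists_limit_Icc {ι : Type*} {U : Ultrafilter ι} {x : ι → B} {a b : B}
    (hx : ∀ᶠ i in (U : Filter ι), a ≤ x i ∧ x i ≤ b) :
    ∃ t, ∀ f ∈ 𝒳, Tendsto (fun i => f (x i)) U (𝓝 (f t)) := by
  have hb : ∀ᶠ i in (U : Filter ι), ‖x i‖ ≤ ‖b - a‖ + ‖a‖ := by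
    filter_upwards [hx] with i hi
    have : ‖x i - a‖ ≤ ‖b - a‖ := CStarAlgebra.norm_le_norm_of_nonneg_of_le
      (sub_nonneg.mpr hi.1) (sub_le_sub_right hi.2 a)
    calc ‖x i‖ = ‖(x i - a) + a‖ := by rw [sub_add_cancel]
      _ ≤ _ := (norm_add_le _ _).trans (by gcongr)
  obtain ⟨t, _, h⟩ := h𝒳.compact (U.map x) _ hb
  exact ⟨t, h⟩

theorem le_of_limit {ι : Type*} {U : Ultrafilter ι} {x : ι → B} {a b t : B}
    (hx : ∀ᶠ i in (U : Filter ι), a ≤ x i ∧ x i ≤ b)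
    (ht : ∀ f ∈ 𝒳, Tendsto (fun i => f (x i)) U (𝓝 (f t))) : a ≤ t ∧ t ≤ b := by
  constructor
  · rw [← sub_nonneg]
    refine h𝒳.nonneg (U := U) (x := fun i => x i - a) (r := ‖b - a‖) ?_ ?_ ?_
    · filter_upwards [hx] with i hi
      exact CStarAlgebra.norm_le_norm_of_nonneg_of_le (sub_nonneg.mpr hi.1)
        (sub_le_sub_right hi.2 a)
    · filter_upwards [hx] with i hi using sub_nonneg.mpr hi.1
    · intro f hf
      simp only [map_sub]
      exact (ht f hf).sub_const _
  · rw [← sub_nonneg]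
    refine h𝒳.nonneg (U := U) (x := fun i => b - x i) (r := ‖b - a‖) ?_ ?_ ?_
    · filter_upwards [hx] with i hi
      exact CStarAlgebra.norm_le_norm_of_nonneg_of_le (sub_nonneg.mpr hi.2)
        (sub_le_sub_left hi.1 b)
    · filter_upwards [hx] with i hi using sub_nonneg.mpr hi.2
    · intro f hf
      simp only [map_sub]
      exact (ht f hf).const_sub _

/-- Order intervals are relatively compact and closed under these limits. A tail of the net lies
between `x i` and any upper bound `c`, hence so does the limit. -/
theorem exists_isLUB_limit {ι : Type*} [Preorder ι] {x : ι → B} (hx : Monotone x)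
    [IsDirectedOrder ι] [Nonempty ι] (hb : BddAbove (Set.range x)) (U : Ultrafilter ι)
    (hU : (U : Filter ι) ≤ atTop) :
    ∃ t, IsLUB (Set.range x) t ∧ ∀ f ∈ 𝒳, Tendsto (fun i => f (x i)) U (𝓝 (f t)) := by
  obtain ⟨b, hb⟩ := hb
  have ev : ∀ i, ∀ c ∈ upperBounds (Set.range x),
      ∀ᶠ j in (U : Filter ι), x i ≤ x j ∧ x j ≤ c := fun i c hc =>
    hU ((eventually_ge_atTop i).mono fun j hj => ⟨hx hj, hc ⟨j, rfl⟩⟩)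
  obtain ⟨t, ht⟩ := h𝒳.exists_limit_Icc (ev (Classical.arbitrary ι) b hb)
  refine ⟨t, ⟨?_, fun c hc => ?_⟩, ht⟩
  · rintro _ ⟨i, rfl⟩
    exact (h𝒳.le_of_limit (ev i b hb) ht).1
  · exact (h𝒳.le_of_limit (ev (Classical.arbitrary ι) c hc) ht).2

theorem mem_orderContinuous {f : B →L[ℂ] ℂ} (hf : f ∈ 𝒳) :
    (f : B →ₗ[ℂ] ℂ) ∈ orderContinuous B := by
  intro d hd hdir s hs ε hε
  have : Nonempty d := hd.to_subtype
  have : IsDirectedOrder d := ⟨fun a b => by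
    obtain ⟨c, hc, h1, h2⟩ := hdir a a.2 b b.2
    exact ⟨⟨c, hc⟩, h1, h2⟩⟩
  have hm : Monotone (fun a : d => (a : B)) := fun _ _ h => h
  have hr : Set.range (fun a : d => (a : B)) = d := Subtype.range_coe
  have : Tendsto (fun a : d => f a) atTop (𝓝 (f s)) := by
    -- Along every ultrafilter the limit is `f` of a supremum, and suprema are unique, so the whole
    -- net converges.
    rw [tendsto_iff_ultrafilter]
    intro U hU
    obtain ⟨t, ht, h⟩ := h𝒳.exists_isLUB_limit hm (by rw [hr]; exact ⟨s, hs.1⟩) U hU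
    rw [hr] at ht
    rw [← ht.unique hs]
    exact h f hf
  obtain ⟨a, ha⟩ := eventually_atTop.mp (Metric.tendsto_nhds.mp this ε hε)
  exact ⟨a, a.2, fun b hb hab => by simpa [dist_eq_norm] using ha ⟨b, hb⟩ hab⟩

end IsPredual

theorem WStarAlgebra.exists_isLUB [WStarAlgebra B] {d : Set B} (hd : d.Nonempty)
    (hdir : DirectedOn (· ≤ ·) d) (hb : BddAbove d) : ∃ s, IsLUB d s := by
  obtain ⟨𝒳, h𝒳⟩ := exists_isPredual (B := B)
  have : Nonempty d := hd.to_subtype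
  have : IsDirectedOrder d := ⟨fun a b => by
    obtain ⟨c, hc, h1, h2⟩ := hdir a a.2 b b.2
    exact ⟨⟨c, hc⟩, h1, h2⟩⟩
  obtain ⟨t, ht, -⟩ := h𝒳.exists_isLUB_limit (x := fun a : d => (a : B)) (fun _ _ h => h)
    (by simpa using hb) (Ultrafilter.of atTop) (Ultrafilter.of_le _)
  exact ⟨t, by simpa using ht⟩

theorem WStarAlgebra.ext_orderContinuous [WStarAlgebra B] {a b : B}
    (h : ∀ ω ∈ orderContinuous B, ω a = ω b) : a = b := by
  obtain ⟨𝒳, h𝒳⟩ := exists_isPredual (B := B)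
  exact h𝒳.ext fun f hf => h f (h𝒳.mem_orderContinuous hf)

end WStar

/-! ### Compressions of functionals and existence of normal positive functionals. -/

section OrderContinuous

variable {B : Type u} [CStarAlgebra B] [PartialOrder B] [StarOrderedRing B]

/-- The functional `x ↦ ω (star a * x * b)`. -/
noncomputable def conjFunctional (ω : B →ₗ[ℂ] ℂ) (a b : B) : B →ₗ[ℂ] ℂ :=
  ω ∘ₗ LinearMap.mulRight ℂ b ∘ₗ LinearMap.mulLeft ℂ (star a)

@[simp] theorem conjFunctional_apply (ω : B →ₗ[ℂ] ℂ) (a b x : B) :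
    conjFunctional ω a b x = ω (star a * x * b) := rfl

/-- Conjugation by an invertible element is an order automorphism, so it carries suprema to suprema.
-/
theorem conjFunctional_unit_mem {ω : B →ₗ[ℂ] ℂ} (hω : ω ∈ orderContinuous B) (c : Bˣ) :
    conjFunctional ω c c ∈ orderContinuous B := by
  intro d hd hdir s hs ε hε
  let g : B → B := fun x => star (c : B) * x * c
  let g' : B → B := fun x => star (↑c⁻¹ : B) * x * ↑c⁻¹
  have hg : Monotone g := fun x y h => star_left_conjugate_le_conjugate h _
  have hg' : Monotone g' := fun x y h => star_left_conjugate_le_conjugate h _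
  have h1 : ∀ x, g (g' x) = x := fun x => by
    have : g (g' x) = star (↑c⁻¹ * (c : B)) * x * (↑c⁻¹ * c) := by
      simp only [g, g', star_mul, mul_assoc]
    rw [this]; simp
  have h2 : ∀ x, g' (g x) = x := fun x => by
    have : g' (g x) = star ((c : B) * ↑c⁻¹) * x * (c * ↑c⁻¹) := by
      simp only [g, g', star_mul, mul_assoc]
    rw [this]; simp
  obtain ⟨_, ⟨a, ha, rfl⟩, H⟩ := hω (g '' d) (hd.image g)
    (by
      rintro _ ⟨a, ha, rfl⟩ _ ⟨b, hb, rfl⟩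
      obtain ⟨e, he, h1, h2⟩ := hdir a ha b hb
      exact ⟨g e, ⟨e, he, rfl⟩, hg h1, hg h2⟩) (g s)
    ⟨by rintro _ ⟨a, ha, rfl⟩; exact hg (hs.1 ha), fun z hz => by
      rw [← h1 z]
      refine hg (hs.2 fun a ha => ?_)
      rw [← h2 a]
      exact hg' (hz ⟨a, ha, rfl⟩)⟩ ε hε
  exact ⟨a, ha, fun b hb hab => H _ ⟨b, hb, rfl⟩ (hg hab)⟩

theorem isUnit_algebraMap_add {c : B} {z : ℂ} (h : ‖c‖ < ‖z‖) : IsUnit (algebraMap ℂ B z + c) := by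
  rcases subsingleton_or_nontrivial B with hB | hB
  · exact ⟨1, Subsingleton.elim _ _⟩
  have : z ∉ spectrum ℂ (-c) := fun hz => by
    have := spectrum.norm_le_norm_of_mem hz
    rw [norm_neg] at this
    linarith
  rw [spectrum.notMem_iff] at this
  simpa using this

/-- For real `z > ‖c‖` both `z + c` and `z - c` are invertible, and the sum of the two conjugations
of `x` by them is `2 c⋆ x c + 2 z² x`. This reduces the claim to invertible elements. -/
theorem conjFunctional_self_mem {ω : B →ₗ[ℂ] ℂ} (hω : ω ∈ orderContinuous B) (c : B) :
    conjFunctional ω c c ∈ orderContinuous B := by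
  set z : ℂ := ((‖c‖ + 1 : ℝ) : ℂ) with hz
  have hzn : ‖z‖ = ‖c‖ + 1 := by
    rw [hz, Complex.norm_real, Real.norm_of_nonneg (by positivity)]
  have hzs : star z = z := Complex.conj_ofReal _
  obtain ⟨u₁, h₁⟩ := isUnit_algebraMap_add (c := c) (z := z) (by rw [hzn]; linarith)
  obtain ⟨u₂, h₂⟩ := isUnit_algebraMap_add (c := -c) (z := z) (by rw [hzn, norm_neg]; linarith)
  have : conjFunctional ω c c = (2⁻¹ : ℂ) • (conjFunctional ω u₁ u₁ + conjFunctional ω u₂ u₂)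
      - z ^ 2 • ω := by
    ext x
    have : star (u₁ : B) * x * u₁ + star (u₂ : B) * x * u₂
        = (2 : ℂ) • (star c * x * c) + (2 * z ^ 2) • x := by
      rw [h₁, h₂]
      simp only [Algebra.algebraMap_eq_smul_one, star_add, star_smul, star_neg, star_one, hzs,
        add_mul, mul_add, smul_mul_assoc, mul_smul_comm, one_mul, mul_one, neg_mul, mul_neg,
        smul_add, smul_neg, smul_smul, two_smul, two_mul, add_smul, ← sq, neg_neg]
      abel
    simp only [LinearMap.sub_apply, LinearMap.smul_apply, LinearMap.add_apply,
      conjFunctional_apply, ← map_add, this]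
    simp only [map_add, map_smul, smul_eq_mul]
    ring
  rw [this]
  exact Submodule.sub_mem _ (Submodule.smul_mem _ _ (Submodule.add_mem _
    (conjFunctional_unit_mem hω _) (conjFunctional_unit_mem hω _))) (Submodule.smul_mem _ _ hω)

theorem conjFunctional_mem {ω : B →ₗ[ℂ] ℂ} (hω : ω ∈ orderContinuous B) (a b : B) :
    conjFunctional ω a b ∈ orderContinuous B := by
  have : conjFunctional ω a b = (4⁻¹ : ℂ) • (conjFunctional ω (a + b) (a + b)
      - conjFunctional ω (a - b) (a - b)
      - Complex.I • conjFunctional ω (a + Complex.I • b) (a + Complex.I • b)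
      + Complex.I • conjFunctional ω (a - Complex.I • b) (a - Complex.I • b)) := by
    ext x
    simp only [LinearMap.sub_apply, LinearMap.smul_apply, LinearMap.add_apply,
      conjFunctional_apply, star_add, star_sub, star_smul, add_mul, mul_add, sub_mul, mul_sub,
      smul_mul_assoc, mul_smul_comm, map_add, map_sub, map_smul, smul_eq_mul, Complex.star_def,
      Complex.conj_I]
    ring_nf
    simp only [Complex.I_sq]
    ring
  rw [this]
  have h := fun c => conjFunctional_self_mem hω c
  exact Submodule.smul_mem _ _ (Submodule.add_mem _ (Submodule.sub_mem _ (Submodule.sub_mem _ (h _)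
    (h _)) (Submodule.smul_mem _ _ (h _))) (Submodule.smul_mem _ _ (h _)))

/-- The real part `x ↦ (f x + conj (f (star x))) / 2` of a linear functional. -/
noncomputable def reFunctional (f : B →ₗ[ℂ] ℂ) : B →ₗ[ℂ] ℂ where
  toFun x := (f x + conj (f (star x))) / 2
  map_add' x y := by simp only [map_add, star_add]; ring
  map_smul' z x := by
    simp only [map_smul, star_smul, smul_eq_mul, map_mul, Complex.star_def, Complex.conj_conj,
      RingHom.id_apply]
    ring

theorem reFunctional_apply_of_isSelfAdjoint (f : B →ₗ[ℂ] ℂ) {x : B} (hx : IsSelfAdjoint x) :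
    reFunctional f x = ((f x).re : ℂ) := by
  change (f x + conj (f (star x))) / 2 = _
  rw [hx.star_eq, Complex.add_conj]
  push_cast
  ring

theorem reFunctional_mem {f : B →ₗ[ℂ] ℂ} (hf : f ∈ orderContinuous B) :
    reFunctional f ∈ orderContinuous B := by
  intro d hd hdir s hs ε hε
  obtain ⟨a, ha, H⟩ := hf d hd hdir s hs ε hε
  refine ⟨a, ha, fun b hb hab => ?_⟩
  have h1 : IsSelfAdjoint (b - s) := by
    have := IsSelfAdjoint.of_nonneg (sub_nonneg.mpr (hs.1 hb))
    simpa using this.neg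
  rw [← map_sub, reFunctional_apply_of_isSelfAdjoint f h1, Complex.norm_real]
  refine (Complex.abs_re_le_norm _).trans_lt ?_
  rw [map_sub]
  exact H b hb hab

theorem LinearMap.monotone_of_nonneg {ω : B →ₗ[ℂ] ℂ} (h : ∀ x, 0 ≤ x → 0 ≤ ω x) : Monotone ω :=
  fun x y hxy => by
    have := h _ (sub_nonneg.mpr hxy)
    rw [map_sub] at this
    exact sub_nonneg.mp this

theorem IsPredual.exists_max_Icc {𝒳 : Set (B →L[ℂ] ℂ)} (h𝒳 : IsPredual 𝒳) {f : B →L[ℂ] ℂ}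
    (hf : f ∈ 𝒳) (z : ℂ) {b : B} (hb : 0 ≤ b) :
    ∃ a, 0 ≤ a ∧ a ≤ b ∧ ∀ x, 0 ≤ x → x ≤ b → (z * f x).re ≤ (z * f a).re := by
  set S : Set ℝ := (fun x => (z * f x).re) '' Set.Icc 0 b with hS
  have hne : S.Nonempty := ⟨_, 0, ⟨le_rfl, hb⟩, rfl⟩
  have hbdd : BddAbove S := by
    refine ⟨‖z‖ * (‖f‖ * ‖b‖), ?_⟩
    rintro _ ⟨x, ⟨h0, h1⟩, rfl⟩
    calc (z * f x).re ≤ ‖z * f x‖ := Complex.re_le_norm _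
      _ = ‖z‖ * ‖f x‖ := norm_mul _ _
      _ ≤ ‖z‖ * (‖f‖ * ‖x‖) := by gcongr; exact f.le_opNorm x
      _ ≤ ‖z‖ * (‖f‖ * ‖b‖) := by gcongr; exact CStarAlgebra.norm_le_norm_of_nonneg_of_le h0 h1
  obtain ⟨u, -, hu, huS⟩ := exists_seq_tendsto_sSup hne hbdd
  choose x hx hxu using huS
  -- A maximising sequence has a weak limit in the interval along a nonprincipal ultrafilter, and
  -- there the supremum is attained.
  have hI : ∀ᶠ n in ((hyperfilter ℕ : Ultrafilter ℕ) : Filter ℕ), 0 ≤ x n ∧ x n ≤ b :=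
    Eventually.of_forall fun n => hx n
  obtain ⟨t, ht⟩ := h𝒳.exists_limit_Icc hI
  obtain ⟨h0, h1⟩ := h𝒳.le_of_limit hI ht
  refine ⟨t, h0, h1, fun y hy0 hyb => ?_⟩
  have h2 : Tendsto (fun n => (z * f (x n)).re) (hyperfilter ℕ : Ultrafilter ℕ) (𝓝 (z * f t).re) :=
    (Complex.continuous_re.tendsto _).comp ((ht f hf).const_mul z)
  have h3 : Tendsto (fun n => (z * f (x n)).re) (hyperfilter ℕ : Ultrafilter ℕ) (𝓝 (sSup S)) := by
    simp only [hxu]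
    exact hu.mono_left Nat.hyperfilter_le_atTop
  rw [tendsto_nhds_unique h2 h3]
  exact le_csSup hbdd ⟨y, ⟨hy0, hyb⟩, rfl⟩

/-- Compression of a nonnegative element by a square root stays below. -/
theorem sqrt_conjugate_le {a x : B} (ha : 0 ≤ a) (hx1 : x ≤ 1) :
    CFC.sqrt a * x * CFC.sqrt a ≤ a := by
  have hs : IsSelfAdjoint (CFC.sqrt a) := .of_nonneg (CFC.sqrt_nonneg a)
  have := hs.conjugate_le_conjugate hx1
  simpa [CFC.sqrt_mul_sqrt_self a ha] using this

theorem sqrt_conjugate_nonneg {a x : B} (hx : 0 ≤ x) :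
    0 ≤ CFC.sqrt a * x * CFC.sqrt a :=
  (IsSelfAdjoint.of_nonneg (CFC.sqrt_nonneg a)).conjugate_nonneg hx

/-- The element `y = a (a + δ)⁻¹` stands in for the range projection of `a`: it is dominated by a
multiple of `a`, and `t - t² / (t + δ) = δ t / (t + δ) ≤ δ`. -/
theorem exists_nonneg_le_norm_sub_mul_le {a : B} (ha0 : 0 ≤ a) {δ : ℝ} (hδ : 0 < δ) :
    ∃ y, 0 ≤ y ∧ y ≤ δ⁻¹ • a ∧ (∀ c, Commute a c → Commute y c) ∧ ‖a - a * y‖ ≤ δ := by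
  have hsp : ∀ t ∈ spectrum ℝ a, 0 ≤ t := fun t ht => spectrum_nonneg_of_nonneg ha0 ht
  have hcont : ContinuousOn (fun t : ℝ => t / (t + δ)) (spectrum ℝ a) :=
    continuousOn_id.div (continuousOn_id.add continuousOn_const) fun t ht =>
      ne_of_gt (add_pos_of_nonneg_of_pos (hsp t ht) hδ)
  have hasa : IsSelfAdjoint a := .of_nonneg ha0
  refine ⟨cfc (fun t : ℝ => t / (t + δ)) a, cfc_nonneg fun t ht => ?_, ?_,
    fun c hc => hc.cfc_real _, ?_⟩
  · have := hsp t ht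
    positivity
  · have h1 : δ⁻¹ • a = cfc (fun t : ℝ => δ⁻¹ * t) a := by
      rw [cfc_const_mul_id (R := ℝ) δ⁻¹ a]
    rw [h1]
    refine cfc_mono (fun t ht => ?_) hcont (continuousOn_const.mul continuousOn_id)
    have := hsp t ht
    rw [inv_mul_eq_div]
    gcongr
    linarith
  · have h1 : a - a * cfc (fun t : ℝ => t / (t + δ)) a
        = cfc (fun t : ℝ => t - t * (t / (t + δ))) a := by
      rw [cfc_sub (fun t : ℝ => t) (fun t : ℝ => t * (t / (t + δ))) a continuousOn_id
          (continuousOn_id.mul hcont),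
        cfc_mul (fun t : ℝ => t) (fun t : ℝ => t / (t + δ)) a continuousOn_id hcont, cfc_id' ℝ a]
    rw [h1]
    refine norm_cfc_le hδ.le fun t ht => ?_
    have h0 := hsp t ht
    have : t - t * (t / (t + δ)) = δ * (t / (t + δ)) := by
      field_simp
      ring
    rw [this, Real.norm_of_nonneg (by positivity)]
    refine mul_le_of_le_one_right hδ.le ?_
    rw [div_le_one (by positivity)]
    linarith

/-- Rotate a predual functional to `g` with `g b > 0` and let `a` maximise `Re g` on `[0, b]`. For
`0 ≤ x ≤ 1` the element `a - √a x √a` is again in `[0, b]`, so maximality forces `Re g (√a x √a) ≥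
0`. Thus compressing the real part of `g` by `√a` gives a positive order continuous `ψ`. If `ψ b =
0`, then `ψ` kills `a` and every `0 ≤ y ≤ δ⁻¹ a`; choosing `y` with `√a y √a` within `δ` of `a`
makes `Re g a` arbitrarily small, although it is positive. -/
theorem exists_scottContinuous_ne_zero [WStarAlgebra B] {b : B} (hb : 0 ≤ b) (hb0 : b ≠ 0) :
    ∃ ψ : B →ₗ[ℂ] ℂ, ScottContinuous ψ ∧ ψ b ≠ 0 := by
  obtain ⟨𝒳, h𝒳⟩ := exists_isPredual (B := B)
  obtain ⟨f, hf, hfb⟩ : ∃ f ∈ 𝒳, f b ≠ 0 := by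
    by_contra! h
    exact hb0 (h𝒳.separating b h)
  set g : B →L[ℂ] ℂ := conj (f b) • f with hg
  have hgmem : (g : B →ₗ[ℂ] ℂ) ∈ orderContinuous B :=
    Submodule.smul_mem _ (conj (f b)) (h𝒳.mem_orderContinuous hf)
  obtain ⟨a, ha0, hab, hmax⟩ := h𝒳.exists_max_Icc hf (conj (f b)) hb
  change ∀ x, 0 ≤ x → x ≤ b → (g x).re ≤ (g a).re at hmax
  have hga : 0 < (g a).re := by
    refine lt_of_lt_of_le ?_ (hmax b hb le_rfl)
    change 0 < (conj (f b) * f b).re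
    rw [Complex.conj_mul', ← Complex.ofReal_pow, Complex.ofReal_re]
    positivity
  set c := CFC.sqrt a with hc
  have hcsa : IsSelfAdjoint c := .of_nonneg (CFC.sqrt_nonneg a)
  have hcc : c * c = a := CFC.sqrt_mul_sqrt_self a ha0
  set ψ := conjFunctional (reFunctional (g : B →ₗ[ℂ] ℂ)) c c with hψ
  have hψsa : ∀ x, IsSelfAdjoint x → ψ x = ((g (c * x * c)).re : ℂ) := fun x hx => by
    rw [hψ, conjFunctional_apply, hcsa.star_eq, reFunctional_apply_of_isSelfAdjoint]
    · rfl
    · simpa [hcsa.star_eq] using hx.conjugate c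
  have hpos : ∀ x, 0 ≤ x → 0 ≤ (g (c * x * c)).re := by
    intro x hx
    have hr : 0 < ‖x‖ + 1 := by positivity
    have hx1 : (‖x‖ + 1)⁻¹ • x ≤ 1 := by
      rw [← CStarAlgebra.norm_le_one_iff_of_nonneg _ (smul_nonneg (by positivity) hx), norm_smul,
        Real.norm_of_nonneg (by positivity), inv_mul_le_one₀ hr]
      linarith
    have h1 := sqrt_conjugate_le ha0 hx1
    have h2 : 0 ≤ c * ((‖x‖ + 1)⁻¹ • x) * c := sqrt_conjugate_nonneg (smul_nonneg (by positivity) hx)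
    have h3 := hmax (a - c * ((‖x‖ + 1)⁻¹ • x) * c) (sub_nonneg.mpr h1)
      ((sub_le_self _ h2).trans hab)
    have h4 : c * ((‖x‖ + 1)⁻¹ • x) * c = (((‖x‖ + 1)⁻¹ : ℝ) : ℂ) • (c * x * c) := by
      rw [Complex.coe_smul, mul_smul_comm, smul_mul_assoc]
    rw [h4, map_sub, map_smul, Complex.sub_re, smul_eq_mul, Complex.re_ofReal_mul] at h3
    have h5 : 0 < (‖x‖ + 1)⁻¹ := by positivity
    by_contra hneg
    nlinarith
  have hψnn : ∀ x, 0 ≤ x → 0 ≤ ψ x := fun x hx => by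
    rw [hψsa x (.of_nonneg hx)]
    exact_mod_cast hpos x hx
  have hψmono := LinearMap.monotone_of_nonneg hψnn
  refine ⟨ψ, scottContinuous_of_mem_orderContinuous
    (conjFunctional_self_mem (reFunctional_mem hgmem) c) hψmono, fun hψb => ?_⟩
  have hψa : ψ a = 0 := le_antisymm (hψb ▸ hψmono hab) (hψnn a ha0)
  have key : ∀ δ : ℝ, 0 < δ → (g a).re ≤ ‖g‖ * δ := by
    intro δ hδ
    obtain ⟨y, hy0, hya, hcomm, hnorm⟩ := exists_nonneg_le_norm_sub_mul_le ha0 hδ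
    have hψy : ψ y = 0 := by
      refine le_antisymm ((hψmono hya).trans_eq ?_) (hψnn y hy0)
      rw [← Complex.coe_smul, map_smul, hψa, smul_zero]
    have hcy : Commute y c := hcomm c (by
      rw [← hcc]
      exact (Commute.refl c).mul_left (Commute.refl c))
    have hcyc : c * y * c = a * y := by
      rw [mul_assoc, hcy.eq, ← mul_assoc, hcc]
    rw [← hcyc] at hnorm
    rw [hψsa y (.of_nonneg hy0)] at hψy
    have h0 : (g (c * y * c)).re = 0 := by exact_mod_cast hψy
    calc (g a).re = (g (a - c * y * c)).re + (g (c * y * c)).re := by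
          rw [map_sub, Complex.sub_re]; ring
      _ = (g (a - c * y * c)).re := by rw [h0, add_zero]
      _ ≤ ‖g (a - c * y * c)‖ := Complex.re_le_norm _
      _ ≤ ‖g‖ * ‖a - c * y * c‖ := g.le_opNorm _
      _ ≤ ‖g‖ * δ := by gcongr
  have h1 := key ((g a).re / (2 * (‖g‖ + 1))) (by positivity)
  have h2 : ‖g‖ * ((g a).re / (2 * (‖g‖ + 1))) ≤ (g a).re / 2 := by
    rw [mul_div_assoc', div_le_div_iff₀ (by positivity) (by positivity)]
    nlinarith [norm_nonneg g]
  linarith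

end OrderContinuous

/-! ### Supports, domination and a Radon–Nikodym theorem for normal functionals. -/

section Dominance

variable {B : Type u} [CStarAlgebra B] [PartialOrder B] [StarOrderedRing B]

/-- Chains have suprema, and order continuity carries `0 ≤ Re χ` to them, so Zorn's lemma applies.
These maximal elements replace spectral and Hahn decomposition projections: `χ = -φ` yields supports
and `χ = φ - n ψ` yields domination. -/
theorem exists_maximal_orderContinuous [WStarAlgebra B] {χ : B →ₗ[ℂ] ℂ}
    (hχ : χ ∈ orderContinuous B) :
    ∃ a, Maximal (fun a => 0 ≤ a ∧ a ≤ 1 ∧ 0 ≤ (χ a).re) a := by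
  refine zorn_le₀ {a : B | 0 ≤ a ∧ a ≤ 1 ∧ 0 ≤ (χ a).re} fun c hc hchain => ?_
  rcases c.eq_empty_or_nonempty with rfl | hne
  · exact ⟨0, ⟨le_rfl, zero_le_one, by simp⟩, by simp⟩
  · obtain ⟨s, hs⟩ := WStarAlgebra.exists_isLUB hne hchain.directedOn ⟨1, fun a ha => (hc ha).2.1⟩
    obtain ⟨a₀, ha₀⟩ := hne
    refine ⟨s, ⟨(hc ha₀).1.trans (hs.1 ha₀), hs.2 fun a ha => (hc ha).2.1, ?_⟩, hs.1⟩
    by_contra! hneg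
    obtain ⟨a, ha, H⟩ := hχ c ⟨a₀, ha₀⟩ hchain.directedOn s hs (-(χ s).re) (by linarith)
    have h1 := (Complex.re_le_norm _).trans_lt (H a ha le_rfl)
    rw [Complex.sub_re] at h1
    linarith [(hc ha).2.2]

theorem mul_self_le_of_le_one {e : B} (he0 : 0 ≤ e) (he1 : e ≤ 1) : e * e ≤ e := by
  have h := sqrt_conjugate_le he0 he1
  have hs := CFC.sqrt_mul_sqrt_self e he0
  have : CFC.sqrt e * e * CFC.sqrt e = e * e := by
    nth_rewrite 2 [← hs]
    rw [← mul_assoc, hs, mul_assoc, hs]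
  rwa [this] at h

theorem mul_eq_zero_of_conjugate_eq_zero {f p : B} (hf : 0 ≤ f) (hp : IsSelfAdjoint p)
    (h : p * f * p = 0) : f * p = 0 := by
  have hs := CFC.sqrt_mul_sqrt_self f hf
  have hsa : IsSelfAdjoint (CFC.sqrt f) := .of_nonneg (CFC.sqrt_nonneg f)
  have h1 : CFC.sqrt f * p = 0 := by
    rw [← CStarRing.star_mul_self_eq_zero_iff, star_mul, hsa.star_eq, hp.star_eq, ← h]
    nth_rewrite 3 [← hs]
    simp only [mul_assoc]
  rw [← hs, mul_assoc, h1, mul_zero]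

/-- The support of a normal positive functional. -/
theorem exists_support [WStarAlgebra B] {φ : B →ₗ[ℂ] ℂ} (hφ : φ ∈ orderContinuous B)
    (hpos : ∀ x, 0 ≤ x → 0 ≤ φ x) :
    ∃ p : B, IsSelfAdjoint p ∧ φ (1 - p) = 0 ∧ ∀ f, 0 ≤ f → φ f = 0 → f * p = 0 := by
  have hmono := LinearMap.monotone_of_nonneg hpos
  -- Since `φ` is positive, `0 ≤ Re (-φ e)` means `φ e = 0`: `e` is maximal among null elements of
  -- the unit interval, and `1 - e` is the support. Any null `f ≤ 1` could be compressed by `1 - e`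
  -- and added to `e`, so its compression vanishes.
  obtain ⟨e, ⟨he0, he1, heφ⟩, hmax⟩ := exists_maximal_orderContinuous (Submodule.neg_mem _ hφ)
  have hzero : ∀ x, 0 ≤ x → 0 ≤ ((-φ) x).re → φ x = 0 := fun x hx h => by
    have h1 := Complex.le_def.mp (hpos x hx)
    simp only [LinearMap.neg_apply, Complex.neg_re, Complex.zero_re, Complex.zero_im] at h h1
    exact Complex.ext (by simp; linarith) (by simp [← h1.2])
  have hφe := hzero e he0 heφ
  have hesa : IsSelfAdjoint e := .of_nonneg he0
  have hp : IsSelfAdjoint (1 - e) := (IsSelfAdjoint.one B).sub hesa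
  have main : ∀ f, 0 ≤ f → f ≤ 1 → φ f = 0 → f * (1 - e) = 0 := by
    intro f hf0 hf1 hφf
    refine mul_eq_zero_of_conjugate_eq_zero hf0 hp ?_
    have hnn : 0 ≤ (1 - e) * f * (1 - e) := hp.conjugate_nonneg hf0
    have hle1 : e + (1 - e) * f * (1 - e) ≤ 1 := by
      have h1 := hp.conjugate_le_conjugate hf1
      have h2 := mul_self_le_of_le_one he0 he1
      calc e + (1 - e) * f * (1 - e) ≤ e + (1 - e) * 1 * (1 - e) := by gcongr
        _ = 1 - (e - e * e) := by noncomm_ring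
        _ ≤ 1 := sub_le_self _ (sub_nonneg.mpr h2)
    -- The compression is null because `(1 - e) f (1 - e) + (1 + e) f (1 + e) = 2 (f + e f e)` and
    -- `e f e ≤ e`; that `e` is a projection is not needed.
    have hle2 : (1 - e) * f * (1 - e) ≤ (2 : ℂ) • (f + e) := by
      have h1 : 0 ≤ (1 + e) * f * (1 + e) := ((IsSelfAdjoint.one B).add hesa).conjugate_nonneg hf0
      have h2 := (hesa.conjugate_le_conjugate hf1).trans_eq (by rw [mul_one])
      have h3 : e * f * e ≤ e := h2.trans (mul_self_le_of_le_one he0 he1)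
      calc (1 - e) * f * (1 - e) = (2 : ℂ) • (f + e * f * e) - (1 + e) * f * (1 + e) := by
            rw [two_smul]; noncomm_ring
        _ ≤ (2 : ℂ) • (f + e * f * e) := sub_le_self _ h1
        _ ≤ (2 : ℂ) • (f + e) := by simp only [two_smul]; gcongr
    have hφ0 : φ ((1 - e) * f * (1 - e)) = 0 := by
      refine le_antisymm ((hmono hle2).trans_eq ?_) (hpos _ hnn)
      rw [map_smul, map_add, hφf, hφe, add_zero, smul_zero]
    have := hmax ⟨add_nonneg he0 hnn, hle1, by simp [map_add, hφe, hφ0]⟩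
      (le_add_of_nonneg_right hnn)
    exact le_antisymm (by simpa using this) hnn
  refine ⟨1 - e, hp, by simpa using hφe, fun f hf hφf => ?_⟩
  have hr : 0 < (‖f‖ + 1)⁻¹ := by positivity
  have h1 := main ((‖f‖ + 1)⁻¹ • f) (smul_nonneg hr.le hf) (by
      rw [← CStarAlgebra.norm_le_one_iff_of_nonneg _ (smul_nonneg hr.le hf), norm_smul,
        Real.norm_of_nonneg hr.le, inv_mul_le_one₀ (by positivity)]
      linarith)
    (by rw [← Complex.coe_smul, map_smul, hφf, smul_zero])
  rw [smul_mul_assoc] at h1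
  exact (smul_eq_zero.mp h1).resolve_left hr.ne'

variable {H K : Type*} [NormedAddCommGroup H] [InnerProductSpace ℂ H] [CompleteSpace H]
  [NormedAddCommGroup K] [InnerProductSpace ℂ K] [CompleteSpace K]

/-- The functional `x ↦ ⟪ζ, σ x ζ⟫`. -/
noncomputable def vectorFunctional (σ : B →⋆ₐ[ℂ] (K →L[ℂ] K)) (ζ : K) : B →ₗ[ℂ] ℂ where
  toFun x := ⟪ζ, σ x ζ⟫_ℂ
  map_add' x y := by simp [inner_add_right]
  map_smul' z x := by simp [inner_smul_right]

theorem vectorFunctional_apply (σ : B →⋆ₐ[ℂ] (K →L[ℂ] K)) (ζ : K) (x : B) :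
    vectorFunctional σ ζ x = ⟪ζ, σ x ζ⟫_ℂ := rfl

theorem inner_map_left (σ : B →⋆ₐ[ℂ] (K →L[ℂ] K)) (b : B) (x y : K) :
    ⟪σ b x, y⟫_ℂ = ⟪x, σ (star b) y⟫_ℂ := by
  rw [map_star, ContinuousLinearMap.star_eq_adjoint, ContinuousLinearMap.adjoint_inner_right]

theorem vectorFunctional_star_mul (σ : B →⋆ₐ[ℂ] (K →L[ℂ] K)) (ζ : K) (x : B) :
    vectorFunctional σ ζ (star x * x) = ((‖σ x ζ‖ ^ 2 : ℝ) : ℂ) := by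
  rw [vectorFunctional_apply, map_mul, ContinuousLinearMap.mul_apply, ← inner_map_left,
    inner_self_eq_norm_sq_to_K]
  simp

theorem vectorFunctional_nonneg (σ : B →⋆ₐ[ℂ] (K →L[ℂ] K)) (ζ : K) (x : B) (hx : 0 ≤ x) :
    0 ≤ vectorFunctional σ ζ x := by
  obtain ⟨y, rfl⟩ := CStarAlgebra.nonneg_iff_eq_star_mul_self.mp hx
  rw [vectorFunctional_star_mul]
  exact_mod_cast sq_nonneg ‖σ y ζ‖

theorem vectorFunctional_map (σ : B →⋆ₐ[ℂ] (K →L[ℂ] K)) (ζ : K) (c x : B) :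
    vectorFunctional σ (σ c ζ) x = vectorFunctional σ ζ (star c * x * c) := by
  simp only [vectorFunctional_apply, inner_map_left, map_mul, ContinuousLinearMap.mul_apply]

/-- A representation is normal if all its vector functionals are. -/
def IsNormalRep (σ : B →⋆ₐ[ℂ] (K →L[ℂ] K)) : Prop :=
  ∀ ζ, vectorFunctional σ ζ ∈ orderContinuous B

/-- A vector `ζ` in the range of `σ p`, with `p` the support of `φ`, has a functional `ψ` vanishing
on positive elements wherever `φ` does. Choose `n` with `n ψ 1 > φ 1` and a maximal `a` in the unit
interval with `(φ - n ψ) a ≥ 0`; put `c = √(1 - a)`. If `φ` exceeded `n ψ` at some `c x c` with `x ≥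
0`, a small multiple of `c x c` could be added to `a`. If `φ (1 - a) = 0`, then also `ψ (1 - a) =
0`, whence `(φ - n ψ) 1 ≥ 0`, a contradiction. -/
theorem exists_dominated_conjugate [WStarAlgebra B] {φ : B →ₗ[ℂ] ℂ} (hφ : φ ∈ orderContinuous B)
    (hpos : ∀ x, 0 ≤ x → 0 ≤ φ x) (hφ1 : φ 1 ≠ 0) {σ : B →⋆ₐ[ℂ] (K →L[ℂ] K)}
    (hσ : IsNormalRep σ) (hinj : Function.Injective σ) :
    ∃ (c : B) (ζ : K), IsSelfAdjoint c ∧ φ (c * c) ≠ 0 ∧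
      ∀ x, 0 ≤ x → φ (c * x * c) ≤ vectorFunctional σ ζ (c * x * c) := by
  obtain ⟨p, hp, hφp, hsupp⟩ := exists_support hφ hpos
  have hp0 : σ p ≠ 0 := fun h => by
    rw [(map_eq_zero_iff σ hinj).mp h, sub_zero] at hφp
    exact hφ1 hφp
  obtain ⟨ζ₀, hζ₀⟩ : ∃ ζ₀, σ p ζ₀ ≠ 0 := by
    by_contra! h
    exact hp0 (ContinuousLinearMap.ext h)
  set ζ := σ p ζ₀ with hζ
  set ψ := vectorFunctional σ ζ with hψ
  have hψ1 : ψ 1 = ((‖ζ‖ ^ 2 : ℝ) : ℂ) := by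
    have := vectorFunctional_star_mul σ ζ 1
    simpa using this
  have hac : ∀ f, 0 ≤ f → φ f = 0 → ψ f = 0 := fun f hf h => by
    rw [hψ, vectorFunctional_apply, hζ, ← ContinuousLinearMap.mul_apply (σ f), ← map_mul,
      hsupp f hf h]
    simp
  obtain ⟨n, hn⟩ := exists_nat_gt ((φ 1).re / ‖ζ‖ ^ 2)
  have hζ2 : 0 < ‖ζ‖ ^ 2 := by positivity
  rw [div_lt_iff₀ hζ2] at hn
  obtain ⟨a, ⟨ha0, ha1, haχ⟩, hmax⟩ := exists_maximal_orderContinuous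
    (Submodule.sub_mem _ hφ (Submodule.smul_mem _ (n : ℂ) (hσ ζ)))
  rw [← hψ] at haχ hmax
  have hre : ∀ x, ((φ - (n : ℂ) • ψ) x).re = (φ x).re - n * (ψ x).re := fun x => by
    simp
  rw [hre] at haχ
  have he0 : 0 ≤ 1 - a := sub_nonneg.mpr ha1
  set c := CFC.sqrt (1 - a) with hc
  have hcsa : IsSelfAdjoint c := .of_nonneg (CFC.sqrt_nonneg _)
  have hcc : c * c = 1 - a := CFC.sqrt_mul_sqrt_self _ he0
  refine ⟨c, (√n : ℂ) • ζ, hcsa, fun h => ?_, fun x hx => ?_⟩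
  · rw [hcc] at h
    have h1 := hac _ he0 h
    rw [map_sub, sub_eq_zero] at h h1
    rw [← h, ← h1, hψ1, Complex.ofReal_re] at haχ
    linarith
  · have hψ' : vectorFunctional σ ((√n : ℂ) • ζ) (c * x * c) = (n : ℂ) * ψ (c * x * c) := by
      rw [vectorFunctional_apply, map_smul, inner_smul_left, inner_smul_right, ← mul_assoc,
        Complex.conj_ofReal, ← Complex.ofReal_mul, Real.mul_self_sqrt (by positivity)]
      simp [hψ, vectorFunctional_apply]
    rw [hψ']
    have hr : 0 < (‖x‖ + 1)⁻¹ := by positivity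
    have hx1 : (‖x‖ + 1)⁻¹ • x ≤ 1 := by
      rw [← CStarAlgebra.norm_le_one_iff_of_nonneg _ (smul_nonneg hr.le hx), norm_smul,
        Real.norm_of_nonneg hr.le, inv_mul_le_one₀ (by positivity)]
      linarith
    set y := c * ((‖x‖ + 1)⁻¹ • x) * c with hy
    have hyx : y = (((‖x‖ + 1)⁻¹ : ℝ) : ℂ) • (c * x * c) := by
      rw [hy, Complex.coe_smul, mul_smul_comm, smul_mul_assoc]
    have hy0 : 0 ≤ y := sqrt_conjugate_nonneg (smul_nonneg hr.le hx)
    have hy1 : y ≤ 1 - a := sqrt_conjugate_le he0 hx1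
    have hcx : 0 ≤ c * x * c := sqrt_conjugate_nonneg hx
    have h1 := Complex.le_def.mp (hpos _ hcx)
    have h2 := Complex.le_def.mp (vectorFunctional_nonneg σ ζ _ hcx)
    rw [← hψ] at h2
    by_contra hcon
    have h3 : n * (ψ (c * x * c)).re < (φ (c * x * c)).re := by
      by_contra! h3
      refine hcon (Complex.le_def.mpr ⟨by simpa using h3, ?_⟩)
      simp [← h1.2, ← h2.2]
    have h4 : 0 < (φ y).re - n * (ψ y).re := by
      rw [hyx, map_smul, map_smul, smul_eq_mul, smul_eq_mul, Complex.re_ofReal_mul,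
        Complex.re_ofReal_mul]
      nlinarith
    have h5 := hmax (y := a + y) ⟨add_nonneg ha0 hy0, by
      simpa using add_le_add_right hy1 a, by
      rw [hre, map_add, map_add, Complex.add_re, Complex.add_re]; linarith⟩
      (le_add_of_nonneg_right hy0)
    have h6 : y = 0 := le_antisymm (by simpa using h5) hy0
    rw [h6] at h4
    simp at h4

theorem exists_extension {V : Type*} [AddCommGroup V] [Module ℂ V] (L : V →ₗ[ℂ] H) (M : V →ₗ[ℂ] K)
    (h : ∀ v, ‖L v‖ ≤ ‖M v‖) :
    ∃ T : K →L[ℂ] H, (∀ v, T (M v) = L v) ∧ ∀ z, (∀ v, ⟪M v, z⟫_ℂ = 0) → T z = 0 := by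
  set K₁ := (LinearMap.range M).topologicalClosure with hK₁
  have hmem : ∀ v, M v ∈ K₁ := fun v => Submodule.le_topologicalClosure _ ⟨v, rfl⟩
  let e : V →ₗ[ℂ] K₁ := M.codRestrict K₁ hmem
  have hd : DenseRange e := by
    rw [DenseRange, dense_iff_closure_eq, Set.eq_univ_iff_forall]
    intro x
    rw [closure_subtype]
    have hx : (x : K) ∈ closure (LinearMap.range M : Set K) := x.2
    convert hx using 2
    ext y
    simp [e, ← Set.range_comp]
  have hn : ∃ C, ∀ v, ‖L v‖ ≤ C * ‖e v‖ := ⟨1, fun v => by rw [one_mul]; exact h v⟩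
  refine ⟨(L.extendOfNorm e) ∘L K₁.orthogonalProjection, fun v => ?_, fun z hz => ?_⟩
  · have : K₁.orthogonalProjection (M v) = e v :=
      Submodule.orthogonalProjection_mem_subspace_eq_self (K := K₁) ⟨M v, hmem v⟩
    rw [ContinuousLinearMap.comp_apply, this, LinearMap.extendOfNorm_eq hd hn]
  · have : K₁.orthogonalProjection z = 0 := by
      rw [Submodule.orthogonalProjection_eq_zero_iff, hK₁, Submodule.orthogonal_closure]
      rw [Submodule.mem_orthogonal]
      rintro _ ⟨v, rfl⟩
      exact hz v
    rw [ContinuousLinearMap.comp_apply, this, map_zero]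

theorem eq_of_eq_on_range_of_eq_on_orthogonal {V : Type*} [AddCommGroup V] [Module ℂ V]
    {M : V →ₗ[ℂ] K} {S T : K →L[ℂ] H} (h : ∀ v, S (M v) = T (M v))
    (h' : ∀ z, (∀ v, ⟪M v, z⟫_ℂ = 0) → S z = T z) : S = T := by
  set K₁ := (LinearMap.range M).topologicalClosure with hK₁
  have h1 : K₁ ≤ LinearMap.eqLocus (S : K →ₗ[ℂ] H) T :=
    Submodule.topologicalClosure_minimal _ (by rintro _ ⟨v, rfl⟩; exact h v)
      (isClosed_eq S.continuous T.continuous)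
  ext z
  rw [← K₁.starProjection_add_starProjection_orthogonal z, map_add, map_add]
  congr 1
  · exact h1 (K₁.starProjection_apply_mem z)
  · refine h' _ fun v => ?_
    exact Submodule.inner_right_of_mem_orthogonal
      (Submodule.le_topologicalClosure (LinearMap.range M) ⟨v, rfl⟩ : M v ∈ K₁)
      (K₁ᗮ.starProjection_apply_mem z)

/-- The map `σ x ζ ↦ τ x ξ` extends to a contraction `T`, zero on the orthogonal complement, that
intertwines `σ` and `τ`. Hence `T⋆ T` and its square root `R` commute with `σ`, and `R ζ` has the
same functional as `T ζ = ξ`. -/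
theorem exists_vectorFunctional_eq {σ : B →⋆ₐ[ℂ] (K →L[ℂ] K)} {τ : B →⋆ₐ[ℂ] (H →L[ℂ] H)}
    {ζ : K} {ξ : H} (h : ∀ x, ‖τ x ξ‖ ≤ ‖σ x ζ‖) :
    ∃ ζ', vectorFunctional σ ζ' = vectorFunctional τ ξ := by
  let L : B →ₗ[ℂ] H :=
    { toFun := fun x => τ x ξ, map_add' := by simp, map_smul' := by simp }
  let M : B →ₗ[ℂ] K :=
    { toFun := fun x => σ x ζ, map_add' := by simp, map_smul' := by simp }
  obtain ⟨T, hT, hT0⟩ := exists_extension L M h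
  have hint : ∀ b, T ∘L σ b = τ b ∘L T := by
    intro b
    refine eq_of_eq_on_range_of_eq_on_orthogonal (M := M) (fun x => ?_) fun z hz => ?_
    · have h1 : σ b (M x) = M (b * x) := by
        change σ b (σ x ζ) = σ (b * x) ζ
        rw [map_mul]; rfl
      have h2 : τ b (L x) = L (b * x) := by
        change τ b (τ x ξ) = τ (b * x) ξ
        rw [map_mul]; rfl
      rw [ContinuousLinearMap.comp_apply, ContinuousLinearMap.comp_apply, h1, hT, hT, h2]
    · rw [ContinuousLinearMap.comp_apply, ContinuousLinearMap.comp_apply, hT0 z hz, map_zero]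
      refine hT0 _ fun x => ?_
      have h1 := hz (star b * x)
      change ⟪σ (star b * x) ζ, z⟫_ℂ = 0 at h1
      rw [map_mul, ContinuousLinearMap.mul_apply, inner_map_left, star_star] at h1
      exact h1
  set S := T.adjoint ∘L T with hS
  have hScomm : ∀ b, Commute S (σ b) := by
    intro b
    have h1 : σ b ∘L T.adjoint = T.adjoint ∘L τ b := by
      have := congrArg ContinuousLinearMap.adjoint (hint (star b))
      rw [ContinuousLinearMap.adjoint_comp, ContinuousLinearMap.adjoint_comp,
        ← ContinuousLinearMap.star_eq_adjoint (σ _), ← ContinuousLinearMap.star_eq_adjoint (τ _),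
        ← map_star, ← map_star, star_star] at this
      exact this
    change (T.adjoint ∘L T) ∘L σ b = σ b ∘L (T.adjoint ∘L T)
    rw [ContinuousLinearMap.comp_assoc, hint, ← ContinuousLinearMap.comp_assoc, ← h1,
      ContinuousLinearMap.comp_assoc]
  have hS0 : 0 ≤ S := by
    rw [ContinuousLinearMap.nonneg_iff_isPositive]
    exact ContinuousLinearMap.isPositive_adjoint_comp_self T
  set R := CFC.sqrt S with hR
  have hRsa : IsSelfAdjoint R := .of_nonneg (CFC.sqrt_nonneg S)
  have hRR : R * R = S := CFC.sqrt_mul_sqrt_self S hS0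
  have hRcomm : ∀ b, Commute R (σ b) := fun b => by
    rw [hR, CFC.sqrt_eq_real_sqrt S hS0]
    exact Commute.cfcₙ_real (hScomm b) _
  refine ⟨R ζ, LinearMap.ext fun x => ?_⟩
  have e1 : T ζ = ξ := by
    have := hT 1
    simpa [M, L] using this
  calc ⟪R ζ, σ x (R ζ)⟫_ℂ = ⟪R ζ, R (σ x ζ)⟫_ℂ := by
        rw [← ContinuousLinearMap.mul_apply, ← (hRcomm x).eq, ContinuousLinearMap.mul_apply]
    _ = ⟪ζ, S (σ x ζ)⟫_ℂ := by
        rw [← hRR, ContinuousLinearMap.mul_apply, ← ContinuousLinearMap.adjoint_inner_right R,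
          ← ContinuousLinearMap.star_eq_adjoint, hRsa.star_eq]
    _ = ⟪T ζ, T (σ x ζ)⟫_ℂ := by
        rw [hS, ContinuousLinearMap.comp_apply, ContinuousLinearMap.adjoint_inner_right]
    _ = ⟪ξ, τ x ξ⟫_ℂ := by
        have : T (σ x ζ) = τ x ξ := hT x
        rw [this, e1]

/-- Only a nonzero piece `τ c ξ` of `ξ` gets matched with a vector of `K`; exhaustion by Zorn's
lemma needs no more. -/
theorem exists_common_vectorFunctional [WStarAlgebra B] {σ : B →⋆ₐ[ℂ] (K →L[ℂ] K)}
    {τ : B →⋆ₐ[ℂ] (H →L[ℂ] H)} (hσ : IsNormalRep σ) (hinj : Function.Injective σ)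
    (hτ : IsNormalRep τ) {ξ : H} (hξ : ξ ≠ 0) :
    ∃ (c : B) (ζ : K), τ c ξ ≠ 0 ∧ vectorFunctional σ ζ = vectorFunctional τ (τ c ξ) := by
  obtain ⟨c, ζ, hc, hφc, hle⟩ := exists_dominated_conjugate (hτ ξ) (vectorFunctional_nonneg τ ξ)
    (by simpa [vectorFunctional_apply] using hξ) hσ hinj
  have h0 : τ c ξ ≠ 0 := fun h => by
    have := vectorFunctional_star_mul τ ξ c
    rw [h, hc.star_eq] at this
    exact hφc (by simpa using this)
  obtain ⟨ζ', h'⟩ := exists_vectorFunctional_eq (σ := σ) (τ := τ) (ζ := σ c ζ) (ξ := τ c ξ)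
    fun x => by
      have h1 := hle (star x * x) (star_mul_self_nonneg x)
      have h2 : c * (star x * x) * c = star c * (star x * x) * c := by rw [hc.star_eq]
      rw [h2, ← vectorFunctional_map, ← vectorFunctional_map, vectorFunctional_star_mul,
        vectorFunctional_star_mul, Complex.real_le_real] at h1
      exact (sq_le_sq₀ (norm_nonneg _) (norm_nonneg _)).mp h1
  exact ⟨c, ζ', h0, h'⟩

end Dominance

/-! ### Equivalence of faithful normal representations up to amplification. -/

section Equivalence

variable {B : Type u} [CStarAlgebra B] [PartialOrder B] [StarOrderedRing B]
variable {H K : Type*} [NormedAddCommGroup H] [InnerProductSpace ℂ H] [CompleteSpace H]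
  [NormedAddCommGroup K] [InnerProductSpace ℂ K] [CompleteSpace K]

/-- A normal representation decomposes into cyclic ones given by vector functionals of a faithful
normal representation. -/
theorem exists_cyclic_decomposition [WStarAlgebra B] {σ : B →⋆ₐ[ℂ] (K →L[ℂ] K)}
    {τ : B →⋆ₐ[ℂ] (H →L[ℂ] H)} (hσ : IsNormalRep σ) (hinj : Function.Injective σ)
    (hτ : IsNormalRep τ) :
    ∃ S : Set H, (∀ s ∈ S, ∃ ζ, vectorFunctional σ ζ = vectorFunctional τ s) ∧
      (∀ s ∈ S, ∀ t ∈ S, s ≠ t → ∀ b, ⟪s, τ b t⟫_ℂ = 0) ∧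
      (Submodule.span ℂ {x | ∃ b, ∃ s ∈ S, x = τ b s}).topologicalClosure = ⊤ := by
  obtain ⟨S, ⟨hS1, hS2⟩, hmax⟩ := zorn_subset
    {S : Set H | (∀ s ∈ S, ∃ ζ, vectorFunctional σ ζ = vectorFunctional τ s) ∧
      (∀ s ∈ S, ∀ t ∈ S, s ≠ t → ∀ b, ⟪s, τ b t⟫_ℂ = 0)} fun c hc hchain => by
    refine ⟨⋃₀ c, ⟨?_, ?_⟩, fun s hs => Set.subset_sUnion_of_mem hs⟩
    · rintro s ⟨C, hC, hs⟩
      exact (hc hC).1 s hs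
    · rintro s ⟨C, hC, hs⟩ t ⟨D, hD, ht⟩ hst
      rcases hchain.total hC hD with h | h
      · exact (hc hD).2 s (h hs) t ht hst
      · exact (hc hC).2 s hs t (h ht) hst
  refine ⟨S, hS1, hS2, ?_⟩
  rw [Submodule.topologicalClosure_eq_top_iff, Submodule.eq_bot_iff]
  intro ξ hξ
  by_contra hξ0
  obtain ⟨c, ζ, hc0, hζ⟩ := exists_common_vectorFunctional hσ hinj hτ hξ0
  have hort : ∀ s ∈ S, ∀ b, ⟪τ c ξ, τ b s⟫_ℂ = 0 := fun s hs b => by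
    rw [inner_map_left, ← ContinuousLinearMap.mul_apply, ← map_mul]
    exact (Submodule.mem_orthogonal' _ _).mp hξ _
      (Submodule.subset_span ⟨star c * b, s, hs, rfl⟩)
  have hmem : insert (τ c ξ) S ⊆ S := by
    refine hmax ⟨?_, ?_⟩ (Set.subset_insert _ _)
    · rintro s (rfl | hs)
      exacts [⟨ζ, hζ⟩, hS1 s hs]
    · rintro s (rfl | hs) t (rfl | ht) hst b
      · exact absurd rfl hst
      · exact hort t ht b
      · have := hort s hs (star b)
        rw [← inner_conj_symm, inner_map_left, this, map_zero]
      · exact hS2 s hs t ht hst b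
  have h1 := hort _ (hmem (Set.mem_insert _ _)) 1
  rw [map_one, ContinuousLinearMap.one_apply, inner_self_eq_zero] at h1
  exact hc0 h1

theorem norm_lsum_eq {P V : Type*} [AddCommGroup V] [Module ℂ V] {L : P → V →ₗ[ℂ] K}
    {M : P → V →ₗ[ℂ] H} (h : ∀ p q a b, ⟪L p a, L q b⟫_ℂ = ⟪M p a, M q b⟫_ℂ) (v : P →₀ V) :
    ‖Finsupp.lsum ℂ L v‖ = ‖Finsupp.lsum ℂ M v‖ := by
  have : ⟪Finsupp.lsum ℂ L v, Finsupp.lsum ℂ L v⟫_ℂ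
      = ⟪Finsupp.lsum ℂ M v, Finsupp.lsum ℂ M v⟫_ℂ := by
    simp only [Finsupp.lsum_apply, Finsupp.sum, sum_inner, inner_sum, h]
  rw [inner_self_eq_norm_sq_to_K, inner_self_eq_norm_sq_to_K] at this
  exact (sq_eq_sq₀ (norm_nonneg _) (norm_nonneg _)).mp (by exact_mod_cast this)

/-- The representation `τ` contains the mutually orthogonal copies `i k` of `τ₀`. -/
structure IsAmplification {H₀ κ : Type*} [NormedAddCommGroup H₀] [InnerProductSpace ℂ H₀]
    [CompleteSpace H₀] (τ₀ : B →⋆ₐ[ℂ] (H₀ →L[ℂ] H₀)) (τ : B →⋆ₐ[ℂ] (H →L[ℂ] H))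
    (i : κ → H₀ →L[ℂ] H) : Prop where
  inner_self : ∀ k x y, ⟪i k x, i k y⟫_ℂ = ⟪x, y⟫_ℂ
  inner_ne : ∀ k l x y, k ≠ l → ⟪i k x, i l y⟫_ℂ = 0
  map : ∀ k b x, τ b (i k x) = i k (τ₀ b x)
  total : (Submodule.span ℂ {x | ∃ k y, x = i k y}).topologicalClosure = ⊤

/-- Vectors with equal functionals generate equivalent cyclic representations. The vectors `ζ s`
need not generate orthogonal subspaces, so the cyclic piece `(s, k)` of `τ` is sent into the copy
numbered `m (s, k)` of `σ₀`; injectivity of `m` keeps different pieces orthogonal. -/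
theorem exists_isometric_intertwiner [WStarAlgebra B] {H₀ K₀ κ : Type*} [NormedAddCommGroup H₀]
    [InnerProductSpace ℂ H₀] [CompleteSpace H₀] [NormedAddCommGroup K₀]
    [InnerProductSpace ℂ K₀] [CompleteSpace K₀]
    {τ₀ : B →⋆ₐ[ℂ] (H₀ →L[ℂ] H₀)} {σ₀ : B →⋆ₐ[ℂ] (K₀ →L[ℂ] K₀)}
    {τ : B →⋆ₐ[ℂ] (H →L[ℂ] H)} {σ : B →⋆ₐ[ℂ] (K →L[ℂ] K)}
    {i : κ → H₀ →L[ℂ] H} {j : κ → K₀ →L[ℂ] K}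
    (hi : IsAmplification τ₀ τ i) (hj : IsAmplification σ₀ σ j)
    {S : Set H₀} (hS1 : ∀ s ∈ S, ∃ ζ, vectorFunctional σ₀ ζ = vectorFunctional τ₀ s)
    (hS2 : ∀ s ∈ S, ∀ t ∈ S, s ≠ t → ∀ b, ⟪s, τ₀ b t⟫_ℂ = 0)
    (hS3 : (Submodule.span ℂ {x | ∃ b, ∃ s ∈ S, x = τ₀ b s}).topologicalClosure = ⊤)
    {m : S × κ → κ} (hm : Function.Injective m) :
    ∃ V : H →L[ℂ] K, (∀ x, ‖V x‖ = ‖x‖) ∧ ∀ b x, V (τ b x) = σ b (V x) := by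
  choose! ζ hζ using hS1
  let L : S × κ → B →ₗ[ℂ] K := fun p =>
    { toFun := fun b => j (m p) (σ₀ b (ζ p.1)), map_add' := by simp, map_smul' := by simp }
  let M : S × κ → B →ₗ[ℂ] H := fun p =>
    { toFun := fun b => i p.2 (τ₀ b p.1), map_add' := by simp, map_smul' := by simp }
  have hLM : ∀ p q a b, ⟪L p a, L q b⟫_ℂ = ⟪M p a, M q b⟫_ℂ := by
    intro p q a b
    change ⟪j (m p) (σ₀ a (ζ p.1)), j (m q) (σ₀ b (ζ q.1))⟫_ℂ
      = ⟪i p.2 (τ₀ a p.1), i q.2 (τ₀ b q.1)⟫_ℂ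
    by_cases hpq : p = q
    · subst hpq
      rw [hj.inner_self, hi.inner_self, inner_map_left, inner_map_left,
        ← ContinuousLinearMap.mul_apply, ← ContinuousLinearMap.mul_apply, ← map_mul, ← map_mul]
      exact LinearMap.congr_fun (hζ p.1 p.1.2) _
    · rw [hj.inner_ne _ _ _ _ (hm.ne hpq)]
      by_cases hk : p.2 = q.2
      · have hs : (p.1 : H₀) ≠ q.1 := fun h => hpq (Prod.ext (Subtype.ext h) hk)
        rw [hk, hi.inner_self, inner_map_left, ← ContinuousLinearMap.mul_apply, ← map_mul,
          hS2 _ p.1.2 _ q.1.2 hs]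
      · rw [hi.inner_ne _ _ _ _ hk]
  obtain ⟨V, hV, -⟩ := exists_extension (Finsupp.lsum ℂ L) (Finsupp.lsum ℂ M)
    fun v => (norm_lsum_eq hLM v).le
  have hVM : ∀ p b, V (M p b) = L p b := fun p b => by
    have := hV (Finsupp.single p b)
    simpa using this
  have hclosed : ∀ k, IsClosed ((i k : H₀ → H) ⁻¹'
      ((LinearMap.range (Finsupp.lsum ℂ M)).topologicalClosure : Set H)) := fun k =>
    (Submodule.isClosed_topologicalClosure _).preimage (i k).continuous
  have hdense : (LinearMap.range (Finsupp.lsum ℂ M)).topologicalClosure = ⊤ := by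
    have h1 : ∀ k y, i k y ∈ (LinearMap.range (Finsupp.lsum ℂ M)).topologicalClosure := by
      intro k y
      have h2 : (⊤ : Submodule ℂ H₀) ≤ ((LinearMap.range (Finsupp.lsum ℂ M)).topologicalClosure).comap
          (i k : H₀ →ₗ[ℂ] H) := by
        rw [← hS3]
        refine Submodule.topologicalClosure_minimal _ (Submodule.span_le.mpr ?_) (hclosed k)
        rintro _ ⟨b, s, hs, rfl⟩
        exact Submodule.le_topologicalClosure _
          ⟨Finsupp.single (⟨s, hs⟩, k) b, by simp [M]⟩
      exact h2 Submodule.mem_top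
    rw [eq_top_iff, ← hi.total]
    refine Submodule.topologicalClosure_minimal _ (Submodule.span_le.mpr ?_)
      (Submodule.isClosed_topologicalClosure _)
    rintro _ ⟨k, y, rfl⟩
    exact h1 k y
  have hD : Dense (LinearMap.range (Finsupp.lsum ℂ M) : Set H) :=
    Submodule.dense_iff_topologicalClosure_eq_top.mpr hdense
  refine ⟨V, fun x => ?_, fun b => ?_⟩
  · refine hD.induction (P := fun x => ‖V x‖ = ‖x‖) ?_
      (isClosed_eq (by fun_prop) (by fun_prop)) x
    rintro _ ⟨v, rfl⟩
    rw [hV, norm_lsum_eq hLM]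
  · refine fun x => hD.induction (P := fun x => V (τ b x) = σ b (V x)) ?_
      (isClosed_eq (by fun_prop) (by fun_prop)) x
    rintro _ ⟨v, rfl⟩
    induction v using Finsupp.induction_linear with
    | zero => simp
    | add f g hf hg => simp only [map_add, hf, hg]
    | single p a =>
      have h1 : τ b (M p a) = M p (b * a) := by
        change τ b (i p.2 (τ₀ a p.1)) = i p.2 (τ₀ (b * a) p.1)
        rw [hi.map, map_mul]; rfl
      have h2 : σ b (L p a) = L p (b * a) := by
        change σ b (j (m p) (σ₀ a (ζ p.1))) = j (m p) (σ₀ (b * a) (ζ p.1))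
        rw [hj.map, map_mul]; rfl
      simp only [Finsupp.lsum_single, h1, hVM, h2]

/-- The Cantor–Bernstein theorem for isometric intertwiners. -/
theorem exists_unitary_intertwiner {τ : B →⋆ₐ[ℂ] (H →L[ℂ] H)} {σ : B →⋆ₐ[ℂ] (K →L[ℂ] K)}
    {V : H →L[ℂ] K} {W : K →L[ℂ] H} (hV : ∀ x, ‖V x‖ = ‖x‖) (hW : ∀ x, ‖W x‖ = ‖x‖)
    (hVτ : ∀ b x, V (τ b x) = σ b (V x)) (hWσ : ∀ b x, W (σ b x) = τ b (W x)) :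
    ∃ U : H ≃ₗᵢ[ℂ] K, ∀ b x, U (τ b x) = σ b (U x) := by
  have hWi : ∀ x y, ⟪W x, W y⟫_ℂ = ⟪x, y⟫_ℂ := fun x y =>
    LinearIsometry.inner_map_map (⟨(W : K →ₗ[ℂ] H), hW⟩ : K →ₗᵢ[ℂ] H) x y
  have hWstar : ∀ y, W.adjoint (W y) = y := fun y => ext_inner_left ℂ fun x => by
    rw [ContinuousLinearMap.adjoint_inner_right, hWi]
  set N := (LinearMap.range (W : K →ₗ[ℂ] H))ᗮ with hN
  set S : H →L[ℂ] H := W ∘L V with hS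
  -- As for sets, `M` collects the orbit under `W V` of the part of `H` missed by `W`. The unitary
  -- is `V` on `M` and `W⋆` on `Mᗮ`, which lies in the range of `W`; the images are orthogonal
  -- because `W V` preserves `M`.
  set M := (⨆ n : ℕ, N.map ((S ^ n : H →L[ℂ] H) : H →ₗ[ℂ] H)).topologicalClosure with hM
  have hSM : ∀ n, ∀ x ∈ N, (S ^ n) x ∈ M := fun n x hx =>
    Submodule.le_topologicalClosure _ (Submodule.mem_iSup_of_mem n ⟨x, hx, rfl⟩)
  have hmin : ∀ Q : Submodule ℂ H, IsClosed (Q : Set H) → (∀ n, ∀ x ∈ N, (S ^ n) x ∈ Q) → M ≤ Q :=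
    fun Q hQ h => Submodule.topologicalClosure_minimal _ (iSup_le fun n => by
      rintro _ ⟨x, hx, rfl⟩
      exact h n x hx) hQ
  have hMc : IsClosed (M : Set H) := Submodule.isClosed_topologicalClosure _
  have hS_M : ∀ x ∈ M, S x ∈ M := by
    refine hmin (M.comap (S : H →ₗ[ℂ] H)) (hMc.preimage S.continuous) fun n x hx => ?_
    have := hSM (n + 1) x hx
    rwa [pow_succ'] at this
  have hτN : ∀ b, ∀ x ∈ N, τ b x ∈ N := by
    intro b x hx
    rw [hN, Submodule.mem_orthogonal] at hx ⊢
    rintro _ ⟨y, rfl⟩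
    have := hx (W (σ (star b) y)) ⟨_, rfl⟩
    rw [hWσ, inner_map_left, star_star] at this
    exact this
  have hSτ : ∀ n b x, (S ^ n) (τ b x) = τ b ((S ^ n) x) := by
    intro n b
    induction n with
    | zero => simp
    | succ n ih =>
      intro x
      rw [pow_succ', ContinuousLinearMap.mul_apply, ih, ContinuousLinearMap.mul_apply]
      change W (V _) = τ b (W (V _))
      rw [hVτ, hWσ]
  have hτM : ∀ b, ∀ x ∈ M, τ b x ∈ M := fun b => by
    refine hmin (M.comap (τ b : H →ₗ[ℂ] H)) (hMc.preimage (τ b).continuous) fun n x hx => ?_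
    change τ b ((S ^ n) x) ∈ M
    rw [← hSτ]
    exact hSM n _ (hτN b x hx)
  have hτM' : ∀ b, ∀ x ∈ Mᗮ, τ b x ∈ Mᗮ := fun b x hx => by
    rw [Submodule.mem_orthogonal] at hx ⊢
    intro y hy
    have := hx _ (hτM (star b) y hy)
    rwa [inner_map_left, star_star] at this
  have hM'W : ∀ z ∈ Mᗮ, ∃ y, W y = z := by
    intro z hz
    have h1 : z ∈ Nᗮ := by
      rw [Submodule.mem_orthogonal] at hz ⊢
      exact fun x hx => hz x (by simpa using hSM 0 x hx)
    have hcl : IsClosed ((LinearMap.range (W : K →ₗ[ℂ] H) : Submodule ℂ H) : Set H) := by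
      have : Isometry W := AddMonoidHomClass.isometry_of_norm W hW
      have h2 := this.isClosedEmbedding.isClosed_range
      exact h2
    have : CompleteSpace (LinearMap.range (W : K →ₗ[ℂ] H)) := hcl.completeSpace_coe
    rw [hN, Submodule.orthogonal_orthogonal] at h1
    exact h1
  have : CompleteSpace M := hMc.completeSpace_coe
  have hpτ : ∀ b x, M.starProjection (τ b x) = τ b (M.starProjection x) := fun b x =>
    Submodule.eq_starProjection_of_mem_orthogonal' (hτM b _ (M.starProjection_apply_mem x))
      (hτM' b _ (Mᗮ.starProjection_apply_mem x))
      (by rw [← map_add, M.starProjection_add_starProjection_orthogonal])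
  have hW'σ : ∀ b x, W.adjoint (τ b x) = σ b (W.adjoint x) := fun b x =>
    ext_inner_left ℂ fun y => by
      have h1 : ⟪y, σ b (W.adjoint x)⟫_ℂ = ⟪σ (star b) y, W.adjoint x⟫_ℂ := by
        rw [inner_map_left, star_star]
      rw [ContinuousLinearMap.adjoint_inner_right, h1, ContinuousLinearMap.adjoint_inner_right,
        hWσ, inner_map_left, star_star]
  set U : H →L[ℂ] K := V ∘L M.starProjection + W.adjoint ∘L Mᗮ.starProjection with hU
  have hUapp : ∀ x, U x = V (M.starProjection x) + W.adjoint (Mᗮ.starProjection x) := fun x => rfl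
  have hUnorm : ∀ x, ‖U x‖ = ‖x‖ := by
    intro x
    have hp := M.starProjection_apply_mem x
    have hq := Mᗮ.starProjection_apply_mem x
    obtain ⟨y, hy⟩ := hM'W _ hq
    have h1 : ⟪V (M.starProjection x), W.adjoint (Mᗮ.starProjection x)⟫_ℂ = 0 := by
      rw [ContinuousLinearMap.adjoint_inner_right]
      exact Submodule.inner_right_of_mem_orthogonal (hS_M _ hp) hq
    have h2 : ⟪M.starProjection x, Mᗮ.starProjection x⟫_ℂ = 0 :=
      Submodule.inner_right_of_mem_orthogonal hp hq
    have h3 := norm_add_sq_eq_norm_sq_add_norm_sq_of_inner_eq_zero _ _ h1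
    have h4 := norm_add_sq_eq_norm_sq_add_norm_sq_of_inner_eq_zero _ _ h2
    rw [M.starProjection_add_starProjection_orthogonal, ← hy, hW] at h4
    rw [← hUapp, ← hy, hWstar, hV] at h3
    exact (mul_self_inj_of_nonneg (norm_nonneg _) (norm_nonneg _)).mp (h3.trans h4.symm)
  let U' : H →ₗᵢ[ℂ] K := ⟨(U : H →ₗ[ℂ] K), hUnorm⟩
  have hsurj : Function.Surjective U' := by
    have hcl : IsClosed ((LinearMap.range U'.toLinearMap : Submodule ℂ K) : Set K) := by
      have h2 := U'.isometry.isClosedEmbedding.isClosed_range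
      exact h2
    have : CompleteSpace (LinearMap.range U'.toLinearMap) := hcl.completeSpace_coe
    rw [← LinearIsometry.coe_toLinearMap, ← LinearMap.range_eq_top,
      ← Submodule.orthogonal_eq_bot_iff, Submodule.eq_bot_iff]
    intro y hy
    have hyU : ∀ x, ⟪U x, y⟫_ℂ = 0 := fun x =>
      Submodule.inner_right_of_mem_orthogonal (LinearMap.mem_range_self _ x) hy
    have hyV : ∀ x ∈ M, ⟪V x, y⟫_ℂ = 0 := fun x hx => by
      have h1 := hyU x
      rw [hUapp, M.starProjection_eq_self_iff.mpr hx,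
        Submodule.starProjection_orthogonal_apply_eq_zero hx] at h1
      simpa using h1
    have hyW : W y ∈ M := by
      rw [← M.orthogonal_orthogonal, Submodule.mem_orthogonal]
      intro z hz
      have h1 := hyU z
      rw [hUapp, Mᗮ.starProjection_eq_self_iff.mpr hz,
        M.starProjection_apply_eq_zero_iff.mpr hz] at h1
      rw [map_zero, zero_add, ContinuousLinearMap.adjoint_inner_left] at h1
      exact h1
    -- For `y` orthogonal to the range of `U`, the vector `W y` lies in `M` and is also orthogonal
    -- to `M`: to `N` because it is in the range of `W`, and to `W V (S ^ n N)` because `W` is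
    -- isometric and `y` is orthogonal to `V M`.
    have hyW' : M ≤ (Submodule.span ℂ {W y})ᗮ := by
      refine hmin _ (Submodule.isClosed_orthogonal _) fun n x hx => ?_
      rw [Submodule.mem_orthogonal_singleton_iff_inner_left]
      rcases n with _ | n
      · rw [pow_zero, ContinuousLinearMap.one_apply]
        exact Submodule.inner_left_of_mem_orthogonal (LinearMap.mem_range_self _ y) hx
      · rw [pow_succ', ContinuousLinearMap.mul_apply]
        change ⟪W (V _), W y⟫_ℂ = 0
        rw [hWi]
        exact hyV _ (hSM n x hx)
    have h1 := Submodule.mem_orthogonal_singleton_iff_inner_left.mp (hyW' hyW)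
    rw [hWi, inner_self_eq_zero] at h1
    exact h1
  refine ⟨LinearIsometryEquiv.ofSurjective U' hsurj, fun b x => ?_⟩
  change U (τ b x) = σ b (U x)
  have hqτ : Mᗮ.starProjection (τ b x) = τ b (Mᗮ.starProjection x) := by
    have h1 := M.starProjection_add_starProjection_orthogonal (τ b x)
    rw [hpτ] at h1
    have h2 := congrArg (τ b) (M.starProjection_add_starProjection_orthogonal x)
    rw [map_add] at h2
    exact add_left_cancel (h1.trans h2.symm)
  rw [hUapp, hUapp, hpτ, hqτ, hVτ, hW'σ, map_add]

end Equivalence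

/-! ### The inner product in right-module notation. -/

section RightInner

variable {B : Type u} [CStarAlgebra B] [PartialOrder B] [StarOrderedRing B]
  {F : Type*} [NormedAddCommGroup F] [NormedSpace ℂ F] [Module Bᵐᵒᵖ F] [CStarModule Bᵐᵒᵖ F]

theorem rightInner_apply (x y : F) : rightInner B x y = unop ⟪x, y⟫_Bᵐᵒᵖ := rfl

theorem rightInner_add_left (x y z : F) :
    rightInner B (x + y) z = rightInner B x z + rightInner B y z := by
  simp [rightInner_apply]

theorem rightInner_smul_left (c : ℂ) (x y : F) :
    rightInner B (c • x) y = conj c • rightInner B x y := by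
  simp [rightInner_apply]

@[simp]
theorem rightInner_zero_left (y : F) : rightInner B (0 : F) y = 0 := by
  simp [rightInner_apply]

theorem star_rightInner (x y : F) : star (rightInner B x y) = rightInner B y x := by
  rw [rightInner_apply, rightInner_apply, ← unop_star, CStarModule.star_inner]

theorem rightInner_self_nonneg (x : F) : 0 ≤ rightInner B x x :=
  CStarModule.inner_self_nonneg (A := Bᵐᵒᵖ)

theorem rightInner_op_smul_right (x y : F) (b : B) :
    rightInner B x (op b • y) = rightInner B x y * b := by
  simp [rightInner_apply]

theorem rightInner_op_smul_left (x y : F) (b : B) :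
    rightInner B (op b • x) y = star b * rightInner B x y := by
  simp [rightInner_apply]

theorem norm_rightInner_self (x : F) : ‖rightInner B x x‖ = ‖x‖ ^ 2 := by
  rw [CStarModule.norm_sq_eq Bᵐᵒᵖ, rightInner_apply, MulOpposite.norm_unop]

theorem rightInner_self_eq_zero {x : F} : rightInner B x x = 0 ↔ x = 0 := by
  rw [rightInner_apply, unop_eq_zero_iff, CStarModule.inner_self]

theorem ext_rightInner {x y : F} (h : ∀ z : F, rightInner B z x = rightInner B z y) : x = y :=
  cstarModule_ext (A := Bᵐᵒᵖ) fun z => unop_injective (h z)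

theorem continuous_rightInner (x : F) : Continuous (rightInner B x) :=
  continuous_unop.comp ((CStarModule.continuous_inner (A := Bᵐᵒᵖ)).comp
    (continuous_const.prodMk continuous_id))

theorem rightInner_op (a b : B) : rightInner B (op a) (op b) = star a * b := rfl

end RightInner

/-! ### The Hilbert space `F ⊗ H` built from a family of positive functionals. -/

section FamilySpace

variable {B : Type u} [CStarAlgebra B] [PartialOrder B] [StarOrderedRing B] {J : Type*}

/-- The algebraic direct sum of copies of `F`, one for each of the positive functionals `φ j`, with
the semi-inner product given by the functionals `φ j`. -/
@[nolint unusedArguments]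
def PreFamilySpace (_ : J → B →ₚ[ℂ] ℂ) (F : Type*) [AddCommGroup F] := J →₀ F

variable (φ : J → B →ₚ[ℂ] ℂ) (F : Type*) [NormedAddCommGroup F] [NormedSpace ℂ F] [Module Bᵐᵒᵖ F]
  [CStarModule Bᵐᵒᵖ F]

noncomputable instance : AddCommGroup (PreFamilySpace φ F) :=
  inferInstanceAs (AddCommGroup (J →₀ F))

noncomputable instance : Module ℂ (PreFamilySpace φ F) :=
  inferInstanceAs (Module ℂ (J →₀ F))

/-- The identification with the finitely supported functions. -/
noncomputable def toPreFamilySpace : (J →₀ F) ≃ₗ[ℂ] PreFamilySpace φ F := LinearEquiv.refl ℂ _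

variable {F}

/-- The semi-inner product of finitely supported functions. -/
noncomputable def familyInner (f g : J →₀ F) : ℂ := f.sum fun j x => φ j (rightInner B x (g j))

theorem familyInner_eq_sum {f g : J →₀ F} {s : Finset J} (hs : f.support ⊆ s) :
    familyInner φ f g = ∑ j ∈ s, φ j (rightInner B (f j) (g j)) :=
  Finsupp.sum_of_support_subset _ hs _ fun j _ => by simp

variable (F) in
/-- The semi-inner product. -/
noncomputable abbrev familyCore : PreInnerProductSpace.Core ℂ (PreFamilySpace φ F) where
  inner f g := familyInner φ ((toPreFamilySpace φ F).symm f) ((toPreFamilySpace φ F).symm g)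
  conj_inner_symm f g := by
    classical
    rw [familyInner_eq_sum φ (s := ((toPreFamilySpace φ F).symm f).support ∪
        ((toPreFamilySpace φ F).symm g).support) Finset.subset_union_left,
      familyInner_eq_sum φ (s := ((toPreFamilySpace φ F).symm f).support ∪
        ((toPreFamilySpace φ F).symm g).support) Finset.subset_union_right, map_sum]
    refine Finset.sum_congr rfl fun j _ => ?_
    rw [← Complex.star_def, ← map_star, star_rightInner]
  re_inner_nonneg f := by
    rw [familyInner_eq_sum φ subset_rfl, map_sum]
    refine Finset.sum_nonneg fun j _ => ?_
    exact (Complex.le_def.mp ((φ j).map_nonneg (rightInner_self_nonneg _))).1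
  add_left f g h := by
    rw [map_add]
    exact Finsupp.sum_add_index' (by simp) fun j x y => by rw [rightInner_add_left, map_add]
  smul_left f g z := by
    rw [map_smul, familyInner, Finsupp.sum_smul_index' (by simp), familyInner, Finsupp.sum, Finsupp.sum,
      Finset.mul_sum]
    refine Finset.sum_congr rfl fun j _ => ?_
    rw [rightInner_smul_left, map_smul, smul_eq_mul]

noncomputable instance : SeminormedAddCommGroup (PreFamilySpace φ F) :=
  InnerProductSpace.Core.toSeminormedAddCommGroup (c := familyCore φ F)

noncomputable instance : InnerProductSpace ℂ (PreFamilySpace φ F) :=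
  InnerProductSpace.ofCore (familyCore φ F)

variable (F) in
/-- The Hilbert space `⨁ j, F ⊗ H_{φ j}`, where `H_{φ j}` is the GNS space of `φ j`. -/
abbrev FamilySpace := UniformSpace.Completion (PreFamilySpace φ F)

variable (F) in
/-- The canonical map into the completion. -/
noncomputable def toFamilySpace : (J →₀ F) →ₗ[ℂ] FamilySpace φ F :=
  UniformSpace.Completion.toComplₗᵢ.toLinearMap ∘ₗ (toPreFamilySpace φ F).toLinearMap

theorem denseRange_toFamilySpace : DenseRange (toFamilySpace φ F) :=
  UniformSpace.Completion.denseRange_coe (α := PreFamilySpace φ F)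

variable {φ} in
theorem ext_toFamilySpace {G : Type*} [NormedAddCommGroup G] [NormedSpace ℂ G]
    {T S : FamilySpace φ F →L[ℂ] G} (h : ∀ f, T (toFamilySpace φ F f) = S (toFamilySpace φ F f)) :
    T = S :=
  ContinuousLinearMap.ext fun x => (denseRange_toFamilySpace φ).induction_on x
    (isClosed_eq T.continuous S.continuous) h

theorem norm_toFamilySpace (f : J →₀ F) :
    ‖toFamilySpace φ F f‖ = ‖toPreFamilySpace φ F f‖ :=
  UniformSpace.Completion.norm_coe _

theorem inner_toFamilySpace (f g : J →₀ F) :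
    ⟪toFamilySpace φ F f, toFamilySpace φ F g⟫_ℂ = familyInner φ f g :=
  UniformSpace.Completion.inner_coe _ _

theorem inner_toFamilySpace_single (j : J) (x : F) (g : J →₀ F) :
    ⟪toFamilySpace φ F (Finsupp.single j x), toFamilySpace φ F g⟫_ℂ
      = φ j (rightInner B x (g j)) := by
  rw [inner_toFamilySpace, familyInner, Finsupp.sum_single_index (by simp)]

theorem norm_toFamilySpace_single_le (j : J) (x : F) :
    ‖toFamilySpace φ F (Finsupp.single j x)‖ ≤ √(φ j 1).re * ‖x‖ := by
  refine le_of_sq_le_sq ?_ (by positivity)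
  have h1 : ((‖toFamilySpace φ F (Finsupp.single j x)‖ ^ 2 : ℝ) : ℂ) = φ j (rightInner B x x) := by
    have := inner_self_eq_norm_sq_to_K (𝕜 := ℂ) (toFamilySpace φ F (Finsupp.single j x))
    rw [inner_toFamilySpace_single, Finsupp.single_eq_same] at this
    rw [this]
    simp
  have h2 : φ j (rightInner B x x) ≤ ((‖x‖ ^ 2 : ℝ) : ℂ) * φ j 1 := by
    have h3 := (IsSelfAdjoint.of_nonneg (rightInner_self_nonneg (B := B) x)).le_algebraMap_norm_self
    have h4 := OrderHomClass.mono (φ j) h3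
    rwa [norm_rightInner_self, Algebra.algebraMap_eq_smul_one, ← Complex.coe_smul, map_smul,
      smul_eq_mul] at h4
  have h5 := (Complex.le_def.mp ((φ j).map_nonneg (zero_le_one (α := B)))).1
  rw [Complex.zero_re] at h5
  rw [← h1, Complex.le_def, Complex.ofReal_re, Complex.re_ofReal_mul] at h2
  rw [mul_pow, Real.sq_sqrt h5, mul_comm]
  exact h2.1

end FamilySpace

/-! ### Adjointable maps act boundedly on these Hilbert spaces. -/

section Adjointable

variable {B : Type u} [CStarAlgebra B] [PartialOrder B] [StarOrderedRing B]
  {F : Type*} [NormedAddCommGroup F] [NormedSpace ℂ F] [Module Bᵐᵒᵖ F] [CStarModule Bᵐᵒᵖ F]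
  {F' : Type*} [NormedAddCommGroup F'] [NormedSpace ℂ F'] [Module Bᵐᵒᵖ F'] [CStarModule Bᵐᵒᵖ F']
  {F'' : Type*} [NormedAddCommGroup F''] [NormedSpace ℂ F''] [Module Bᵐᵒᵖ F'']
  [CStarModule Bᵐᵒᵖ F'']

variable (B) in
/-- `S` is an adjoint of `T`. -/
def IsAdjointPair (T : F →ₗ[ℂ] F') (S : F' →ₗ[ℂ] F) : Prop :=
  ∀ x y, rightInner B (T x) y = rightInner B x (S y)

namespace IsAdjointPair

theorem symm {T : F →ₗ[ℂ] F'} {S : F' →ₗ[ℂ] F} (h : IsAdjointPair B T S) :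
    IsAdjointPair B S T := fun x y => by
  rw [← star_rightInner, ← h, star_rightInner]

theorem comp {T : F →ₗ[ℂ] F'} {S : F' →ₗ[ℂ] F} {T' : F' →ₗ[ℂ] F''} {S' : F'' →ₗ[ℂ] F'}
    (h' : IsAdjointPair B T' S') (h : IsAdjointPair B T S) :
    IsAdjointPair B (T' ∘ₗ T) (S ∘ₗ S') := fun x y => by
  rw [LinearMap.comp_apply, h', h, LinearMap.comp_apply]

theorem map_op_smul {T : F →ₗ[ℂ] F'} {S : F' →ₗ[ℂ] F} (h : IsAdjointPair B T S) (b : B) (x : F) :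
    T (op b • x) = op b • T x :=
  ext_rightInner fun z => by
    rw [← h.symm, rightInner_op_smul_right, h.symm, rightInner_op_smul_right]

theorem continuous [CompleteSpace F] [CompleteSpace F'] {T : F →ₗ[ℂ] F'} {S : F' →ₗ[ℂ] F}
    (h : IsAdjointPair B T S) : Continuous T := by
  refine T.continuous_of_seq_closed_graph fun u x y hu hTu => ext_rightInner (B := B) fun z => ?_
  have h1 : Tendsto (fun n => rightInner B z (T (u n))) atTop (𝓝 (rightInner B z y)) :=
    ((continuous_rightInner z).tendsto y).comp hTu
  have h2 : Tendsto (fun n => rightInner B z (T (u n))) atTop (𝓝 (rightInner B z (T x))) := by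
    simp only [← h.symm z]
    exact ((continuous_rightInner (S z)).tendsto x).comp hu
  exact tendsto_nhds_unique h1 h2

end IsAdjointPair

/-- A symmetric operator with `‖R ^ n x‖ ≤ K C ^ n` has norm at most `C`. -/
theorem norm_le_of_symmetric_of_pow_le {V : Type*} [SeminormedAddCommGroup V]
    [InnerProductSpace ℂ V] {R : V →ₗ[ℂ] V} (hR : ∀ x y, ⟪R x, y⟫_ℂ = ⟪x, R y⟫_ℂ) {C : ℝ}
    (hC : 0 < C) {x : V} {K : ℝ} (hK : ∀ n : ℕ, ‖(R ^ n) x‖ ≤ K * C ^ n) : ‖R x‖ ≤ C * ‖x‖ := by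
  have hpow : ∀ n x y, ⟪(R ^ n) x, y⟫_ℂ = ⟪x, (R ^ n) y⟫_ℂ := by
    intro n
    induction n with
    | zero => simp
    | succ n ih =>
      intro x y
      rw [pow_succ', Module.End.mul_apply, hR, ih, ← Module.End.mul_apply (R ^ n), ← pow_succ,
        pow_succ']
  have hsq : ∀ n, ‖(R ^ n) x‖ ^ 2 ≤ ‖x‖ * ‖(R ^ (2 * n)) x‖ := by
    intro n
    have h1 : ⟪(R ^ n) x, (R ^ n) x⟫_ℂ = ⟪x, (R ^ (2 * n)) x⟫_ℂ := by
      rw [hpow, ← Module.End.mul_apply, ← pow_add, two_mul]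
    have h2 := norm_inner_le_norm (𝕜 := ℂ) x ((R ^ (2 * n)) x)
    rw [← h1, inner_self_eq_norm_sq_to_K] at h2
    simpa using h2
  rcases (norm_nonneg x).eq_or_lt with h0 | h0
  · have := hsq 1
    rw [← h0, zero_mul, pow_one] at this
    have h1 : ‖R x‖ = 0 := by
      have := le_antisymm this (sq_nonneg _)
      simpa using this
    rw [h1, ← h0, mul_zero]
  · set r : ℕ → ℝ := fun n => ‖(R ^ n) x‖ / ‖x‖ with hr
    have hr2 : ∀ n, r n ^ 2 ≤ r (2 * n) := fun n => by
      rw [hr, div_pow, div_le_div_iff₀ (by positivity) h0]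
      nlinarith [hsq n]
    -- Symmetry gives `‖R ^ n x‖² ≤ ‖x‖ ‖R ^ (2n) x‖`. Iterated doubling bounds `(r 1 / C) ^ (2 ^
    -- k)` by a constant, so `r 1 ≤ C` and `K` disappears.
    have hrk : ∀ k, r 1 ^ (2 ^ k) ≤ r (2 ^ k) := by
      intro k
      induction k with
      | zero => simp
      | succ k ih =>
        calc r 1 ^ 2 ^ (k + 1) = (r 1 ^ 2 ^ k) ^ 2 := by rw [pow_succ, pow_mul]
          _ ≤ r (2 ^ k) ^ 2 := by gcongr
          _ ≤ r (2 * 2 ^ k) := hr2 _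
          _ = r (2 ^ (k + 1)) := by rw [pow_succ' 2 k]
    have hbd : ∀ k : ℕ, (r 1 / C) ^ (2 ^ k) ≤ K / ‖x‖ := by
      intro k
      rw [div_pow, div_le_iff₀ (by positivity)]
      refine (hrk k).trans ?_
      simp only [hr]
      rw [div_mul_eq_mul_div]
      gcongr
      exact hK _
    have h1 : r 1 ≤ C := by
      by_contra! h
      have h2 : 1 < r 1 / C := by rwa [one_lt_div hC]
      obtain ⟨n, hn⟩ := pow_unbounded_of_one_lt (K / ‖x‖) h2
      have h3 : (r 1 / C) ^ n ≤ (r 1 / C) ^ (2 ^ n) := by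
        gcongr
        · exact h2.le
        · exact Nat.lt_two_pow_self.le
      linarith [hbd n]
    rw [hr] at h1
    simp only [pow_one] at h1
    rwa [div_le_iff₀ h0] at h1

variable {J : Type*} (φ : J → B →ₚ[ℂ] ℂ)

theorem IsAdjointPair.familyInner_mapRange {T : F →ₗ[ℂ] F'} {S : F' →ₗ[ℂ] F}
    (h : IsAdjointPair B T S) (f : J →₀ F) (g : J →₀ F') :
    familyInner φ (Finsupp.mapRange.linearMap T f) g
      = familyInner φ f (Finsupp.mapRange.linearMap S g) := by
  rw [familyInner_eq_sum φ (s := f.support), familyInner_eq_sum φ subset_rfl]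
  · simp [h _ _]
  · exact Finsupp.support_mapRange (hf := map_zero T)

/-- The operator `R = S T` is symmetric for the semi-inner product. Boundedness of `R` in the module
norm only gives `‖R ^ n f‖ ≤ K C ^ n` with `K` depending on `f`, but the growth rate `C` does not,
and for a symmetric operator the growth rate already bounds the norm. Then `‖T f‖² = ⟨f, R f⟩`. -/
theorem IsAdjointPair.exists_bound [CompleteSpace F] [CompleteSpace F'] {T : F →ₗ[ℂ] F'}
    {S : F' →ₗ[ℂ] F} (h : IsAdjointPair B T S) :
    ∃ C, ∀ f : J →₀ F, ‖toFamilySpace φ F' (Finsupp.mapRange.linearMap T f)‖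
      ≤ C * ‖toFamilySpace φ F f‖ := by
  set R : F →ₗ[ℂ] F := S ∘ₗ T with hR
  have hRR : IsAdjointPair B R R := h.symm.comp h
  let R' : F →L[ℂ] F := ⟨R, hRR.continuous⟩
  set C : ℝ := ‖R'‖ + 1 with hC
  have hCpos : 0 < C := by positivity
  have hRn : ∀ (n : ℕ) (x : F), ‖(R ^ n) x‖ ≤ C ^ n * ‖x‖ := by
    intro n x
    induction n with
    | zero => simp
    | succ n ih =>
      rw [pow_succ', Module.End.mul_apply]
      calc ‖R ((R ^ n) x)‖ ≤ ‖R'‖ * ‖(R ^ n) x‖ := R'.le_opNorm _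
        _ ≤ C * (C ^ n * ‖x‖) := by gcongr; linarith
        _ = C ^ (n + 1) * ‖x‖ := by ring
  let e := toPreFamilySpace φ F
  let Q : PreFamilySpace φ F →ₗ[ℂ] PreFamilySpace φ F :=
    e.toLinearMap ∘ₗ Finsupp.mapRange.linearMap R ∘ₗ e.symm.toLinearMap
  have hQpow : ∀ (n : ℕ) (f : J →₀ F), (Q ^ n) (e f) = e (Finsupp.mapRange.linearMap (R ^ n) f) := by
    intro n f
    induction n with
    | zero =>
      rw [pow_zero, Module.End.one_apply]
      congr 1
      ext j
      simp
    | succ n ih =>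
      rw [pow_succ', Module.End.mul_apply, ih]
      change e (Finsupp.mapRange.linearMap R (Finsupp.mapRange.linearMap (R ^ n) f)) = _
      congr 1
      ext j
      simp [pow_succ']
  have hK : ∀ f : J →₀ F, ∃ K, ∀ n : ℕ,
      ‖toFamilySpace φ F (Finsupp.mapRange.linearMap (R ^ n) f)‖ ≤ K * C ^ n := by
    intro f
    induction f using Finsupp.induction_linear with
    | zero => exact ⟨0, by simp⟩
    | add f g hf hg =>
      obtain ⟨K₁, h₁⟩ := hf
      obtain ⟨K₂, h₂⟩ := hg
      refine ⟨K₁ + K₂, fun n => ?_⟩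
      rw [map_add, map_add, add_mul]
      exact (norm_add_le _ _).trans (add_le_add (h₁ n) (h₂ n))
    | single j x =>
      refine ⟨√(φ j 1).re * ‖x‖, fun n => ?_⟩
      have : (Finsupp.mapRange.linearMap (R ^ n) : (J →₀ F) →ₗ[ℂ] (J →₀ F)) (Finsupp.single j x)
          = Finsupp.single j ((R ^ n) x) := by simp
      rw [this]
      refine (norm_toFamilySpace_single_le φ j _).trans ?_
      rw [mul_assoc, mul_comm ‖x‖]
      gcongr
      exact hRn n x
  have hRb : ∀ f : J →₀ F, ‖toFamilySpace φ F (Finsupp.mapRange.linearMap R f)‖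
      ≤ C * ‖toFamilySpace φ F f‖ := by
    intro f
    obtain ⟨K, hK⟩ := hK f
    have := norm_le_of_symmetric_of_pow_le (V := PreFamilySpace φ F) (R := Q)
      (fun f g => hRR.familyInner_mapRange φ (e.symm f) (e.symm g)) hCpos (x := e f) (K := K)
      fun n => by
        rw [hQpow, ← norm_toFamilySpace]
        exact hK n
    rw [norm_toFamilySpace, norm_toFamilySpace]
    exact this
  refine ⟨√C, fun f => ?_⟩
  have h1 : ⟪toFamilySpace φ F' (Finsupp.mapRange.linearMap T f),
      toFamilySpace φ F' (Finsupp.mapRange.linearMap T f)⟫_ℂ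
      = ⟪toFamilySpace φ F f, toFamilySpace φ F (Finsupp.mapRange.linearMap R f)⟫_ℂ := by
    rw [inner_toFamilySpace, h.familyInner_mapRange, inner_toFamilySpace]
    congr 1
    ext j
    simp [hR]
  have h2 := norm_inner_le_norm (𝕜 := ℂ) (toFamilySpace φ F f)
    (toFamilySpace φ F (Finsupp.mapRange.linearMap R f))
  rw [← h1, inner_self_eq_norm_sq_to_K] at h2
  refine le_of_sq_le_sq ?_ (by positivity)
  rw [mul_pow, Real.sq_sqrt hCpos.le]
  calc _ ≤ ‖toFamilySpace φ F f‖ * ‖toFamilySpace φ F (Finsupp.mapRange.linearMap R f)‖ := by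
        simpa using h2
    _ ≤ ‖toFamilySpace φ F f‖ * (C * ‖toFamilySpace φ F f‖) := by gcongr; exact hRb f
    _ = _ := by ring

/-- The bounded operator between the Hilbert spaces induced by an adjointable map. -/
noncomputable def familyMap (T : F →ₗ[ℂ] F') : FamilySpace φ F →L[ℂ] FamilySpace φ F' :=
  (toFamilySpace φ F' ∘ₗ Finsupp.mapRange.linearMap T).extendOfNorm (toFamilySpace φ F)

variable [CompleteSpace F] [CompleteSpace F'] [CompleteSpace F'']

namespace IsAdjointPair

theorem familyMap_apply {T : F →ₗ[ℂ] F'} {S : F' →ₗ[ℂ] F} (h : IsAdjointPair B T S) (f : J →₀ F) :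
    familyMap φ T (toFamilySpace φ F f) = toFamilySpace φ F' (Finsupp.mapRange.linearMap T f) :=
  LinearMap.extendOfNorm_eq (denseRange_toFamilySpace φ) (h.exists_bound φ) f

theorem adjoint_familyMap {T : F →ₗ[ℂ] F'} {S : F' →ₗ[ℂ] F} (h : IsAdjointPair B T S) :
    (familyMap φ T).adjoint = familyMap φ S := by
  symm
  rw [ContinuousLinearMap.eq_adjoint_iff]
  intro x y
  refine (denseRange_toFamilySpace φ).induction_on (p := fun x =>
    ⟪familyMap φ S x, y⟫_ℂ = ⟪x, familyMap φ T y⟫_ℂ) x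
    (isClosed_eq (by fun_prop) (by fun_prop)) fun f => ?_
  refine (denseRange_toFamilySpace φ).induction_on (p := fun y =>
    ⟪familyMap φ S (toFamilySpace φ F' f), y⟫_ℂ = ⟪toFamilySpace φ F' f, familyMap φ T y⟫_ℂ) y
    (isClosed_eq (by fun_prop) (by fun_prop)) fun g => ?_
  rw [h.symm.familyMap_apply, h.familyMap_apply, inner_toFamilySpace, inner_toFamilySpace,
    h.symm.familyInner_mapRange]

theorem familyMap_comp {T : F →ₗ[ℂ] F'} {S : F' →ₗ[ℂ] F} {T' : F' →ₗ[ℂ] F''} {S' : F'' →ₗ[ℂ] F'}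
    (h' : IsAdjointPair B T' S') (h : IsAdjointPair B T S) :
    familyMap φ (T' ∘ₗ T) = familyMap φ T' ∘L familyMap φ T := by
  refine ext_toFamilySpace fun f => ?_
  rw [(h'.comp h).familyMap_apply, ContinuousLinearMap.comp_apply, h.familyMap_apply,
    h'.familyMap_apply]
  congr 1
  ext j
  simp

theorem familyMap_add {T₁ T₂ : F →ₗ[ℂ] F'} {S₁ S₂ : F' →ₗ[ℂ] F} (h₁ : IsAdjointPair B T₁ S₁)
    (h₂ : IsAdjointPair B T₂ S₂) : familyMap φ (T₁ + T₂) = familyMap φ T₁ + familyMap φ T₂ := by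
  have h : IsAdjointPair B (T₁ + T₂) (S₁ + S₂) := fun x y => by
    simp only [LinearMap.add_apply, rightInner_add_left, map_add, h₁ x y, h₂ x y]
  refine ext_toFamilySpace fun f => ?_
  rw [h.familyMap_apply, ContinuousLinearMap.add_apply, h₁.familyMap_apply, h₂.familyMap_apply,
    ← map_add]
  congr 1
  ext j
  simp

theorem smul {T : F →ₗ[ℂ] F'} {S : F' →ₗ[ℂ] F} (h : IsAdjointPair B T S) (c : ℂ) :
    IsAdjointPair B (c • T) (conj c • S) := fun x y => by
  simp only [LinearMap.smul_apply, rightInner_smul_left, map_smul, h x y]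

theorem familyMap_smul {T : F →ₗ[ℂ] F'} {S : F' →ₗ[ℂ] F} (h : IsAdjointPair B T S) (c : ℂ) :
    familyMap φ (c • T) = c • familyMap φ T := by
  refine ext_toFamilySpace fun f => ?_
  refine ((h.smul c).familyMap_apply φ f).trans
    (Eq.trans ?_ (congrArg (c • ·) (h.familyMap_apply φ f)).symm)
  change _ = c • toFamilySpace φ F' _
  rw [← map_smul]
  congr 1
  ext j
  simp

end IsAdjointPair

theorem isAdjointPair_id : IsAdjointPair B (LinearMap.id : F →ₗ[ℂ] F) LinearMap.id :=
  fun _ _ => rfl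

theorem familyMap_id : familyMap φ (LinearMap.id : F →ₗ[ℂ] F) = ContinuousLinearMap.id ℂ _ := by
  refine ext_toFamilySpace fun f => ?_
  rw [isAdjointPair_id.familyMap_apply, ContinuousLinearMap.id_apply]
  congr 1
  ext j
  simp

end Adjointable

/-! ### Normality, faithfulness and amplification of the induced representations. -/

section FamilyRep

variable {B : Type u} [CStarAlgebra B] [PartialOrder B] [StarOrderedRing B]

section Quadratic

variable {M : Type*} [AddCommGroup M] [Module ℂ M] [PartialOrder M]
  {K : Type*} [NormedAddCommGroup K] [InnerProductSpace ℂ K] [CompleteSpace K]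

/-- The functional `x ↦ ⟪ζ, Λ x ζ⟫`. -/
noncomputable def quadraticFunctional (Λ : M →ₗ[ℂ] (K →L[ℂ] K)) (ζ : K) : M →ₗ[ℂ] ℂ where
  toFun x := ⟪ζ, Λ x ζ⟫_ℂ
  map_add' x y := by simp [inner_add_right]
  map_smul' z x := by simp [inner_smul_right]

theorem quadraticFunctional_apply (Λ : M →ₗ[ℂ] (K →L[ℂ] K)) (ζ : K) (x : M) :
    quadraticFunctional Λ ζ x = ⟪ζ, Λ x ζ⟫_ℂ := rfl

/-- Beyond a fixed `b₀` in the directed set, monotonicity gives `‖Λ (b - s)‖ ≤ ‖Λ s - Λ b₀‖`. With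
this uniform bound `ζ` can be replaced by a nearby vector of `D`. -/
theorem quadraticFunctional_mem_of_dense {Λ : M →ₗ[ℂ] (K →L[ℂ] K)} (hΛ : Monotone Λ) {D : Set K}
    (hD : Dense D) (h : ∀ ζ ∈ D, quadraticFunctional Λ ζ ∈ orderContinuous M) (ζ : K) :
    quadraticFunctional Λ ζ ∈ orderContinuous M := by
  intro d hd hdir s hs ε hε
  obtain ⟨b₀, hb₀⟩ := id hd
  set R := ‖Λ s - Λ b₀‖ with hR
  have hcont : ContinuousAt (fun ζ' : K => R * (‖ζ - ζ'‖ * (‖ζ‖ + ‖ζ'‖))) ζ := by fun_prop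
  have hev : ∀ᶠ ζ' in 𝓝 ζ, R * (‖ζ - ζ'‖ * (‖ζ‖ + ‖ζ'‖)) < ε / 2 := by
    refine hcont.eventually_lt continuousAt_const ?_
    simpa using hε
  obtain ⟨ζ', hζ', hζ'D⟩ := (mem_closure_iff_nhds.mp (hD.closure_eq ▸ Set.mem_univ ζ)) _ hev
  obtain ⟨a, ha, H⟩ := h ζ' hζ'D d hd hdir s hs (ε / 2) (by positivity)
  obtain ⟨a', ha', h1, h2⟩ := hdir a ha b₀ hb₀
  refine ⟨a', ha', fun b hb hab => ?_⟩
  have h3 := H b hb (h1.trans hab)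
  have hy : ‖Λ (b - s)‖ ≤ R := by
    rw [← norm_neg, ← map_neg, neg_sub, map_sub]
    exact CStarAlgebra.norm_le_norm_of_nonneg_of_le (sub_nonneg.mpr (hΛ (hs.1 hb)))
      (sub_le_sub_left (hΛ (h2.trans hab)) _)
  rw [← map_sub] at h3 ⊢
  rw [quadraticFunctional_apply] at h3 ⊢
  have h4 : ⟪ζ, Λ (b - s) ζ⟫_ℂ = ⟪ζ - ζ', Λ (b - s) ζ⟫_ℂ + ⟪ζ', Λ (b - s) (ζ - ζ')⟫_ℂ
      + ⟪ζ', Λ (b - s) ζ'⟫_ℂ := by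
    rw [(Λ (b - s)).map_sub, inner_sub_left, inner_sub_right]
    ring
  have h5 : ‖⟪ζ - ζ', Λ (b - s) ζ⟫_ℂ‖ ≤ ‖ζ - ζ'‖ * (R * ‖ζ‖) :=
    (norm_inner_le_norm _ _).trans (by gcongr; exact (Λ (b - s)).le_of_opNorm_le hy _)
  have h6 : ‖⟪ζ', Λ (b - s) (ζ - ζ')⟫_ℂ‖ ≤ ‖ζ'‖ * (R * ‖ζ - ζ'‖) :=
    (norm_inner_le_norm _ _).trans (by gcongr; exact (Λ (b - s)).le_of_opNorm_le hy _)
  rw [h4]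
  have h7 := norm_add₃_le (a := ⟪ζ - ζ', Λ (b - s) ζ⟫_ℂ) (b := ⟪ζ', Λ (b - s) (ζ - ζ')⟫_ℂ)
    (c := ⟪ζ', Λ (b - s) ζ'⟫_ℂ)
  have h8 : R * (‖ζ - ζ'‖ * (‖ζ‖ + ‖ζ'‖)) < ε / 2 := hζ'
  nlinarith

theorem ContinuousLinearMap.le_of_forall_inner_le {S T : K →L[ℂ] K}
    (h : ∀ x, ⟪x, S x⟫_ℂ ≤ ⟪x, T x⟫_ℂ) : S ≤ T := by
  rw [ContinuousLinearMap.le_def, ContinuousLinearMap.isPositive_iff_complex]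
  intro x
  have h1 : 0 ≤ ⟪(T - S) x, x⟫_ℂ := by
    rw [← inner_conj_symm, ← Complex.star_def, star_nonneg_iff, ContinuousLinearMap.sub_apply,
      inner_sub_right]
    exact sub_nonneg.mpr (h x)
  obtain ⟨h2, h3⟩ := Complex.le_def.mp h1
  exact ⟨Complex.ext (Complex.ofReal_re _) ((Complex.ofReal_im _).trans h3), h2⟩

theorem ContinuousLinearMap.inner_le_of_le {S T : K →L[ℂ] K} (h : S ≤ T) (x : K) :
    ⟪x, S x⟫_ℂ ≤ ⟪x, T x⟫_ℂ := by
  rw [ContinuousLinearMap.le_def, ContinuousLinearMap.isPositive_iff_complex] at h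
  obtain ⟨h1, h2⟩ := h x
  have h3 : 0 ≤ ⟪(T - S) x, x⟫_ℂ := by
    rw [← h1]
    exact_mod_cast h2
  rwa [← inner_conj_symm, ← Complex.star_def, star_nonneg_iff, ContinuousLinearMap.sub_apply,
    inner_sub_right, sub_nonneg] at h3

theorem inner_le_of_isLUB {Λ : M →ₗ[ℂ] (K →L[ℂ] K)} {ζ : K}
    (hΛ : quadraticFunctional Λ ζ ∈ orderContinuous M) {d : Set M} (hd : d.Nonempty)
    (hdir : DirectedOn (· ≤ ·) d) {s : M} (hs : IsLUB d s) {z : ℂ}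
    (hz : ∀ a ∈ d, ⟪ζ, Λ a ζ⟫_ℂ ≤ z) : ⟪ζ, Λ s ζ⟫_ℂ ≤ z := by
  have : Nonempty d := hd.to_subtype
  have : IsDirectedOrder d := ⟨fun a b => by
    obtain ⟨c, hc, h1, h2⟩ := hdir a a.2 b b.2
    exact ⟨⟨c, hc⟩, h1, h2⟩⟩
  have := tendsto_of_mem_orderContinuous hΛ (x := fun a : d => (a : M)) (fun _ _ h => h)
    (s := s) (by simpa using hs)
  exact le_of_tendsto' this fun a => hz a a.2

theorem scottContinuous_of_quadraticFunctional_mem {Λ : M →ₗ[ℂ] (K →L[ℂ] K)} (hΛ : Monotone Λ)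
    (h : ∀ ζ, quadraticFunctional Λ ζ ∈ orderContinuous M) : ScottContinuous Λ := by
  intro d hd hdir s hs
  refine ⟨?_, fun S hS => ContinuousLinearMap.le_of_forall_inner_le fun x => ?_⟩
  · rintro _ ⟨a, ha, rfl⟩
    exact hΛ (hs.1 ha)
  · exact inner_le_of_isLUB (h x) hd hdir hs fun a ha =>
      ContinuousLinearMap.inner_le_of_le (hS ⟨a, ha, rfl⟩) x

theorem ScottContinuous.isNormalMap {N : Type*} [AddCommGroup N] [Module ℂ N] [PartialOrder N]
    {f : M →ₗ[ℂ] N} (hf : ScottContinuous f) : IsNormalMap f := by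
  intro ψ hψ
  induction hψ using Submodule.span_induction with
  | mem ψ hψ =>
    refine Submodule.subset_span fun d hd hdir s hs => ?_
    have hdir' : DirectedOn (· ≤ ·) (f '' d) := by
      rintro _ ⟨a, ha, rfl⟩ _ ⟨b, hb, rfl⟩
      obtain ⟨c, hc, h1, h2⟩ := hdir a ha b hb
      exact ⟨f c, ⟨c, hc, rfl⟩, hf.monotone h1, hf.monotone h2⟩
    have h1 := hψ (hd.image f) hdir' (hf hd hdir hs)
    rwa [Set.image_image] at h1
  | zero => rw [LinearMap.zero_comp]; exact Submodule.zero_mem _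
  | add ψ₁ ψ₂ _ _ h₁ h₂ => rw [LinearMap.add_comp]; exact Submodule.add_mem _ h₁ h₂
  | smul c ψ _ h => rw [LinearMap.smul_comp]; exact Submodule.smul_mem _ c h

end Quadratic

section

variable {K : Type*} [NormedAddCommGroup K] [InnerProductSpace ℂ K] [CompleteSpace K]

/-- The linear map underlying a representation. -/
noncomputable def repLinearMap (σ : B →⋆ₐ[ℂ] (K →L[ℂ] K)) : B →ₗ[ℂ] (K →L[ℂ] K) where
  toFun := σ
  map_add' := map_add σ
  map_smul' := map_smul σ

theorem vectorFunctional_eq (σ : B →⋆ₐ[ℂ] (K →L[ℂ] K)) (ζ : K) :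
    vectorFunctional σ ζ = quadraticFunctional (repLinearMap σ) ζ :=
  LinearMap.ext fun _ => rfl

theorem monotone_repLinearMap (σ : B →⋆ₐ[ℂ] (K →L[ℂ] K)) : Monotone (repLinearMap σ) :=
  fun _ _ h => OrderHomClass.mono σ h

theorem isNormalRep_of_dense {σ : B →⋆ₐ[ℂ] (K →L[ℂ] K)} {D : Set K} (hD : Dense D)
    (h : ∀ ζ ∈ D, vectorFunctional σ ζ ∈ orderContinuous B) : IsNormalRep σ := by
  intro ζ
  simp only [vectorFunctional_eq] at h ⊢
  exact quadraticFunctional_mem_of_dense (monotone_repLinearMap σ) hD h ζ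

theorem IsNormalRep.isNormalMap {σ : B →⋆ₐ[ℂ] (K →L[ℂ] K)} (hσ : IsNormalRep σ) :
    IsNormalMap (repLinearMap σ) :=
  (scottContinuous_of_quadraticFunctional_mem (monotone_repLinearMap σ)
    fun ζ => vectorFunctional_eq σ ζ ▸ hσ ζ).isNormalMap

end

variable {F : Type*} [NormedAddCommGroup F] [NormedSpace ℂ F] [Module Bᵐᵒᵖ F]
  [CStarModule Bᵐᵒᵖ F] [CompleteSpace F] {J : Type*} (φ : J → B →ₚ[ℂ] ℂ)

/-- The representation on `FamilySpace φ F` induced by a left action on `F`. -/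
noncomputable def familyRep (l : B →ₐ[ℂ] Module.End ℂ F)
    (hl : ∀ b, IsAdjointPair B (l b) (l (star b))) :
    B →⋆ₐ[ℂ] (FamilySpace φ F →L[ℂ] FamilySpace φ F) where
  toAlgHom := AlgHom.ofLinearMap
    { toFun := fun b => familyMap φ (l b)
      map_add' := fun a b => by rw [map_add, (hl a).familyMap_add φ (hl b)]
      map_smul' := fun c b => by rw [map_smul, (hl b).familyMap_smul φ]; rfl }
    (by
      change familyMap φ (l 1) = _
      rw [map_one]
      exact familyMap_id φ)
    (fun a b => by
      change familyMap φ (l (a * b)) = familyMap φ (l a) * familyMap φ (l b)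
      rw [map_mul]
      exact (hl a).familyMap_comp φ (hl b))
  map_star' b := ((hl b).adjoint_familyMap φ).symm

theorem familyRep_apply (l : B →ₐ[ℂ] Module.End ℂ F)
    (hl : ∀ b, IsAdjointPair B (l b) (l (star b))) (b : B) :
    familyRep φ l hl b = familyMap φ (l b) := rfl

/-- On a finitely supported vector `f` the vector functional is the finite sum of the `b ↦ φ j ⟨f j,
b f j⟩`; such vectors are dense. -/
theorem isNormalRep_familyRep (l : B →ₐ[ℂ] Module.End ℂ F)
    (hl : ∀ b, IsAdjointPair B (l b) (l (star b)))
    (h : ∀ j x, (φ j : B →ₗ[ℂ] ℂ) ∘ₗ rightInner B x ∘ₗ LinearMap.applyₗ x ∘ₗ l.toLinearMap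
      ∈ orderContinuous B) : IsNormalRep (familyRep φ l hl) := by
  refine isNormalRep_of_dense (denseRange_toFamilySpace φ) ?_
  rintro _ ⟨f, rfl⟩
  have : vectorFunctional (familyRep φ l hl) (toFamilySpace φ F f)
      = ∑ j ∈ f.support, (φ j : B →ₗ[ℂ] ℂ) ∘ₗ rightInner B (f j) ∘ₗ LinearMap.applyₗ (f j) ∘ₗ
        l.toLinearMap := by
    ext b
    rw [vectorFunctional_apply, familyRep_apply, (hl b).familyMap_apply, inner_toFamilySpace,
      familyInner_eq_sum φ subset_rfl, LinearMap.sum_apply]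
    simp
  rw [this]
  exact Submodule.sum_mem _ fun j _ => h j _

theorem familyRep_injective (l : B →ₐ[ℂ] Module.End ℂ F)
    (hl : ∀ b, IsAdjointPair B (l b) (l (star b))) (hinj : Function.Injective l)
    (hφ : ∀ b : B, 0 ≤ b → (∀ j, φ j b = 0) → b = 0) :
    Function.Injective (familyRep φ l hl) := by
  refine (injective_iff_map_eq_zero _).mpr fun b hb => ?_
  refine (map_eq_zero_iff l hinj).mp (LinearMap.ext fun x => ?_)
  rw [LinearMap.zero_apply, ← rightInner_self_eq_zero (B := B)]
  refine hφ _ (rightInner_self_nonneg _) fun j => ?_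
  have h1 : familyMap φ (l b) (toFamilySpace φ F (Finsupp.single j x)) = 0 := by
    rw [← familyRep_apply φ l hl, hb]; rfl
  rw [(hl b).familyMap_apply] at h1
  have h2 : toFamilySpace φ F (Finsupp.single j (l b x)) = 0 := by
    rw [← h1]
    congr 1
    simp
  have h3 := inner_toFamilySpace_single φ j (l b x) (Finsupp.single j (l b x))
  rw [Finsupp.single_eq_same, h2, inner_zero_left] at h3
  exact h3.symm

variable {κ : Type*}

theorem familyInner_mapDomain (k k' : κ) (f g : J →₀ F) (hk : k = k') :
    familyInner (fun p : J × κ => φ p.1) (Finsupp.lmapDomain F ℂ (fun j => (j, k)) f)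
      (Finsupp.lmapDomain F ℂ (fun j => (j, k')) g) = familyInner φ f g := by
  subst hk
  have hinj : Function.Injective fun j : J => (j, k) := fun a b h => (Prod.ext_iff.mp h).1
  simp only [familyInner, Finsupp.lmapDomain_apply, Finsupp.sum_mapDomain_index_inj hinj,
    Finsupp.mapDomain_apply hinj]

theorem familyInner_mapDomain_of_ne (k k' : κ) (f g : J →₀ F) (hk : k ≠ k') :
    familyInner (fun p : J × κ => φ p.1) (Finsupp.lmapDomain F ℂ (fun j => (j, k)) f)
      (Finsupp.lmapDomain F ℂ (fun j => (j, k')) g) = 0 := by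
  have hinj : Function.Injective fun j : J => (j, k) := fun a b h => (Prod.ext_iff.mp h).1
  simp only [familyInner, Finsupp.lmapDomain_apply, Finsupp.sum_mapDomain_index_inj hinj]
  refine Finset.sum_eq_zero fun j _ => ?_
  dsimp only
  rw [Finsupp.mapDomain_notin_range, map_zero, map_zero]
  rintro ⟨j', h⟩
  exact hk (Prod.ext_iff.mp h).2.symm

variable (F) in
/-- The inclusion of one of the copies indexed by `κ`. -/
noncomputable def familyIncl (k : κ) :
    FamilySpace φ F →L[ℂ] FamilySpace (fun p : J × κ => φ p.1) F :=
  (toFamilySpace (fun p : J × κ => φ p.1) F ∘ₗ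
    Finsupp.lmapDomain F ℂ (fun j => (j, k))).extendOfNorm (toFamilySpace φ F)

theorem familyIncl_apply (k : κ) (f : J →₀ F) :
    familyIncl F φ k (toFamilySpace φ F f)
      = toFamilySpace (fun p : J × κ => φ p.1) F (Finsupp.lmapDomain F ℂ (fun j => (j, k)) f) := by
  refine LinearMap.extendOfNorm_eq (denseRange_toFamilySpace φ) ⟨1, fun f => ?_⟩ f
  rw [one_mul]
  have h1 := inner_toFamilySpace (fun p : J × κ => φ p.1)
    (Finsupp.lmapDomain F ℂ (fun j => (j, k)) f) (Finsupp.lmapDomain F ℂ (fun j => (j, k)) f)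
  rw [familyInner_mapDomain φ k k f f rfl, ← inner_toFamilySpace, inner_self_eq_norm_sq_to_K,
    inner_self_eq_norm_sq_to_K] at h1
  exact ((sq_eq_sq₀ (norm_nonneg _) (norm_nonneg _)).mp (by exact_mod_cast h1)).le

theorem isAmplification_familyRep (l : B →ₐ[ℂ] Module.End ℂ F)
    (hl : ∀ b, IsAdjointPair B (l b) (l (star b))) :
    IsAmplification (familyRep φ l hl) (familyRep (fun p : J × κ => φ p.1) l hl)
      (familyIncl F φ) where
  inner_self k x y := by
    refine (denseRange_toFamilySpace φ).induction_on (p := fun x =>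
      ⟪familyIncl F φ k x, familyIncl F φ k y⟫_ℂ = ⟪x, y⟫_ℂ) x
      (isClosed_eq (by fun_prop) (by fun_prop)) fun f => ?_
    refine (denseRange_toFamilySpace φ).induction_on (p := fun y =>
      ⟪familyIncl F φ k (toFamilySpace φ F f), familyIncl F φ k y⟫_ℂ = ⟪toFamilySpace φ F f, y⟫_ℂ) y
      (isClosed_eq (by fun_prop) (by fun_prop)) fun g => ?_
    rw [familyIncl_apply, familyIncl_apply, inner_toFamilySpace, inner_toFamilySpace,
      familyInner_mapDomain φ k k f g rfl]
  inner_ne k k' x y hk := by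
    refine (denseRange_toFamilySpace φ).induction_on (p := fun x =>
      ⟪familyIncl F φ k x, familyIncl F φ k' y⟫_ℂ = 0) x
      (isClosed_eq (by fun_prop) (by fun_prop)) fun f => ?_
    refine (denseRange_toFamilySpace φ).induction_on (p := fun y =>
      ⟪familyIncl F φ k (toFamilySpace φ F f), familyIncl F φ k' y⟫_ℂ = 0) y
      (isClosed_eq (by fun_prop) (by fun_prop)) fun g => ?_
    rw [familyIncl_apply, familyIncl_apply, inner_toFamilySpace,
      familyInner_mapDomain_of_ne φ k k' f g hk]
  map k b x := by
    have : familyRep (fun p : J × κ => φ p.1) l hl b ∘L familyIncl F φ k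
        = familyIncl F φ k ∘L familyRep φ l hl b := by
      refine ext_toFamilySpace fun f => ?_
      rw [ContinuousLinearMap.comp_apply, ContinuousLinearMap.comp_apply, familyRep_apply,
        familyRep_apply, (hl b).familyMap_apply, familyIncl_apply, familyIncl_apply,
        (hl b).familyMap_apply]
      congr 1
      exact (Finsupp.mapDomain_mapRange _ _ _ (map_zero _) (map_add _)).symm
    exact DFunLike.congr_fun this x
  total := by
    rw [eq_top_iff]
    intro x _
    refine (denseRange_toFamilySpace _).induction_on (p := fun x => x ∈
      (Submodule.span ℂ {x | ∃ k y, x = familyIncl F φ (κ := κ) k y}).topologicalClosure) x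
      (Submodule.isClosed_topologicalClosure _) fun f => ?_
    induction f using Finsupp.induction_linear with
    | zero => rw [map_zero]; exact Submodule.zero_mem _
    | add f g hf hg => rw [map_add]; exact Submodule.add_mem _ hf hg
    | single p y =>
      refine Submodule.le_topologicalClosure _ (Submodule.subset_span
        ⟨p.2, toFamilySpace φ F (Finsupp.single p.1 y), ?_⟩)
      rw [familyIncl_apply, Finsupp.lmapDomain_apply, Finsupp.mapDomain_single]

end FamilyRep

/-! ### The unitary between `E ⊗ H` and `H`. -/

section Correspondence

variable {B : Type u} [CStarAlgebra B] [PartialOrder B] [StarOrderedRing B]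
  {E : Type v} [NormedAddCommGroup E] [NormedSpace ℂ E]
  [Module Bᵐᵒᵖ E] [CStarModule Bᵐᵒᵖ E]

theorem WStarCorrespondence.isAdjointPair (X : WStarCorrespondence B E) (b : B) :
    IsAdjointPair B (X.lact b) (X.lact (star b)) := X.inner_lact b

/-- The difference `x - 1 x` is orthogonal to all `b y`, since `⟨1 x, b y⟩ = ⟨x, b y⟩`, and these
are total by nondegeneracy. -/
theorem WStarCorrespondence.lact_one (X : WStarCorrespondence B E) : X.lact 1 = 1 := by
  ext x
  have h1 : ∀ z : E, rightInner B (x - X.lact 1 x) z = 0 := by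
    intro z
    have hz : z ∈ (Submodule.span ℂ {z : E | ∃ (b : B) (x : E), z = X.lact b x}).topologicalClosure := by
      rw [X.nondegenerate]; trivial
    have hc : IsClosed ((LinearMap.ker (rightInner B (x - X.lact 1 x)) : Submodule ℂ E) : Set E) :=
      isClosed_singleton.preimage (continuous_rightInner (B := B) _)
    refine Submodule.topologicalClosure_minimal _ (Submodule.span_le.mpr ?_) hc hz
    rintro _ ⟨b, y, rfl⟩
    change rightInner B (x - X.lact 1 x) (X.lact b y) = 0
    have h2 : rightInner B (X.lact 1 x) (X.lact b y) = rightInner B x (X.lact b y) := by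
      rw [X.inner_lact, ← Module.End.mul_apply, ← map_mul, star_one, one_mul]
    rw [sub_eq_add_neg, rightInner_add_left, ← neg_one_smul ℂ, rightInner_smul_left, h2]
    simp
  exact (sub_eq_zero.mp (rightInner_self_eq_zero.mp (h1 _))).symm

/-- The left action as a unital homomorphism. -/
noncomputable def WStarCorrespondence.lactHom (X : WStarCorrespondence B E) :
    B →ₐ[ℂ] Module.End ℂ E :=
  AlgHom.ofLinearMap (X.lact : B →ₗ[ℂ] Module.End ℂ E) X.lact_one (map_mul X.lact)

variable (B) in
/-- The left multiplication on the right module `B`. -/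
noncomputable def mulLeftHom : B →ₐ[ℂ] Module.End ℂ Bᵐᵒᵖ :=
  AlgHom.ofLinearMap
    { toFun := fun b => LinearMap.mulRight ℂ (op b)
      map_add' := fun a b => by ext x; simp [mul_add]
      map_smul' := fun c b => by ext x; simp }
    (by ext x; simp) (fun a b => by ext x; simp [mul_assoc])

theorem mulLeftHom_apply (b : B) (x : Bᵐᵒᵖ) : mulLeftHom B b x = x * op b := rfl

theorem isAdjointPair_mulLeftHom (b : B) :
    IsAdjointPair B (mulLeftHom B b) (mulLeftHom B (star b)) := fun x y => by
  change star (unop (x * op b)) * unop y = star (unop x) * unop (y * op (star b))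
  simp [mul_assoc]

variable (B) in
/-- The family of all normal positive functionals. -/
noncomputable def normalStates : {ψ : B →ₗ[ℂ] ℂ // ScottContinuous ψ} → B →ₚ[ℂ] ℂ :=
  fun ψ => PositiveLinearMap.mk₀ ψ.1 fun x hx => by
    have := ψ.2.monotone hx
    rwa [map_zero] at this

theorem eq_zero_of_normalStates [WStarAlgebra B] {b : B} (hb : 0 ≤ b)
    (h : ∀ ψ, normalStates B ψ b = 0) : b = 0 := by
  by_contra hb0
  obtain ⟨ψ, hψ, hψb⟩ := exists_scottContinuous_ne_zero hb hb0
  exact hψb (h ⟨ψ, hψ⟩)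

theorem isNormalRep_mulLeftHom :
    IsNormalRep (familyRep (normalStates B) (mulLeftHom B) isAdjointPair_mulLeftHom) :=
  isNormalRep_familyRep _ _ _ fun ψ x => by
    have := conjFunctional_self_mem (scottContinuous_mem_orderContinuous ψ.2) (unop x)
    convert this using 1
    ext b
    change ψ.1 (star (unop x) * unop (x * op b)) = ψ.1 (star (unop x) * b * unop x)
    simp [mul_assoc]

variable [CompleteSpace E]

theorem WStarCorrespondence.isNormalRep (X : WStarCorrespondence B E) :
    IsNormalRep (familyRep (normalStates B) X.lactHom X.isAdjointPair) :=
  isNormalRep_familyRep _ _ _ fun ψ x =>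
    normalFunctionals_le_orderContinuous (X.normal x ψ.1 (Submodule.subset_span ψ.2))

theorem WStarCorrespondence.exists_unitary [WStarAlgebra B] (X : WStarCorrespondence B E)
    (hX : X.IsFaithful) :
    ∃ (κ : Type (max u v)) (_ : Nonempty κ)
      (U : FamilySpace (fun p : {ψ : B →ₗ[ℂ] ℂ // ScottContinuous ψ} × κ => normalStates B p.1) E
        ≃ₗᵢ[ℂ] FamilySpace (fun p : {ψ : B →ₗ[ℂ] ℂ // ScottContinuous ψ} × κ =>
          normalStates B p.1) Bᵐᵒᵖ),
      ∀ b x, U (familyMap _ (X.lact b) x) = familyMap _ (mulLeftHom B b) (U x) := by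
  have hn1 := X.isNormalRep
  have hn2 := isNormalRep_mulLeftHom (B := B)
  have hi1 : Function.Injective (familyRep (normalStates B) X.lactHom X.isAdjointPair) :=
    familyRep_injective _ _ _ hX fun b hb h => eq_zero_of_normalStates hb h
  have hi2 : Function.Injective
      (familyRep (normalStates B) (mulLeftHom B) isAdjointPair_mulLeftHom) := by
    refine familyRep_injective _ _ _ (fun a b h => ?_) fun b hb h => eq_zero_of_normalStates hb h
    have := LinearMap.congr_fun h 1
    simpa [mulLeftHom_apply] using this
  obtain ⟨S₁, h11, h12, h13⟩ := exists_cyclic_decomposition hn2 hi2 hn1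
  obtain ⟨S₂, h21, h22, h23⟩ := exists_cyclic_decomposition hn1 hi1 hn2
  -- Prepending an element embeds both `S₁ × κ` and `S₂ × κ` into `κ` when `κ` consists of lists, so
  -- one index set serves for both intertwiners without cardinal arithmetic.
  refine ⟨List (S₁ ⊕ S₂), inferInstance, ?_⟩
  obtain ⟨V, hV, hVτ⟩ := exists_isometric_intertwiner
    (isAmplification_familyRep (κ := List (S₁ ⊕ S₂)) (normalStates B) X.lactHom X.isAdjointPair)
    (isAmplification_familyRep (κ := List (S₁ ⊕ S₂)) (normalStates B) (mulLeftHom B)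
      isAdjointPair_mulLeftHom) h11 h12 h13 (m := fun p => Sum.inl p.1 :: p.2)
    (fun p q h => by
      simp only [List.cons.injEq, Sum.inl.injEq] at h
      exact Prod.ext h.1 h.2)
  obtain ⟨W, hW, hWσ⟩ := exists_isometric_intertwiner
    (isAmplification_familyRep (κ := List (S₁ ⊕ S₂)) (normalStates B) (mulLeftHom B)
      isAdjointPair_mulLeftHom)
    (isAmplification_familyRep (κ := List (S₁ ⊕ S₂)) (normalStates B) X.lactHom X.isAdjointPair)
    h21 h22 h23 (m := fun p => Sum.inr p.1 :: p.2)
    (fun p q h => by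
      simp only [List.cons.injEq, Sum.inr.injEq] at h
      exact Prod.ext h.1 h.2)
  exact exists_unitary_intertwiner hV hW hVτ hWσ

end Correspondence

/-! ### Suprema of adjointable operators on self-dual modules. -/

section SelfDual

variable {B : Type u} [CStarAlgebra B] [PartialOrder B] [StarOrderedRing B]
  {F : Type*} [NormedAddCommGroup F] [NormedSpace ℂ F] [Module Bᵐᵒᵖ F] [CStarModule Bᵐᵒᵖ F]

theorem adjointableOps.exists_isAdjointPair (T : adjointableOps Bᵐᵒᵖ F) :
    ∃ S : F →ₗ[ℂ] F, IsAdjointPair B (T : Module.End ℂ F) S := by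
  obtain ⟨S, hS⟩ := T.2
  exact ⟨S, fun x y => congrArg unop (hS x y)⟩

theorem IsAdjointPair.mem_adjointableOps {T S : F →ₗ[ℂ] F} (h : IsAdjointPair B T S) :
    T ∈ adjointableOps Bᵐᵒᵖ F := ⟨S, fun x y => unop_injective (h x y)⟩

theorem adjointableOps.le_iff {T S : adjointableOps Bᵐᵒᵖ F} : T ≤ S ↔
    ∀ x, rightInner B x ((T : Module.End ℂ F) x) ≤ rightInner B x ((S : Module.End ℂ F) x) :=
  Iff.rfl

/-- An operator with self-adjoint quadratic form is symmetric. -/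
theorem isAdjointPair_self_of_diag {R : F →ₗ[ℂ] F}
    (h : ∀ z, rightInner B (R z) z = rightInner B z (R z)) : IsAdjointPair B R R := by
  intro x y
  have h1 := h (y + x)
  have h2 := h (y + Complex.I • x)
  simp only [map_add, map_smul, rightInner_add_left, rightInner_smul_left, h, Complex.conj_I] at h1 h2
  have h3 : rightInner B (R x) y - rightInner B x (R y)
      = rightInner B y (R x) - rightInner B (R y) x := by
    linear_combination (norm := module) h1
  have h4 : Complex.I • (rightInner B (R x) y - rightInner B x (R y))
      = Complex.I • -(rightInner B y (R x) - rightInner B (R y) x) := by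
    linear_combination (norm := module) -h2
  have h5 := smul_right_injective _ Complex.I_ne_zero h4
  rw [← h3, eq_neg_iff_add_eq_zero, ← two_smul ℂ] at h5
  exact sub_eq_zero.mp ((smul_eq_zero.mp h5).resolve_left two_ne_zero)

/-- The combination of the values of a quadratic form that gives the sesquilinear form. -/
noncomputable def polarization (q : F → B) (x y : F) : B :=
  (4⁻¹ : ℂ) • (q (y + x) - q (y - x) + Complex.I • q (y + Complex.I • x)
    - Complex.I • q (y - Complex.I • x))

theorem polarization_rightInner (T : F →ₗ[ℂ] F) (x y : F) :
    polarization (fun z => rightInner B z (T z)) x y = rightInner B x (T y) := by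
  have hI : ∀ b : B, Complex.I • Complex.I • b = -b := fun b => by
    rw [smul_smul, Complex.I_mul_I, neg_one_smul]
  have : (4 : ℂ) • rightInner B x (T y) = rightInner B x (T y) + rightInner B x (T y)
      + rightInner B x (T y) + rightInner B x (T y) := by
    module
  rw [polarization, inv_smul_eq_iff₀ (by norm_num), this]
  simp only [sub_eq_add_neg, ← neg_smul, map_add, map_smul, rightInner_add_left,
    rightInner_smul_left, map_neg, Complex.conj_I, smul_add, neg_neg, ← neg_one_smul ℂ (_ : F)]
  simp only [neg_smul, hI, smul_neg, neg_neg, map_one, one_smul]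
  abel

theorem norm_polarization_le {q : F → B} {K : ℝ} (hK : ∀ z, ‖q z‖ ≤ K * ‖z‖ ^ 2) (hK0 : 0 ≤ K)
    (x y : F) : ‖polarization q x y‖ ≤ K * (‖y‖ + ‖x‖) ^ 2 := by
  have h1 : ∀ z, ‖z‖ ≤ ‖y‖ + ‖x‖ → ‖q z‖ ≤ K * (‖y‖ + ‖x‖) ^ 2 := fun z hz =>
    (hK z).trans (by gcongr)
  have hI : ‖Complex.I • x‖ = ‖x‖ := by rw [norm_smul, Complex.norm_I, one_mul]
  have a1 := h1 (y + x) (norm_add_le _ _)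
  have a2 := h1 (y - x) (norm_sub_le _ _)
  have a3 := h1 (y + Complex.I • x) (hI ▸ norm_add_le _ _)
  have a4 := h1 (y - Complex.I • x) (hI ▸ norm_sub_le _ _)
  have h2 : ‖q (y + x) - q (y - x) + Complex.I • q (y + Complex.I • x)
    - Complex.I • q (y - Complex.I • x)‖ ≤ ‖q (y + x)‖ + ‖q (y - x)‖ + ‖q (y + Complex.I • x)‖
      + ‖q (y - Complex.I • x)‖ := by
    refine (norm_sub_le _ _).trans (add_le_add ((norm_add_le _ _).trans
      (add_le_add (norm_sub_le _ _) ?_)) ?_) <;>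
    rw [norm_smul, Complex.norm_I, one_mul]
  rw [polarization, norm_smul]
  norm_num
  linarith

theorem tendsto_polarization {ι : Type*} {l : Filter ι} {q : ι → F → B} {q' : F → B}
    {ω : B →ₗ[ℂ] ℂ} (h : ∀ z, Tendsto (fun i => ω (q i z)) l (𝓝 (ω (q' z)))) (x y : F) :
    Tendsto (fun i => ω (polarization (q i) x y)) l (𝓝 (ω (polarization q' x y))) := by
  simp only [polarization, map_smul, map_add, map_sub]
  exact ((((h _).sub (h _)).add ((h _).const_smul _)).sub ((h _).const_smul _)).const_smul _

/-- A bounded sesquilinear form on a self-dual module is given by an operator. -/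
theorem IsSelfDual.exists_operator (hF : IsSelfDual B F) {r : F → F → B}
    (hadd : ∀ x y y', r x (y + y') = r x y + r x y') (hsmul : ∀ x (c : ℂ) y, r x (c • y) = c • r x y)
    (hop : ∀ x y b, r x (op b • y) = r x y * b)
    (hadd' : ∀ x x' y, r (x + x') y = r x y + r x' y)
    (hsmul' : ∀ x (c : ℂ) y, r (c • x) y = conj c • r x y)
    {K : ℝ} (hK : ∀ x y, ‖r x y‖ ≤ K * (‖y‖ + ‖x‖) ^ 2) (hK0 : 0 ≤ K) :
    ∃ R : F →ₗ[ℂ] F, ∀ x y, r x y = rightInner B (R x) y := by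
  have h1 : ∀ x, ∃ z, ∀ y, r x y = rightInner B z y := by
    intro x
    let L : F →ₗ[ℂ] B := { toFun := r x, map_add' := hadd x, map_smul' := hsmul x }
    have hL : ∃ C, ∀ z, ‖L z‖ ≤ C * ‖z‖ := by
      -- The bound `K (‖y‖ + ‖x‖)²` is not homogeneous in `y`, but for fixed `x` a bound on the unit
      -- ball is enough.
      refine LinearMap.bound_of_ball_bound one_pos (K * (1 + ‖x‖) ^ 2) L fun z hz => ?_
      have : ‖z‖ ≤ 1 := by simpa using (mem_ball_zero_iff.mp hz).le
      exact (hK x z).trans (by gcongr)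
    exact hF (L.mkContinuousOfExistsBound hL) fun y b => hop x y b
  choose R hR using h1
  have hext : ∀ {x y : F}, (∀ z, rightInner B x z = rightInner B y z) → x = y := fun h =>
    ext_rightInner (B := B) fun z => by rw [← star_rightInner, h, star_rightInner]
  refine ⟨{ toFun := R, map_add' := fun x y => hext fun z => ?_,
            map_smul' := fun c x => hext fun z => ?_ }, hR⟩
  · rw [rightInner_add_left, ← hR, ← hR, ← hR, hadd']
  · rw [RingHom.id_apply, rightInner_smul_left, ← hR, ← hR, hsmul']

variable [WStarAlgebra B] [CompleteSpace F]

/-- On a self-dual module, a supremum of a directed set of adjointable operators is a pointwise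
supremum of the quadratic forms. -/
theorem IsSelfDual.isLUB_rightInner (hF : IsSelfDual B F) {d : Set (adjointableOps Bᵐᵒᵖ F)}
    (hd : d.Nonempty) (hdir : DirectedOn (· ≤ ·) d) {T : adjointableOps Bᵐᵒᵖ F} (hT : IsLUB d T)
    (z : F) : IsLUB ((fun S : adjointableOps Bᵐᵒᵖ F => rightInner B z ((S : Module.End ℂ F) z)) '' d)
      (rightInner B z ((T : Module.End ℂ F) z)) := by
  have : Nonempty d := hd.to_subtype
  have : IsDirectedOrder d := ⟨fun a b => by
    obtain ⟨c, hc, h1, h2⟩ := hdir a a.2 b b.2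
    exact ⟨⟨c, hc⟩, h1, h2⟩⟩
  have hmono : ∀ z, Monotone fun S : adjointableOps Bᵐᵒᵖ F =>
    rightInner B z ((S : Module.End ℂ F) z) := fun z _ _ h => h z
  have hdir' : ∀ z, DirectedOn (· ≤ ·)
      ((fun S : adjointableOps Bᵐᵒᵖ F => rightInner B z ((S : Module.End ℂ F) z)) '' d) := by
    rintro z _ ⟨a, ha, rfl⟩ _ ⟨b, hb, rfl⟩
    obtain ⟨c, hc, h1, h2⟩ := hdir a ha b hb
    exact ⟨_, ⟨c, hc, rfl⟩, hmono z h1, hmono z h2⟩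
  have hub : ∀ z, rightInner B z ((T : Module.End ℂ F) z) ∈ upperBounds
      ((fun S : adjointableOps Bᵐᵒᵖ F => rightInner B z ((S : Module.End ℂ F) z)) '' d) := by
    rintro z _ ⟨a, ha, rfl⟩
    exact hT.1 ha z
  have hQ : ∀ z, ∃ s, IsLUB
      ((fun S : adjointableOps Bᵐᵒᵖ F => rightInner B z ((S : Module.End ℂ F) z)) '' d) s :=
    fun z => WStarAlgebra.exists_isLUB (hd.image _) (hdir' z) ⟨_, hub z⟩
  choose Q hQ using hQ
  let D : d → F →ₗ[ℂ] F := fun i => (T : Module.End ℂ F) - (i : adjointableOps Bᵐᵒᵖ F)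
  -- The gap between the form of `T` and the pointwise supremum `Q`. It is a weak limit of the forms
  -- of `T - S` with `S` in `d`, hence comes from a bounded sesquilinear form, and self-duality
  -- turns it into a symmetric operator `R`. Then `T - R` is still an upper bound of `d`, so `T ≤ T
  -- - R` and `q` vanishes.
  let q : F → B := fun z => rightInner B z ((T : Module.End ℂ F) z) - Q z
  have hlim : ∀ ω ∈ orderContinuous B, ∀ z,
      Tendsto (fun i => ω (rightInner B z (D i z))) atTop (𝓝 (ω (q z))) := by
    intro ω hω z
    have h1 := tendsto_of_mem_orderContinuous hω
      (x := fun i : d => rightInner B z (((i : adjointableOps Bᵐᵒᵖ F) : Module.End ℂ F) z))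
      (fun a b h => hmono z h) (s := Q z) (by
        have := hQ z
        rwa [Set.image_eq_range] at this)
    have h2 := h1.const_sub (ω (rightInner B z ((T : Module.End ℂ F) z)))
    simp only [← map_sub] at h2
    simpa only [D, q, LinearMap.sub_apply, map_sub] using h2
  have hlim' : ∀ ω ∈ orderContinuous B, ∀ x y,
      Tendsto (fun i => ω (rightInner B x (D i y))) atTop (𝓝 (ω (polarization q x y))) := by
    intro ω hω x y
    simpa only [polarization_rightInner] using tendsto_polarization (hlim ω hω) x y
  have hext : ∀ {a b : B}, (∀ ω ∈ orderContinuous B, ∃ u : d → ℂ,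
      Tendsto u atTop (𝓝 (ω a)) ∧ Tendsto u atTop (𝓝 (ω b))) → a = b := fun h =>
    WStarAlgebra.ext_orderContinuous fun ω hω => by
      obtain ⟨u, h1, h2⟩ := h ω hω
      exact tendsto_nhds_unique h1 h2
  have hq0 : ∀ z, 0 ≤ q z := fun z => sub_nonneg.mpr ((hQ z).2 (hub z))
  have hqdiag : ∀ z, polarization q z z = q z := fun z =>
    hext fun ω hω => ⟨_, hlim' ω hω z z, hlim ω hω z⟩
  have hbound : ∃ K, 0 ≤ K ∧ ∀ z, ‖q z‖ ≤ K * ‖z‖ ^ 2 := by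
    obtain ⟨i⟩ := ‹Nonempty d›
    obtain ⟨S, hS⟩ := adjointableOps.exists_isAdjointPair (T - (i : adjointableOps Bᵐᵒᵖ F))
    let D' : F →L[ℂ] F := ⟨D i, hS.continuous⟩
    refine ⟨‖D'‖, norm_nonneg _, fun z => ?_⟩
    have h1 : q z ≤ rightInner B z (D i z) := by
      change _ - _ ≤ rightInner B z ((T : Module.End ℂ F) z - _)
      rw [map_sub]
      exact sub_le_sub_left ((hQ z).1 ⟨i, i.2, rfl⟩) _
    refine (CStarAlgebra.norm_le_norm_of_nonneg_of_le (hq0 z) h1).trans ?_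
    rw [rightInner_apply, MulOpposite.norm_unop]
    refine (CStarModule.norm_inner_le F).trans ?_
    calc ‖z‖ * ‖D' z‖ ≤ ‖z‖ * (‖D'‖ * ‖z‖) := by gcongr; exact D'.le_opNorm z
      _ = _ := by ring
  obtain ⟨K, hK0, hK⟩ := hbound
  obtain ⟨R, hR⟩ := hF.exists_operator (r := polarization q)
    (fun x y y' => hext fun ω hω => ⟨_, hlim' ω hω x (y + y'), by
      simpa only [map_add] using (hlim' ω hω x y).add (hlim' ω hω x y')⟩)
    (fun x c y => hext fun ω hω => ⟨_, hlim' ω hω x (c • y), by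
      simpa only [map_smul] using (hlim' ω hω x y).const_smul c⟩)
    (fun x y b => hext fun ω hω => ⟨_, hlim' ω hω x (op b • y), by
      have hD : ∀ i, D i (op b • y) = op b • D i y := fun i => by
        obtain ⟨S, hS⟩ := adjointableOps.exists_isAdjointPair (T - (i : adjointableOps Bᵐᵒᵖ F))
        exact hS.map_op_smul b y
      -- Right linearity of the limit form uses convergence against the functional `ω (· b)`, which
      -- is again order continuous.
      have := hlim' _ (conjFunctional_mem hω 1 b) x y
      simpa only [conjFunctional_apply, star_one, one_mul, hD, rightInner_op_smul_right] using this⟩)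
    (fun x x' y => hext fun ω hω => ⟨_, hlim' ω hω (x + x') y, by
      simpa only [map_add, rightInner_add_left] using (hlim' ω hω x y).add (hlim' ω hω x' y)⟩)
    (fun x c y => hext fun ω hω => ⟨_, hlim' ω hω (c • x) y, by
      simpa only [map_smul, rightInner_smul_left] using (hlim' ω hω x y).const_smul (conj c)⟩)
    (norm_polarization_le hK hK0) hK0
  have hRq : ∀ z, rightInner B (R z) z = q z := fun z => by rw [← hR, hqdiag]
  have hRq' : ∀ z, rightInner B z (R z) = q z := fun z => by
    rw [← star_rightInner, hRq, (IsSelfAdjoint.of_nonneg (hq0 z)).star_eq]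
  have hRR : IsAdjointPair B R R := isAdjointPair_self_of_diag fun z => by rw [hRq, hRq']
  have hle : T ≤ T - ⟨R, hRR.mem_adjointableOps⟩ := hT.2 fun i hi => by
    rw [adjointableOps.le_iff]
    intro z
    change _ ≤ rightInner B z ((T : Module.End ℂ F) z - R z)
    rw [map_sub, hRq', sub_sub_cancel]
    exact (hQ z).1 ⟨i, hi, rfl⟩
  have hqz : q z = 0 := by
    refine le_antisymm ?_ (hq0 z)
    have h1 : rightInner B z ((T : Module.End ℂ F) z)
      ≤ rightInner B z ((T : Module.End ℂ F) z - R z) := hle z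
    rw [map_sub, hRq'] at h1
    simpa using h1
  rw [sub_eq_zero.mp hqz]
  exact hQ z

theorem IsSelfDual.comp_rightInner_mem (hF : IsSelfDual B F) {ω : B →ₗ[ℂ] ℂ}
    (hω : ω ∈ orderContinuous B) (z : F) :
    ω ∘ₗ rightInner B z ∘ₗ LinearMap.applyₗ z ∘ₗ (adjointableOps Bᵐᵒᵖ F).val.toLinearMap
      ∈ orderContinuous (adjointableOps Bᵐᵒᵖ F) := by
  intro d hd hdir T hT ε hε
  have : DirectedOn (· ≤ ·)
      ((fun S : adjointableOps Bᵐᵒᵖ F => rightInner B z ((S : Module.End ℂ F) z)) '' d) := by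
    rintro _ ⟨a, ha, rfl⟩ _ ⟨b, hb, rfl⟩
    obtain ⟨c, hc, h1, h2⟩ := hdir a ha b hb
    exact ⟨_, ⟨c, hc, rfl⟩, h1 z, h2 z⟩
  obtain ⟨_, ⟨a, ha, rfl⟩, H⟩ := hω _ (hd.image _) this _ (hF.isLUB_rightInner hd hdir hT z) ε hε
  exact ⟨a, ha, fun b hb hab => H _ ⟨b, hb, rfl⟩ (hab z)⟩

end SelfDual

/-! ### The module `B ⊕ E`. -/

section Sum

variable (B : Type u) [CStarAlgebra B] [PartialOrder B] [StarOrderedRing B]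
  (E : Type v) [NormedAddCommGroup E] [NormedSpace ℂ E] [Module Bᵐᵒᵖ E] [CStarModule Bᵐᵒᵖ E]

/-- The inclusion of the first summand of `B ⊕ E`. -/
noncomputable def sumInl : Bᵐᵒᵖ →ₗ[ℂ] C⋆ᵐᵒᵈ(Bᵐᵒᵖ, Bᵐᵒᵖ × E) := LinearMap.inl ℂ Bᵐᵒᵖ E

/-- The inclusion of the second summand of `B ⊕ E`. -/
noncomputable def sumInr : E →ₗ[ℂ] C⋆ᵐᵒᵈ(Bᵐᵒᵖ, Bᵐᵒᵖ × E) := LinearMap.inr ℂ Bᵐᵒᵖ E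

/-- The projection onto the first summand of `B ⊕ E`. -/
noncomputable def sumFst : C⋆ᵐᵒᵈ(Bᵐᵒᵖ, Bᵐᵒᵖ × E) →ₗ[ℂ] Bᵐᵒᵖ := LinearMap.fst ℂ Bᵐᵒᵖ E

/-- The projection onto the second summand of `B ⊕ E`. -/
noncomputable def sumSnd : C⋆ᵐᵒᵈ(Bᵐᵒᵖ, Bᵐᵒᵖ × E) →ₗ[ℂ] E := LinearMap.snd ℂ Bᵐᵒᵖ E

variable {B E}

theorem rightInner_sum (p q : C⋆ᵐᵒᵈ(Bᵐᵒᵖ, Bᵐᵒᵖ × E)) :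
    rightInner B p q = rightInner B (sumFst B E p) (sumFst B E q)
      + rightInner B (sumSnd B E p) (sumSnd B E q) := rfl

theorem isAdjointPair_sumInl : IsAdjointPair B (sumInl B E) (sumFst B E) := fun x y => by
  rw [rightInner_sum]
  change _ + rightInner B (0 : E) _ = _
  rw [rightInner_zero_left, add_zero]
  rfl

theorem isAdjointPair_sumInr : IsAdjointPair B (sumInr B E) (sumSnd B E) := fun x y => by
  rw [rightInner_sum]
  change rightInner B (0 : Bᵐᵒᵖ) _ + _ = _
  rw [rightInner_zero_left, zero_add]
  rfl

theorem sumFst_comp_sumInl : sumFst B E ∘ₗ sumInl B E = LinearMap.id := rfl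

theorem sumSnd_comp_sumInr : sumSnd B E ∘ₗ sumInr B E = LinearMap.id := rfl

theorem sumFst_comp_sumInr : sumFst B E ∘ₗ sumInr B E = 0 := rfl

variable [CompleteSpace E]

/-- On the summand `B` a right linear map is left multiplication by its value at `1`; on `E`
self-duality applies. -/
theorem IsSelfDual.sum (h : IsSelfDual B E) : IsSelfDual B C⋆ᵐᵒᵈ(Bᵐᵒᵖ, Bᵐᵒᵖ × E) := by
  intro Φ hΦ
  obtain ⟨x, hx⟩ := h (Φ ∘L ⟨sumInr B E, isAdjointPair_sumInr.continuous⟩) fun y b => by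
    exact (congrArg Φ (isAdjointPair_sumInr.map_op_smul b y)).trans (hΦ _ b)
  refine ⟨sumInl B E (op (star (Φ (sumInl B E 1)))) + sumInr B E x, fun p => ?_⟩
  have hp : p = op (unop (sumFst B E p)) • sumInl B E 1 + sumInr B E (sumSnd B E p) := by
    rw [← isAdjointPair_sumInl.map_op_smul, op_unop, smul_eq_mul, mul_one]
    refine Prod.ext ?_ ?_
    · exact (add_zero (sumFst B E p)).symm
    · exact (zero_add (sumSnd B E p)).symm
  conv_lhs => rw [hp, map_add, hΦ]
  rw [rightInner_add_left, isAdjointPair_sumInl, isAdjointPair_sumInr, ← hx]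
  congr 1
  conv_rhs => rw [← op_unop (sumFst B E p), rightInner_op, star_star]

end Sum

/-! ### The normal action of the adjointable operators on `F ⊗ H`. -/

section FamilyMap

variable {B : Type u} [CStarAlgebra B] [PartialOrder B] [StarOrderedRing B]
  {F : Type*} [NormedAddCommGroup F] [NormedSpace ℂ F] [Module Bᵐᵒᵖ F]
  [CStarModule Bᵐᵒᵖ F] [CompleteSpace F] {J : Type*} (φ : J → B →ₚ[ℂ] ℂ)

variable (F) in
/-- The representation of the adjointable operators on the Hilbert space `FamilySpace φ F`. -/
noncomputable def adjointableRep :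
    adjointableOps Bᵐᵒᵖ F →ₗ[ℂ] (FamilySpace φ F →L[ℂ] FamilySpace φ F) where
  toFun T := familyMap φ (T : Module.End ℂ F)
  map_add' T₁ T₂ := by
    obtain ⟨S₁, h₁⟩ := adjointableOps.exists_isAdjointPair T₁
    obtain ⟨S₂, h₂⟩ := adjointableOps.exists_isAdjointPair T₂
    exact h₁.familyMap_add φ h₂
  map_smul' c T := by
    obtain ⟨S, h⟩ := adjointableOps.exists_isAdjointPair T
    exact h.familyMap_smul φ c

theorem adjointableRep_apply (T : adjointableOps Bᵐᵒᵖ F) :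
    adjointableRep F φ T = familyMap φ (T : Module.End ℂ F) := rfl

theorem inner_adjointableRep (T : adjointableOps Bᵐᵒᵖ F) (f : J →₀ F) :
    ⟪toFamilySpace φ F f, adjointableRep F φ T (toFamilySpace φ F f)⟫_ℂ
      = ∑ j ∈ f.support, φ j (rightInner B (f j) ((T : Module.End ℂ F) (f j))) := by
  obtain ⟨S, h⟩ := adjointableOps.exists_isAdjointPair T
  rw [adjointableRep_apply, h.familyMap_apply, inner_toFamilySpace, familyInner_eq_sum φ subset_rfl]
  simp

theorem monotone_adjointableRep : Monotone (adjointableRep F φ) := by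
  intro T S h
  refine ContinuousLinearMap.le_of_forall_inner_le fun x => ?_
  refine (denseRange_toFamilySpace φ).induction_on (p := fun x =>
    ⟪x, adjointableRep F φ T x⟫_ℂ ≤ ⟪x, adjointableRep F φ S x⟫_ℂ) x
    (isClosed_le (by fun_prop) (by fun_prop)) fun f => ?_
  rw [inner_adjointableRep, inner_adjointableRep]
  exact Finset.sum_le_sum fun j _ => OrderHomClass.mono (φ j) (h (f j))

/-- On a finitely supported `f` the quadratic functional is the sum of the `T ↦ φ j ⟨f j, T f j⟩`,
each order continuous because suprema of adjointable operators on a self-dual module are pointwise.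
-/
theorem IsSelfDual.quadraticFunctional_adjointableRep_mem [WStarAlgebra B] (hF : IsSelfDual B F)
    (hφ : ∀ j, (φ j : B →ₗ[ℂ] ℂ) ∈ orderContinuous B) (ζ : FamilySpace φ F) :
    quadraticFunctional (adjointableRep F φ) ζ ∈ orderContinuous (adjointableOps Bᵐᵒᵖ F) := by
  refine quadraticFunctional_mem_of_dense (monotone_adjointableRep φ)
    (denseRange_toFamilySpace φ) ?_ ζ
  rintro _ ⟨f, rfl⟩
  have : quadraticFunctional (adjointableRep F φ) (toFamilySpace φ F f)
      = ∑ j ∈ f.support, (φ j : B →ₗ[ℂ] ℂ) ∘ₗ rightInner B (f j) ∘ₗ LinearMap.applyₗ (f j) ∘ₗ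
        (adjointableOps Bᵐᵒᵖ F).val.toLinearMap := by
    ext T
    rw [quadraticFunctional_apply, inner_adjointableRep, LinearMap.sum_apply]
    rfl
  rw [this]
  exact Submodule.sum_mem _ fun j _ => hF.comp_rightInner_mem (hφ j) (f j)

end FamilyMap

/-! ### Compression to the linking algebra of `B(G)`. -/

section LinkOp

variable {G : Type*} [NormedAddCommGroup G] [InnerProductSpace ℂ G] [CompleteSpace G]
  {K : Type*} [NormedAddCommGroup K] [InnerProductSpace ℂ K] [CompleteSpace K]
  (w₁ w₂ : G →L[ℂ] K)

/-- The action of the row `(w₁, w₂)` on a column. -/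
noncomputable def rowMap : C⋆ᵐᵒᵈ((G →L[ℂ] G)ᵐᵒᵖ, (G →L[ℂ] G)ᵐᵒᵖ × (G →L[ℂ] G)ᵐᵒᵖ) →ₗ[ℂ] (G →L[ℂ] K) where
  toFun p := w₁ ∘L unop (sumFst (G →L[ℂ] G) (G →L[ℂ] G)ᵐᵒᵖ p)
    + w₂ ∘L unop (sumSnd (G →L[ℂ] G) (G →L[ℂ] G)ᵐᵒᵖ p)
  map_add' p q := by
    simp only [map_add, unop_add, ContinuousLinearMap.comp_add]
    abel
  map_smul' c p := by
    simp only [map_smul, unop_smul, ContinuousLinearMap.comp_smul, smul_add, RingHom.id_apply]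

/-- The action of the adjoint of the row `(w₁, w₂)`. -/
noncomputable def rowAdjoint : (G →L[ℂ] K) →ₗ[ℂ]
    C⋆ᵐᵒᵈ((G →L[ℂ] G)ᵐᵒᵖ, (G →L[ℂ] G)ᵐᵒᵖ × (G →L[ℂ] G)ᵐᵒᵖ) where
  toFun t := sumInl (G →L[ℂ] G) (G →L[ℂ] G)ᵐᵒᵖ (op (w₁.adjoint ∘L t))
    + sumInr (G →L[ℂ] G) (G →L[ℂ] G)ᵐᵒᵖ (op (w₂.adjoint ∘L t))
  map_add' s t := by
    simp only [map_add, op_add, ContinuousLinearMap.comp_add]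
    abel
  map_smul' c t := by
    simp only [map_smul, op_smul, ContinuousLinearMap.comp_smul, smul_add, RingHom.id_apply]

theorem rightInner_rowAdjoint (p : C⋆ᵐᵒᵈ((G →L[ℂ] G)ᵐᵒᵖ, (G →L[ℂ] G)ᵐᵒᵖ × (G →L[ℂ] G)ᵐᵒᵖ))
    (t : G →L[ℂ] K) :
    rightInner (G →L[ℂ] G) p (rowAdjoint w₁ w₂ t) = (rowMap w₁ w₂ p).adjoint ∘L t := by
  have h1 : rightInner (G →L[ℂ] G) p (rowAdjoint w₁ w₂ t)
      = star (unop (sumFst (G →L[ℂ] G) (G →L[ℂ] G)ᵐᵒᵖ p)) * (w₁.adjoint ∘L t)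
        + star (unop (sumSnd (G →L[ℂ] G) (G →L[ℂ] G)ᵐᵒᵖ p)) * (w₂.adjoint ∘L t) := by
    change rightInner _ p (_ + _) = _
    rw [map_add, ← isAdjointPair_sumInl.symm p, ← isAdjointPair_sumInr.symm p]
    rfl
  rw [h1]
  change _ = (w₁ ∘L _ + w₂ ∘L _).adjoint ∘L t
  rw [map_add, ContinuousLinearMap.adjoint_comp, ContinuousLinearMap.adjoint_comp,
    ContinuousLinearMap.add_comp]
  rfl

/-- The compression of an operator on `K` to the linking algebra of `B(G)`. -/
noncomputable def linkCompression :
    (K →L[ℂ] K) →ₗ[ℂ] LinkingAlgebra (G →L[ℂ] G)ᵐᵒᵖ (G →L[ℂ] G)ᵐᵒᵖ where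
  toFun A := ⟨rowAdjoint w₁ w₂ ∘ₗ (ContinuousLinearMap.compL ℂ G K K A).toLinearMap ∘ₗ rowMap w₁ w₂,
    IsAdjointPair.mem_adjointableOps (S := rowAdjoint w₁ w₂ ∘ₗ
      (ContinuousLinearMap.compL ℂ G K K A.adjoint).toLinearMap ∘ₗ rowMap w₁ w₂) fun p q => by
        rw [← star_rightInner]
        simp only [LinearMap.comp_apply, rightInner_rowAdjoint]
        change ((rowMap w₁ w₂ q).adjoint ∘L (A ∘L rowMap w₁ w₂ p)).adjoint
          = (rowMap w₁ w₂ p).adjoint ∘L (A.adjoint ∘L rowMap w₁ w₂ q)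
        rw [ContinuousLinearMap.adjoint_comp, ContinuousLinearMap.adjoint_comp,
          ContinuousLinearMap.adjoint_adjoint, ContinuousLinearMap.comp_assoc]⟩
  map_add' A A' := by
    refine Subtype.ext (LinearMap.ext fun p => ?_)
    exact (congrArg (rowAdjoint w₁ w₂) (ContinuousLinearMap.add_comp A A' (rowMap w₁ w₂ p))).trans
      (map_add _ _ _)
  map_smul' c A := by
    refine Subtype.ext (LinearMap.ext fun p => ?_)
    exact (congrArg (rowAdjoint w₁ w₂) (ContinuousLinearMap.smul_comp c A (rowMap w₁ w₂ p))).trans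
      (map_smul _ _ _)

theorem linkCompression_apply (A : K →L[ℂ] K) (p) :
    (linkCompression w₁ w₂ A : Module.End ℂ _) p = rowAdjoint w₁ w₂ (A ∘L rowMap w₁ w₂ p) := rfl

theorem inner_linkCompression (A : K →L[ℂ] K) (p) (g : G) :
    ⟪g, rightInner (G →L[ℂ] G) p ((linkCompression w₁ w₂ A : Module.End ℂ _) p) g⟫_ℂ
      = ⟪rowMap w₁ w₂ p g, A (rowMap w₁ w₂ p g)⟫_ℂ := by
  rw [linkCompression_apply, rightInner_rowAdjoint, ContinuousLinearMap.comp_apply,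
    ContinuousLinearMap.adjoint_inner_right, ContinuousLinearMap.comp_apply]

/-- The order of the linking algebra is tested by quadratic forms at a column `p` and a vector `g`.
There the compression of `Λ a` has the quadratic form of `Λ a` at the vector `rowMap w₁ w₂ p g`, so
suprema can be checked on `K`. -/
theorem scottContinuous_linkCompression_comp {M : Type*} [AddCommGroup M] [Module ℂ M]
    [PartialOrder M] {Λ : M →ₗ[ℂ] (K →L[ℂ] K)} (hΛ : Monotone Λ)
    (h : ∀ ζ, quadraticFunctional Λ ζ ∈ orderContinuous M) :
    ScottContinuous (linkCompression w₁ w₂ ∘ₗ Λ) := by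
  intro d hd hdir s hs
  refine ⟨?_, fun S hS => adjointableOps.le_iff.mpr fun p =>
    ContinuousLinearMap.le_of_forall_inner_le fun g => ?_⟩
  · rintro _ ⟨a, ha, rfl⟩
    refine adjointableOps.le_iff.mpr fun p => ContinuousLinearMap.le_of_forall_inner_le fun g => ?_
    rw [LinearMap.comp_apply, LinearMap.comp_apply, inner_linkCompression, inner_linkCompression]
    exact ContinuousLinearMap.inner_le_of_le (hΛ (hs.1 ha)) _
  · rw [LinearMap.comp_apply, inner_linkCompression]
    refine inner_le_of_isLUB (h _) hd hdir hs fun a ha => ?_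
    rw [← inner_linkCompression]
    exact ContinuousLinearMap.inner_le_of_le (adjointableOps.le_iff.mp (hS ⟨a, ha, rfl⟩) p) g

/-- The compression is the matrix with entries `wᵢ⋆ A wⱼ`; the hypotheses kill the second column and
the upper left entry and leave `t` in the lower left. -/
theorem linkCompression_eq_linkingCorner {w₁ w₂ : G →L[ℂ] K} {A : K →L[ℂ] K} {s : G →L[ℂ] K}
    {t : G →L[ℂ] G} (h₁ : A ∘L w₁ = s) (h₂ : A ∘L w₂ = 0) (h₃ : w₁.adjoint ∘L s = 0)
    (h₄ : w₂.adjoint ∘L s = t) : linkCompression w₁ w₂ A = linkingCorner (op t) := by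
  refine Subtype.ext (LinearMap.ext fun p => ?_)
  have hrow : A ∘L rowMap w₁ w₂ p = s ∘L unop (sumFst (G →L[ℂ] G) (G →L[ℂ] G)ᵐᵒᵖ p) := by
    change A ∘L (w₁ ∘L _ + w₂ ∘L _) = _
    rw [ContinuousLinearMap.comp_add, ← ContinuousLinearMap.comp_assoc, h₁,
      ← ContinuousLinearMap.comp_assoc, h₂, ContinuousLinearMap.zero_comp, add_zero]
  rw [linkCompression_apply, hrow]
  change sumInl (G →L[ℂ] G) (G →L[ℂ] G)ᵐᵒᵖ (op (w₁.adjoint ∘L _))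
    + sumInr (G →L[ℂ] G) (G →L[ℂ] G)ᵐᵒᵖ (op (w₂.adjoint ∘L _)) = sumInr (G →L[ℂ] G) (G →L[ℂ] G)ᵐᵒᵖ _
  rw [← ContinuousLinearMap.comp_assoc, h₃, ← ContinuousLinearMap.comp_assoc, h₄,
    ContinuousLinearMap.zero_comp, op_zero, map_zero, zero_add]
  rfl

/-- The map of linking algebras is `Λ` followed by compression along `v₁` and `v₂ U⁻¹`. As `v₁` and
`v₂` are isometries with orthogonal ranges, the corner `v₂ (c x) v₁⋆` becomes `U (c x)`. -/
theorem isNormalModuleMap_of_compression {A : Type*} {E : Type*}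
    [CStarAlgebra A] [PartialOrder A] [StarOrderedRing A] [NormedAddCommGroup E] [NormedSpace ℂ E]
    [Module A E] [CStarModule A E] {L : Type*} [NormedAddCommGroup L] [InnerProductSpace ℂ L]
    [CompleteSpace L] {Λ : LinkingAlgebra A E →ₗ[ℂ] (K →L[ℂ] K)} (hΛ : Monotone Λ)
    (h : ∀ ζ, quadraticFunctional Λ ζ ∈ orderContinuous (LinkingAlgebra A E))
    {v₁ : G →L[ℂ] K} {v₂ : L →L[ℂ] K} {c : E → G →L[ℂ] L}
    (h₁₁ : v₁.adjoint ∘L v₁ = ContinuousLinearMap.id ℂ G)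
    (h₂₂ : v₂.adjoint ∘L v₂ = ContinuousLinearMap.id ℂ L) (h₁₂ : v₁.adjoint ∘L v₂ = 0)
    (U : L ≃ₗᵢ[ℂ] G) (hc : ∀ x, Λ (linkingCorner x) = v₂ ∘L c x ∘L v₁.adjoint) :
    IsNormalModuleMap (A := A) (E := E) (C := (G →L[ℂ] G)ᵐᵒᵖ) (F := (G →L[ℂ] G)ᵐᵒᵖ)
      (fun x => op ((U : L →L[ℂ] G) ∘L c x)) := by
  have hP := scottContinuous_linkCompression_comp v₁ (v₂ ∘L (U.symm : G →L[ℂ] L)) hΛ h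
  have hP' := hP.isNormalMap
  refine ⟨_, hP', fun x => ?_⟩
  rw [LinearMap.comp_apply, hc]
  refine linkCompression_eq_linkingCorner (s := v₂ ∘L c x) ?_ ?_ ?_ ?_
  · rw [ContinuousLinearMap.comp_assoc, ContinuousLinearMap.comp_assoc, h₁₁,
      ContinuousLinearMap.comp_id]
  · rw [ContinuousLinearMap.comp_assoc, ContinuousLinearMap.comp_assoc,
      ← ContinuousLinearMap.comp_assoc v₁.adjoint, h₁₂, ContinuousLinearMap.zero_comp,
      ContinuousLinearMap.comp_zero, ContinuousLinearMap.comp_zero]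
  · rw [← ContinuousLinearMap.comp_assoc, h₁₂, ContinuousLinearMap.zero_comp]
  · rw [ContinuousLinearMap.adjoint_comp, LinearIsometryEquiv.adjoint_eq_symm,
      LinearIsometryEquiv.symm_symm, ContinuousLinearMap.comp_assoc,
      ← ContinuousLinearMap.comp_assoc v₂.adjoint, h₂₂, ContinuousLinearMap.id_comp]

end LinkOp

/-! ### Creation operators and the representation of `E`. -/

section Creation

variable {B : Type u} [CStarAlgebra B] [PartialOrder B] [StarOrderedRing B]
  {E : Type v} [NormedAddCommGroup E] [NormedSpace ℂ E] [Module Bᵐᵒᵖ E] [CStarModule Bᵐᵒᵖ E]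

/-- The adjointable map `b ↦ x b`. -/
noncomputable def creationMap : E →ₗ[ℂ] Bᵐᵒᵖ →ₗ[ℂ] E :=
  LinearMap.mk₂ ℂ (fun x a => a • x) (fun x y a => smul_add a x y)
    (fun c x a => ext_rightInner (B := B) fun z => by
      rw [← op_unop a, rightInner_op_smul_right, map_smul, map_smul, rightInner_op_smul_right,
        smul_mul_assoc])
    (fun x a b => add_smul a b x)
    (fun c x a => ext_rightInner (B := B) fun z => by
      rw [← op_unop a, ← op_smul, rightInner_op_smul_right, map_smul, rightInner_op_smul_right,
        mul_smul_comm])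

theorem creationMap_apply (x : E) (a : Bᵐᵒᵖ) : creationMap x a = a • x := rfl

variable (B) in
/-- The adjointable map `y ↦ ⟨x, y⟩`. -/
noncomputable def annihilationMap (x : E) : E →ₗ[ℂ] Bᵐᵒᵖ :=
  (MulOpposite.opLinearEquiv ℂ).toLinearMap ∘ₗ rightInner B x

theorem annihilationMap_apply (x y : E) : annihilationMap B x y = op (rightInner B x y) := rfl

theorem isAdjointPair_creationMap (x : E) :
    IsAdjointPair B (creationMap x) (annihilationMap B x) := fun a y => by
  rw [creationMap_apply, annihilationMap_apply, ← op_unop a, rightInner_op_smul_left, rightInner_op]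

theorem annihilationMap_comp_creationMap (x y : E) :
    annihilationMap B x ∘ₗ creationMap y = mulLeftHom B (rightInner B x y) :=
  LinearMap.ext fun a => by
    rw [LinearMap.comp_apply, creationMap_apply, annihilationMap_apply, ← op_unop a,
      rightInner_op_smul_right, mulLeftHom_apply, op_mul]

theorem WStarCorrespondence.creationMap_bimodule (X : WStarCorrespondence B E) (b : B) (x : E)
    (b' : B) : creationMap (X.lact b (op b' • x))
      = X.lact b ∘ₗ creationMap x ∘ₗ mulLeftHom B b' :=
  LinearMap.ext fun a => by
    rw [LinearMap.comp_apply, LinearMap.comp_apply, creationMap_apply, creationMap_apply,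
      mulLeftHom_apply, mul_smul, ← op_unop a, (X.isAdjointPair b).map_op_smul,
      (X.isAdjointPair b).map_op_smul, (X.isAdjointPair b).map_op_smul]

theorem linkingCorner_eq (x : E) : (linkingCorner x : LinkingAlgebra Bᵐᵒᵖ E).1
    = sumInr B E ∘ₗ creationMap x ∘ₗ sumFst B E := rfl

variable [CompleteSpace E] {J : Type w} {φ : J → B →ₚ[ℂ] ℂ}
  (U : FamilySpace φ E ≃ₗᵢ[ℂ] FamilySpace φ Bᵐᵒᵖ)

/-- The operators `η(x)` determined by an identification of `E ⊗ H` with `H`. -/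
noncomputable def creationRep : E →ₗ[ℂ] (FamilySpace φ Bᵐᵒᵖ →L[ℂ] FamilySpace φ Bᵐᵒᵖ) where
  toFun x := (U : FamilySpace φ E →L[ℂ] FamilySpace φ Bᵐᵒᵖ) ∘L familyMap φ (creationMap x)
  map_add' x y := by
    rw [map_add, (isAdjointPair_creationMap x).familyMap_add φ (isAdjointPair_creationMap y),
      ContinuousLinearMap.comp_add]
  map_smul' c x := by
    rw [map_smul, (isAdjointPair_creationMap x).familyMap_smul φ, ContinuousLinearMap.comp_smul,
      RingHom.id_apply]

theorem creationRep_apply (x : E) : creationRep U x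
    = (U : FamilySpace φ E →L[ℂ] FamilySpace φ Bᵐᵒᵖ) ∘L familyMap φ (creationMap x) := rfl

theorem adjoint_comp_self :
    (U : FamilySpace φ E →L[ℂ] FamilySpace φ Bᵐᵒᵖ).adjoint
      ∘L (U : FamilySpace φ E →L[ℂ] FamilySpace φ Bᵐᵒᵖ) = ContinuousLinearMap.id ℂ _ := by
  rw [LinearIsometryEquiv.adjoint_eq_symm]
  ext x
  simp

theorem star_creationRep_mul (x y : E) : star (creationRep U x) * creationRep U y
    = familyMap φ (mulLeftHom B (rightInner B x y)) := by
  rw [← annihilationMap_comp_creationMap,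
    (isAdjointPair_creationMap x).symm.familyMap_comp φ (isAdjointPair_creationMap y),
    ← (isAdjointPair_creationMap x).adjoint_familyMap φ, creationRep_apply, creationRep_apply,
    ContinuousLinearMap.star_eq_adjoint, ContinuousLinearMap.adjoint_comp]
  change (_ ∘L _) ∘L (_ ∘L _) = _
  rw [ContinuousLinearMap.comp_assoc, ← ContinuousLinearMap.comp_assoc _ _ (familyMap φ _),
    adjoint_comp_self, ContinuousLinearMap.id_comp]

theorem familyMap_zero {F F' : Type*} [NormedAddCommGroup F] [NormedSpace ℂ F] [Module Bᵐᵒᵖ F]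
    [CStarModule Bᵐᵒᵖ F] [NormedAddCommGroup F'] [NormedSpace ℂ F'] [Module Bᵐᵒᵖ F']
    [CStarModule Bᵐᵒᵖ F'] [CompleteSpace F] [CompleteSpace F'] (φ : J → B →ₚ[ℂ] ℂ) :
    familyMap φ (0 : F →ₗ[ℂ] F') = 0 := by
  have h : IsAdjointPair B (0 : F →ₗ[ℂ] F') 0 := fun x y => by simp
  have := h.familyMap_smul φ 0
  rwa [zero_smul, zero_smul] at this

variable (E φ) in
theorem sumFst_sumInl_family :
    familyMap φ (sumFst B E) ∘L familyMap φ (sumInl B E) = ContinuousLinearMap.id ℂ _ := by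
  rw [← isAdjointPair_sumInl.symm.familyMap_comp φ isAdjointPair_sumInl, sumFst_comp_sumInl,
    familyMap_id]

variable (E φ) in
theorem sumSnd_sumInr_family :
    familyMap φ (sumSnd B E) ∘L familyMap φ (sumInr B E) = ContinuousLinearMap.id ℂ _ := by
  rw [← isAdjointPair_sumInr.symm.familyMap_comp φ isAdjointPair_sumInr, sumSnd_comp_sumInr,
    familyMap_id]

variable (E φ) in
theorem sumFst_sumInr_family : familyMap φ (sumFst B E) ∘L familyMap φ (sumInr B E) = 0 := by
  rw [← isAdjointPair_sumInl.symm.familyMap_comp φ isAdjointPair_sumInr, sumFst_comp_sumInr,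
    familyMap_zero]

variable (φ) in
theorem adjointableRep_linkingCorner (x : E) :
    adjointableRep C⋆ᵐᵒᵈ(Bᵐᵒᵖ, Bᵐᵒᵖ × E) φ (linkingCorner x) =
      familyMap φ (sumInr B E) ∘L familyMap φ (creationMap x) ∘L familyMap φ (sumFst B E) := by
  rw [adjointableRep_apply, linkingCorner_eq, isAdjointPair_sumInr.familyMap_comp φ
    ((isAdjointPair_creationMap x).comp isAdjointPair_sumInl.symm),
    (isAdjointPair_creationMap x).familyMap_comp φ isAdjointPair_sumInl.symm]

/-- The linking algebra acts on `(B ⊕ E) ⊗ H`, where `H` and `E ⊗ H` sit as orthogonal summands and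
the corner of `x` acts as its creation operator. Self-duality of `B ⊕ E` makes this action normal.
-/
theorem isNormalModuleMap_creationRep [WStarAlgebra B] (hE : IsSelfDual B E)
    (hφ : ∀ j, (φ j : B →ₗ[ℂ] ℂ) ∈ orderContinuous B) :
    IsNormalModuleMap (A := Bᵐᵒᵖ) (E := E)
      (C := (FamilySpace φ Bᵐᵒᵖ →L[ℂ] FamilySpace φ Bᵐᵒᵖ)ᵐᵒᵖ)
      (F := (FamilySpace φ Bᵐᵒᵖ →L[ℂ] FamilySpace φ Bᵐᵒᵖ)ᵐᵒᵖ) (fun x => op (creationRep U x)) := by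
  refine isNormalModuleMap_of_compression (K := FamilySpace φ C⋆ᵐᵒᵈ(Bᵐᵒᵖ, Bᵐᵒᵖ × E))
    (Λ := adjointableRep C⋆ᵐᵒᵈ(Bᵐᵒᵖ, Bᵐᵒᵖ × E) φ) (monotone_adjointableRep φ)
    (hE.sum.quadraticFunctional_adjointableRep_mem φ hφ) (v₁ := familyMap φ (sumInl B E))
    (v₂ := familyMap φ (sumInr B E)) (c := fun x => familyMap φ (creationMap x)) ?_ ?_ ?_ U ?_
  · rw [isAdjointPair_sumInl.adjoint_familyMap φ, sumFst_sumInl_family]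
  · rw [isAdjointPair_sumInr.adjoint_familyMap φ, sumSnd_sumInr_family]
  · rw [isAdjointPair_sumInl.adjoint_familyMap φ, sumFst_sumInr_family]
  · intro x
    rw [isAdjointPair_sumInl.adjoint_familyMap φ, adjointableRep_linkingCorner]

theorem topologicalClosure_span_creationRep :
    (Submodule.span ℂ {h : FamilySpace φ Bᵐᵒᵖ | ∃ (x : E) (g : FamilySpace φ Bᵐᵒᵖ),
      h = creationRep U x g}).topologicalClosure = ⊤ := by
  rw [eq_top_iff]
  intro z _
  rw [← U.apply_symm_apply z]
  refine (denseRange_toFamilySpace φ).induction_on (p := fun y => U y ∈ _) (U.symm z)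
    ((Submodule.isClosed_topologicalClosure _).preimage U.continuous) fun f => ?_
  induction f using Finsupp.induction_linear with
  | zero => rw [map_zero, map_zero]; exact Submodule.zero_mem _
  | add f g hf hg => rw [map_add, map_add]; exact Submodule.add_mem _ hf hg
  | single j y =>
    refine Submodule.le_topologicalClosure _ (Submodule.subset_span
      -- The creation operator of `y` maps the class of `1` in the `j`-th summand to the class of
      -- `y`, and `U` maps total sets to total sets.
      ⟨y, toFamilySpace φ Bᵐᵒᵖ (Finsupp.single j 1), ?_⟩)
    rw [creationRep_apply, ContinuousLinearMap.comp_apply,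
      (isAdjointPair_creationMap y).familyMap_apply, Finsupp.mapRange.linearMap_apply,
      Finsupp.mapRange_single, creationMap_apply, one_smul]
    rfl

end Creation

theorem WStarCorrespondence.exists_representation {B : Type u} [CStarAlgebra B] [PartialOrder B] [StarOrderedRing B]
    [WStarAlgebra B] {E : Type v} [NormedAddCommGroup E] [NormedSpace ℂ E] [CompleteSpace E]
    [Module Bᵐᵒᵖ E] [CStarModule Bᵐᵒᵖ E] (X : WStarCorrespondence B E) (hX : X.IsFaithful) :
    ∃ (G : Type (max u v)) (_ : NormedAddCommGroup G) (_ : InnerProductSpace ℂ G)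
      (_ : CompleteSpace G) (R : X.Representation G),
      R.IsNormal ∧ R.IsFaithful ∧ R.IsNondegenerate := by
  obtain ⟨κ, hκ, U, hU⟩ := X.exists_unitary hX
  let φ := fun p : {ψ : B →ₗ[ℂ] ℂ // ScottContinuous ψ} × κ => normalStates B p.1
  have hφ : ∀ p, (φ p : B →ₗ[ℂ] ℂ) ∈ orderContinuous B := fun p =>
    scottContinuous_mem_orderContinuous p.1.2
  let π := familyRep φ (mulLeftHom B) isAdjointPair_mulLeftHom
  have hπ : IsNormalRep π := isNormalRep_familyRep _ _ _ fun p x => by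
    have := conjFunctional_self_mem (hφ p) (unop x)
    convert this using 1
    ext b
    change φ p (star (unop x) * unop (x * op b)) = φ p (star (unop x) * b * unop x)
    simp [mul_assoc]
  have hinj : Function.Injective π := by
    refine familyRep_injective _ _ _ (fun a b h => ?_) fun b hb h =>
      eq_zero_of_normalStates hb fun ψ => h (ψ, hκ.some)
    have := LinearMap.congr_fun h 1
    simpa [mulLeftHom_apply] using this
  refine ⟨FamilySpace φ Bᵐᵒᵖ, inferInstance, inferInstance, inferInstance,
    { π := π.toNonUnitalStarAlgHom
      η := creationRep U
      π_nondegenerate := ?_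
      map_bimodule := fun b x b' => ?_
      star_mul := star_creationRep_mul U }, ⟨?_, ?_⟩, ⟨hinj, ?_⟩, ?_⟩
  · rw [eq_top_iff]
    intro z _
    refine Submodule.le_topologicalClosure _ (Submodule.subset_span ⟨1, z, ?_⟩)
    change z = π 1 z
    rw [map_one]
    rfl
  · ext g
    change U (familyMap φ _ g) = familyMap φ (mulLeftHom B b) (U (familyMap φ (creationMap x)
      (familyMap φ (mulLeftHom B b') g)))
    -- Creation operators respect both actions already; the intertwining property of `U` moves the
    -- left action from `E ⊗ H` to `H`.
    rw [X.creationMap_bimodule, (X.isAdjointPair b).familyMap_comp φ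
      ((isAdjointPair_creationMap x).comp (isAdjointPair_mulLeftHom b')),
      (isAdjointPair_creationMap x).familyMap_comp φ (isAdjointPair_mulLeftHom b'), ← hU]
    rfl
  · exact hπ.isNormalMap
  · exact isNormalModuleMap_creationRep U X.selfDual hφ
  · refine (injective_iff_map_eq_zero (creationRep U)).mpr fun x hx => ?_
    have h1 : π (rightInner B x x) = 0 := by
      change familyMap φ _ = 0
      rw [← star_creationRep_mul U, hx, mul_zero]
    exact rightInner_self_eq_zero.mp (hinj (h1.trans (map_zero π).symm))
  · exact topologicalClosure_span_creationRep U

end NormalRepresentation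

theorem theorem8p2 {B : Type u} [CStarAlgebra B] [PartialOrder B] [StarOrderedRing B]
    [WStarAlgebra B] {E : Type v} [NormedAddCommGroup E] [NormedSpace ℂ E] [CompleteSpace E]
    [Module Bᵐᵒᵖ E] [CStarModule Bᵐᵒᵖ E] (X : WStarCorrespondence B E) (hX : X.IsFaithful) :
    ∃ (G : Type (max u v)) (_ : NormedAddCommGroup G) (_ : InnerProductSpace ℂ G)
      (_ : CompleteSpace G) (R : X.Representation G),
      R.IsNormal ∧ R.IsFaithful ∧ R.IsNondegenerate :=
  X.exists_representation hX
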